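/- Consider random access machines (RAMs) with registers of $w$ bits, a read-only input tape and a write-only output tape (one register content per cell), where each instruction takes one unit of time. There are a single RAM program $P$, an integer $k$, a polynomial $p$ and constants $0<c\le C$ such that the following holds for every $n\ge 1$ and every register length $w\ge k(\lfloor\log_2 n\rfloor+1)$; in particular for the register length $w=k(\lfloor\log_2 n\rfloor+1)=\Theta(\log n)$. Let $A$ be a finite list of permutations in $\mathsf{Sym}(n)$, and let the input consist of the number $n$ followed by the permutations in $A$, each of them written as the sequence of its $n$ values in $\{1,\dots,n\}$. Then $P$ outputs a sequence $s_1,\dots,s_m,\mathsf{EOE}$ and halts, where $s_1,\dots,s_m$ are pairwise distinct, $\{s_1,\dots,s_m\}=\langle A\rangle$ is the subgroup of $\mathsf{Sym}(n)$ generated by $A$, each $s_i$ is written as the sequence of its $n$ values, and $\mathsf{EOE}$ is an end-of-enumeration marker. If $t_i$ is the time when $P$ starts with outputting $s_i$ ($1\le i\le m$) and $t_{m+1}$ is the time when it outputs $\mathsf{EOE}$, then - (polynomial preprocessing) $t_1\le p(1+n|A|)$, where $1+n|A|$ is the length of the input; - (delay $\Theta(n)$) $c\,n\le t_{i+1}-t_i\le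 C\,n$ for all $1\le i\le m$. As every $s_i$ consists of $n$ words, this is output-linear delay. -/

import Mathlib

/-! ### A random access machine with registers of bounded length

The machine has registers `r₀, r₁, r₂, …`, each of which holds a natural number below `2 ^ w`, where
`w` is the register length. It has a one-way read-only input tape and a one-way write-only output
tape, both of which hold one word per cell. Every instruction takes one unit of time. -/

namespace RAM

/-- The instructions of the machine. The register numbers, constants and jump targets that occur in
an instruction are fixed in the program. -/
inductive Instr : Type
  /-- `r_d := c` -/
  | const (d c : ℕ)
  /-- `r_d := r_a + r_b` -/
  | add (d a b : ℕ)
  /-- `r_d := max (r_a - r_b) 0` -/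
  | sub (d a b : ℕ)
  /-- `r_d := r_a * r_b` -/
  | mul (d a b : ℕ)
  /-- `r_d := ⌊r_a / r_b⌋` (and `0` if `r_b = 0`) -/
  | div (d a b : ℕ)
  /-- indirect read: `r_d := r_j` where `j` is the content of `r_a` -/
  | load (d a : ℕ)
  /-- indirect write: `r_j := r_b` where `j` is the content of `r_a` -/
  | store (a b : ℕ)
  /-- go to instruction `q` -/
  | jump (q : ℕ)
  /-- go to instruction `q` if `r_a = 0` -/
  | jumpZero (a q : ℕ)
  /-- go to instruction `q` if `r_a < r_b` -/
  | jumpLess (a b q : ℕ)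
  /-- move the next word of the input tape to `r_d`; go to instruction `q` if there is none left -/
  | read (d q : ℕ)
  /-- append the content of `r_a` to the output tape -/
  | write (a : ℕ)

/-- A program is a finite list of instructions, numbered from `0`. -/
abbrev Program : Type := List Instr

/-- A configuration: program counter, register contents, unread part of the input tape. -/
structure Config : Type where
  pc : ℕ
  reg : ℕ → ℕ
  input : List ℕ

/-- Put the value `v` into register `d` (all arithmetic is modulo `2 ^ w`) and go to the next
instruction. -/
def Config.put (w : ℕ) (c : Config) (d v : ℕ) : Config :=
  { c with pc := c.pc + 1, reg := Function.update c.reg d (v % 2 ^ w) }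

/-- The effect of one instruction on a machine with register length `w`. -/
def Instr.exec (w : ℕ) (c : Config) : Instr → Config
  | .const d v => c.put w d v
  | .add d a b => c.put w d (c.reg a + c.reg b)
  | .sub d a b => c.put w d (c.reg a - c.reg b)
  | .mul d a b => c.put w d (c.reg a * c.reg b)
  | .div d a b => c.put w d (c.reg a / c.reg b)
  | .load d a => c.put w d (c.reg (c.reg a))
  | .store a b => c.put w (c.reg a) (c.reg b)
  | .jump q => { c with pc := q }
  | .jumpZero a q => { c with pc := if c.reg a = 0 then q else c.pc + 1 }
  | .jumpLess a b q => { c with pc := if c.reg a < c.reg b then q else c.pc + 1 }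
  | .read d q =>
    match c.input with
    | [] => { c with pc := q }
    | v :: rest => { c.put w d v with input := rest }
  | .write _ => { c with pc := c.pc + 1 }

/-- The machine halts when the program counter points to no instruction of the program. -/
def Halted (P : Program) (c : Config) : Prop := P.length ≤ c.pc

/-- One step of the machine; a halted machine does not move. -/
def step (P : Program) (w : ℕ) (c : Config) : Config :=
  match P[c.pc]? with
  | none => c
  | some instr => instr.exec w c

/-- The configuration after `t` steps on the input tape `x`; initially all registers are `0`. -/
def config (P : Program) (w : ℕ) (x : List ℕ) : ℕ → Config
  | 0 => { pc := 0, reg := fun _ => 0, input := x }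
  | t + 1 => step P w (config P w x t)

/-- The word that is written to the output tape in the step that starts in configuration `c`. -/
def emitted (P : Program) (c : Config) : Option ℕ :=
  match P[c.pc]? with
  | some (.write a) => some (c.reg a)
  | _ => none

/-- The words that are written during the first `T` steps, in order, each paired with the number of
steps carried out before it is written. -/
def outputs (P : Program) (w : ℕ) (x : List ℕ) (T : ℕ) : List (ℕ × ℕ) :=
  (List.range T).filterMap fun t => (emitted P (config P w x t)).map fun v => (t, v)

/-- The end-of-enumeration marker, a single word. -/
def EOE : ℕ := 0

/-- On the input tape `x`, the machine of register length `w` with program `P` enumerates the set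
`S`: it writes (the encodings of) the elements `s₀, …, s_{m-1}` of `S`, every one of them exactly
once, followed by the marker `EOE`, and then halts. Moreover, for `i < m`, `t i` is the time when it
starts with outputting `s_i`, and `t m` is the time when it outputs `EOE`. -/
structure Enumerates {α : Type*} (P : Program) (w : ℕ) (x : List ℕ) (enc : α → List ℕ)
    (S : Set α) (s : List α) (t : ℕ → ℕ) : Prop where
  nodup : s.Nodup
  mem_iff : ∀ a, a ∈ s ↔ a ∈ S
  run : ∃ T, Halted P (config P w x T) ∧
    (outputs P w x T).map Prod.snd = s.flatMap enc ++ [EOE] ∧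
    ∀ i ≤ s.length,
      ((outputs P w x T).map Prod.fst)[((s.take i).flatMap enc).length]? = some (t i)

end RAM

/-- A permutation of `n` points is written as the list of its `n` values, one value from
`{1, …, n}` per word. -/
def permWords {n : ℕ} (g : Equiv.Perm (Fin n)) : List ℕ :=
  List.ofFn fun i => (g i : ℕ) + 1

/-- The input: the degree `n`, followed by the given permutations one after the other. -/
def permInput {n : ℕ} (A : List (Equiv.Perm (Fin n))) : List ℕ :=
  n :: A.flatMap permWords

/-! ### A structured language for the machine -/

namespace RAM

set_option linter.constructorNameAsVariable false

/-! The algorithm is the Schreier–Sims method in the form of Furst, Hopcroft and Luks, followed by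
an odometer that runs through the resulting table. Level `i` of the table holds group elements that
fix every point below `i`, at most one for each preimage of `i`, the identity among them. To sift
`g`, multiply it from the left, level by level, by the entry `V` of level `i` that maps the current
image of `i` back to `i`; if there is none, insert the inverse of the current permutation. In the
end nothing but the identity is left, so `g⁻¹` is a product of entries, one per level, with the
higher levels on the left. Once the generators and all products of two entries have been sifted, the
set of these products is closed under multiplication, and by finiteness it is the generated subgroup
(`Desc.mul_mem`, `desc_eq_closure`). The factorization is unique because an entry is determined by
its preimage (`nodup_prodList`). There are at most `n²` entries, hence at most `n⁴` products, each
sifted in time `O(n²)`.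

For linear delay, the products of the current entries of the levels below `l` are kept for every
`l`. The odometer finds the highest level with an unused entry, makes one composition of two
permutations there and sets all higher levels to the identity. Those levels then share a single
product, so only pointers to a row have to be reset (`rest_step`, `advance_spec`). Search,
composition, reset and output are linear. Conversely, `n` words cannot be written in fewer than `n`
steps.

The concrete program is verified through a small structured language whose executions carry a trace
with one item per machine step. Compiled code produces literally this trace (`Exec.correct`), so
output words and their times can be read off together; `enumerates_of_blocks` converts a trace that
is cut into one bounded block per permutation into the required time bounds. With no generators the
input has length one and the preprocessing time must not depend on `n`; the program then prints the
identity without building a table. -/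

/-- Runs of the machine from `c` to `c'`; the list holds, for every step, the word that is written in
it (if any). -/
def Steps (P : Program) (w : ℕ) : Config → List (Option ℕ) → Config → Prop
  | c, [], c' => c' = c
  | c, o :: tr, c' => emitted P c = o ∧ Steps P w (step P w c) tr c'

theorem Steps.append {P : Program} {w : ℕ} {tr tr' : List (Option ℕ)} {c c' c'' : Config}
    (h : Steps P w c tr c') (h' : Steps P w c' tr' c'') : Steps P w c (tr ++ tr') c'' := by
  induction tr generalizing c with
  | nil => cases h; exact h'
  | cons o tr ih => exact ⟨h.1, ih h.2⟩

theorem Steps.single {P : Program} {w : ℕ} {c : Config} {ins : Instr} (h : P[c.pc]? = some ins)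
    (hw : ∀ a, ins ≠ .write a) : Steps P w c [none] (ins.exec w c) := by
  refine ⟨?_, ?_⟩
  · unfold emitted
    rw [h]
    cases ins <;> simp_all
  · simp [Steps, step, h]

theorem Steps.single_write {P : Program} {w : ℕ} {c : Config} {a : ℕ}
    (h : P[c.pc]? = some (.write a)) :
    Steps P w c [some (c.reg a)] ((Instr.write a).exec w c) := by
  refine ⟨?_, ?_⟩
  · simp [emitted, h]
  · simp [Steps, step, h]

/-- The instructions `code` stand in the program `P` from number `p` on. -/
def CodeAt (P : Program) (p : ℕ) (code : List Instr) : Prop :=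
  ∀ i, ∀ h : i < code.length, P[p + i]? = some code[i]

theorem CodeAt.left {P : Program} {p : ℕ} {l l' : List Instr} (h : CodeAt P p (l ++ l')) :
    CodeAt P p l := by
  intro i hi
  rw [h i (by simp; omega), List.getElem_append_left hi]

theorem CodeAt.right {P : Program} {p : ℕ} {l l' : List Instr} (h : CodeAt P p (l ++ l')) :
    CodeAt P (p + l.length) l' := by
  intro i hi
  have := h (l.length + i) (by simp; omega)
  rw [← add_assoc] at this
  rw [this, List.getElem_append_right (by omega)]
  simp

theorem CodeAt.head {P : Program} {p : ℕ} {i : Instr} {l : List Instr} (h : CodeAt P p (i :: l)) :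
    P[p]? = some i := h 0 (by simp)

theorem CodeAt.tail {P : Program} {p : ℕ} {i : Instr} {l : List Instr} (h : CodeAt P p (i :: l)) :
    CodeAt P (p + 1) l := CodeAt.right (l := [i]) h

/-- The scalar variables of the language. -/
inductive Var
  | N | i | j | e | k | a | b | x | go | r | l
  deriving DecidableEq

/-- The register of a variable. -/
def Var.reg : Var → ℕ
  | N => 1 | i => 2 | j => 3 | e => 4 | k => 5 | a => 6 | b => 7 | x => 8 | go => 9 | r => 10
  | l => 11

theorem Var.reg_injective : Function.Injective Var.reg := by
  intro x y h
  cases x <;> cases y <;> simp_all [Var.reg]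

theorem Var.reg_pos (x : Var) : 0 < x.reg := by cases x <;> simp [Var.reg]

theorem Var.reg_lt (x : Var) : x.reg < 16 := by cases x <;> simp [Var.reg]

/-- The two-dimensional arrays of the language. -/
inductive Arr
  | E | I | G | X | C | Q | R
  deriving DecidableEq

/-- The residue class of the registers of an array. -/
def Arr.off : Arr → ℕ
  | E => 0 | I => 1 | G => 2 | X => 3 | C => 4 | Q => 5 | R => 6

theorem Arr.off_injective : Function.Injective Arr.off := by
  intro x y h
  cases x <;> cases y <;> simp_all [Arr.off]

theorem Arr.off_lt (x : Arr) : x.off < 8 := by cases x <;> simp [Arr.off]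

/-- Expressions; `size` is the number of columns of the arrays. -/
inductive Expr
  | lit (c : ℕ)
  | size
  | var (x : Var)
  | add (e₁ e₂ : Expr)
  | sub (e₁ e₂ : Expr)
  | get (A : Arr) (e₁ e₂ : Expr)

/-- Values of the variables and arrays, unread part of the input. -/
structure Store : Type where
  var : Var → ℕ
  arr : Arr → ℕ → ℕ → ℕ
  inp : List ℕ

/-- The value of an expression; the arrays have `n + 1` columns. -/
def Expr.eval (n : ℕ) (s : Store) : Expr → ℕ
  | lit c => c
  | size => n + 1
  | var x => s.var x
  | add e₁ e₂ => e₁.eval n s + e₂.eval n s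
  | sub e₁ e₂ => e₁.eval n s - e₂.eval n s
  | get A e₁ e₂ => s.arr A (e₁.eval n s) (e₂.eval n s)

/-- The evaluation of the expression respects the bounds of words and arrays. -/
def Expr.Ok (n : ℕ) (s : Store) : Expr → Prop
  | lit c => c ≤ 2
  | size => True
  | var _ => True
  | add e₁ e₂ => e₁.Ok n s ∧ e₂.Ok n s ∧ e₁.eval n s + e₂.eval n s ≤ (n + 1) ^ 2
  | sub e₁ e₂ => e₁.Ok n s ∧ e₂.Ok n s
  | get _ e₁ e₂ => e₁.Ok n s ∧ e₂.Ok n s ∧ e₁.eval n s ≤ (n + 1) ^ 2 ∧ e₂.eval n s < n + 1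

/-- The instructions that turn row number (register `t`) and column number (register `t + 1`) into
the number of a register. -/
def addrCode (A : Arr) (t : ℕ) : List Instr :=
  [.mul t t 0, .add t t (t + 1), .const (t + 1) 8, .mul t t (t + 1), .const (t + 1) (32 + A.off),
    .add t t (t + 1)]

/-- Code that computes an expression in register `t`, with scratch registers above `t`. -/
def Expr.compile (t : ℕ) : Expr → List Instr
  | lit c => [.const t c]
  | size => [.const t 0, .add t t 0]
  | var x => [.const t 0, .add t t x.reg]
  | add e₁ e₂ => e₁.compile t ++ e₂.compile (t + 1) ++ [.add t t (t + 1)]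
  | sub e₁ e₂ => e₁.compile t ++ e₂.compile (t + 1) ++ [.sub t t (t + 1)]
  | get A e₁ e₂ => e₁.compile t ++ e₂.compile (t + 1) ++ addrCode A t ++ [.load t t]

/-- The number of instructions of the compiled expression. -/
def Expr.cost : Expr → ℕ
  | lit _ => 1
  | size => 2
  | var _ => 2
  | add e₁ e₂ => e₁.cost + e₂.cost + 1
  | sub e₁ e₂ => e₁.cost + e₂.cost + 1
  | get _ e₁ e₂ => e₁.cost + e₂.cost + 7

/-- The number of scratch registers that the compiled expression needs. -/
def Expr.depth : Expr → ℕ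
  | lit _ => 1
  | size => 1
  | var _ => 1
  | add e₁ e₂ => max e₁.depth (e₂.depth + 1)
  | sub e₁ e₂ => max e₁.depth (e₂.depth + 1)
  | get _ e₁ e₂ => max e₁.depth (e₂.depth + 1)

theorem Expr.length_compile (e : Expr) (t : ℕ) : (e.compile t).length = e.cost := by
  induction e generalizing t <;> simp_all [Expr.compile, Expr.cost, addrCode] <;> omega

theorem Expr.depth_pos (e : Expr) : 0 < e.depth := by
  cases e <;> simp [Expr.depth]

/-- The register that holds an array entry. -/
def addr (n : ℕ) (A : Arr) (r k : ℕ) : ℕ := 32 + 8 * (r * (n + 1) + k) + A.off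

/-- The arrays are interleaved modulo 8, so the residue recovers the array; the quotient is read in
base `n + 1` as row and column. -/
theorem addr_inj {n : ℕ} {A B : Arr} {r k r' k' : ℕ} (hk : k < n + 1) (hk' : k' < n + 1)
    (h : addr n A r k = addr n B r' k') : A = B ∧ r = r' ∧ k = k' := by
  have hA := A.off_lt
  have hB := B.off_lt
  unfold addr at h
  have h1 : A.off = B.off := by omega
  have h2 : r * (n + 1) + k = r' * (n + 1) + k' := by omega
  refine ⟨Arr.off_injective h1, ?_⟩
  have h3 : r = r' := by
    have e1 : (k + (n + 1) * r) / (n + 1) = r := by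
      rw [Nat.add_mul_div_left _ _ (by omega), Nat.div_eq_of_lt hk]; simp
    have e2 : (k' + (n + 1) * r') / (n + 1) = r' := by
      rw [Nat.add_mul_div_left _ _ (by omega), Nat.div_eq_of_lt hk']; simp
    rw [← e1, ← e2]
    congr 1
    linarith
  subst h3
  exact ⟨rfl, by omega⟩

/-- The register length is large enough for the arrays. -/
def Fits (n w : ℕ) : Prop := 48 + 8 * ((n + 1) ^ 2 * (n + 1) + (n + 1)) ≤ 2 ^ w

theorem Fits.addr_lt {n w : ℕ} (h : Fits n w) {A : Arr} {r k : ℕ} (hr : r ≤ (n + 1) ^ 2)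
    (hk : k < n + 1) : addr n A r k < 2 ^ w := by
  have h1 := A.off_lt
  have h2 : r * (n + 1) ≤ (n + 1) ^ 2 * (n + 1) := Nat.mul_le_mul_right _ hr
  unfold Fits at h
  unfold addr
  omega

theorem Fits.lt {n w : ℕ} (h : Fits n w) {v : ℕ} (hv : v ≤ (n + 1) ^ 2) : v < 2 ^ w := by
  have h2 : v ≤ (n + 1) ^ 2 * (n + 1) := le_trans hv (Nat.le_mul_of_pos_right _ (by omega))
  unfold Fits at h
  omega

/-- The configuration `c` represents the store `s`. -/
structure Related (n w : ℕ) (s : Store) (c : Config) : Prop where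
  size : c.reg 0 = n + 1
  var : ∀ x : Var, c.reg x.reg = s.var x
  arr : ∀ A r k, k < n + 1 → c.reg (addr n A r k) = s.arr A r k
  inp : c.input = s.inp
  lt : ∀ i, c.reg i < 2 ^ w

/-- Registers 16 to 31 lie above the variables and below the arrays, so scratch work is invisible in
the store. -/
theorem Related.put_temp {n w : ℕ} {s : Store} {c : Config} (h : Related n w s c) {d v : ℕ}
    (hd : 16 ≤ d) (hd' : d < 32) : Related n w s (c.put w d v) where
  size := by
    simp only [Config.put]
    rw [Function.update_of_ne (by omega), h.size]
  var x := by
    have := x.reg_lt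
    simp only [Config.put]
    rw [Function.update_of_ne (by omega), h.var]
  arr A r k hk := by
    simp only [Config.put]
    rw [Function.update_of_ne (by unfold addr; omega), h.arr _ _ _ hk]
  inp := h.inp
  lt i := by
    simp only [Config.put, Function.update_apply]
    split
    · exact Nat.mod_lt _ (by positivity)
    · exact h.lt i

/-- The store after an assignment to a variable. -/
def Store.set (s : Store) (x : Var) (v : ℕ) : Store :=
  { s with var := Function.update s.var x v }

/-- The store after an assignment to an array entry. -/
def Store.setArr (s : Store) (A : Arr) (r k v : ℕ) : Store :=
  { s with
    arr := Function.update s.arr A (Function.update (s.arr A) r (Function.update (s.arr A r) k v)) }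

theorem Related.put_var {n w : ℕ} {s : Store} {c : Config} (h : Related n w s c) (x : Var) {v : ℕ}
    (hv : v < 2 ^ w) :
    Related n w (s.set x v) (c.put w x.reg v) where
  size := by
    have := x.reg_pos
    simp only [Config.put]
    rw [Function.update_of_ne (by omega), h.size]
  var y := by
    simp only [Config.put, Store.set]
    rw [Nat.mod_eq_of_lt hv]
    by_cases hxy : y = x
    · subst hxy; simp
    · rw [Function.update_of_ne (fun e => hxy (Var.reg_injective e)), Function.update_of_ne hxy,
        h.var]
  arr A r k hk := by
    have := x.reg_lt
    simp only [Config.put]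
    rw [Function.update_of_ne (by unfold addr; omega), h.arr _ _ _ hk]
    rfl
  inp := h.inp
  lt i := by
    simp only [Config.put, Function.update_apply]
    split
    · exact Nat.mod_lt _ (by positivity)
    · exact h.lt i

theorem Related.put_arr {n w : ℕ} {s : Store} {c : Config} (h : Related n w s c) (A : Arr)
    {r k v : ℕ} (hk : k < n + 1) (hv : v < 2 ^ w) :
    Related n w (s.setArr A r k v) (c.put w (addr n A r k) v) where
  size := by
    simp only [Config.put]
    rw [Function.update_of_ne (by unfold addr; omega), h.size]
  var x := by
    have := x.reg_lt
    simp only [Config.put]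
    rw [Function.update_of_ne (by unfold addr; omega), h.var]
    rfl
  arr B r' k' hk' := by
    simp only [Config.put, Store.setArr]
    rw [Nat.mod_eq_of_lt hv]
    by_cases e : addr n B r' k' = addr n A r k
    · obtain ⟨rfl, rfl, rfl⟩ := addr_inj hk' hk e
      simp
    · rw [Function.update_of_ne e, h.arr _ _ _ hk']
      by_cases hA : B = A
      · subst hA
        rw [Function.update_self]
        by_cases hr : r' = r
        · subst hr
          rw [Function.update_self, Function.update_of_ne]
          rintro rfl
          exact e rfl
        · rw [Function.update_of_ne hr]
      · rw [Function.update_of_ne hA]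
  inp := h.inp
  lt i := by
    simp only [Config.put, Function.update_apply]
    split
    · exact Nat.mod_lt _ (by positivity)
    · exact h.lt i

/-- The step of an instruction that puts a value into a scratch register. -/
theorem Related.step_temp {P : Program} {n w : ℕ} {s : Store} {c : Config} (h : Related n w s c)
    {ins : Instr} (hP : P[c.pc]? = some ins) (hw : ∀ a, ins ≠ .write a) {d v : ℕ}
    (hi : ins.exec w c = c.put w d v) (hd : 16 ≤ d) (hd' : d < 32) (hv : v < 2 ^ w) :
    ∃ c', Steps P w c [none] c' ∧ c'.pc = c.pc + 1 ∧ Related n w s c' ∧ c'.reg d = v ∧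
      ∀ i, i ≠ d → c'.reg i = c.reg i := by
  refine ⟨c.put w d v, hi ▸ Steps.single hP hw, rfl, h.put_temp hd hd', ?_, ?_⟩
  · simp [Config.put, Nat.mod_eq_of_lt hv]
  · intro i hi
    simp [Config.put, hi]

theorem addrCode_correct {P : Program} {n w : ℕ} (hf : Fits n w) {s : Store} {c : Config}
    (h : Related n w s c) {A : Arr} {t r k : ℕ} (hc : CodeAt P c.pc (addrCode A t))
    (ht : 16 ≤ t) (ht' : t + 1 < 32) (h1 : c.reg t = r) (h2 : c.reg (t + 1) = k)
    (hr : r ≤ (n + 1) ^ 2) (hk : k < n + 1) :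
    ∃ c', Steps P w c (List.replicate 6 none) c' ∧ c'.pc = c.pc + 6 ∧ Related n w s c' ∧
      c'.reg t = addr n A r k ∧ ∀ i, i ≠ t → i ≠ t + 1 → c'.reg i = c.reg i := by
  have hA := A.off_lt
  have hlt := hf.addr_lt (A := A) hr hk
  unfold addr at hlt
  have hm : r * (n + 1) ≤ 8 * (r * (n + 1)) := by omega
  obtain ⟨c1, S1, p1, R1, v1, f1⟩ := h.step_temp (d := t) (v := r * (n + 1)) hc.head (by simp)
    (by simp [Instr.exec, h1, h.size]) ht (by omega) (by omega)
  obtain ⟨c2, S2, p2, R2, v2, f2⟩ := R1.step_temp (d := t) (v := r * (n + 1) + k)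
    (p1 ▸ hc.tail.head) (by simp)
    (by simp [Instr.exec, v1, f1 (t + 1) (by omega), h2]) ht (by omega) (by omega)
  obtain ⟨c3, S3, p3, R3, v3, f3⟩ := R2.step_temp (d := t + 1) (v := 8)
    (by rw [p2, p1]; exact hc.tail.tail.head) (by simp)
    (by simp [Instr.exec]) (by omega) (by omega) (by omega)
  obtain ⟨c4, S4, p4, R4, v4, f4⟩ := R3.step_temp (d := t) (v := 8 * (r * (n + 1) + k))
    (by rw [p3, p2, p1]; exact hc.tail.tail.tail.head) (by simp)
    (by simp [Instr.exec, v3, f3 t (by omega), v2, mul_comm]) ht (by omega) (by omega)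
  obtain ⟨c5, S5, p5, R5, v5, f5⟩ := R4.step_temp (d := t + 1) (v := 32 + A.off)
    (by rw [p4, p3, p2, p1]; exact hc.tail.tail.tail.tail.head) (by simp)
    (by simp [Instr.exec]) (by omega) (by omega) (by omega)
  obtain ⟨c6, S6, p6, R6, v6, f6⟩ := R5.step_temp (d := t) (v := addr n A r k)
    (by rw [p5, p4, p3, p2, p1]; exact hc.tail.tail.tail.tail.tail.head) (by simp)
    (by
      simp only [Instr.exec, v5, f5 t (by omega), v4]
      congr 1
      unfold addr
      omega) ht (by omega) (by unfold addr; omega)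
  refine ⟨c6, ?_, by omega, R6, v6, ?_⟩
  · exact ((((S1.append S2).append S3).append S4).append S5).append S6
  · intro i hi hi'
    rw [f6 i hi, f5 i hi', f4 i hi, f3 i hi', f2 i hi, f1 i hi]

/-- Evaluation works like a stack: the first operand stays in register `t` while the second is
computed from `t + 1` upwards. The last conjunct, that nothing below the target register changes, is
what makes the induction go through. -/
theorem Expr.compile_correct {P : Program} {n w : ℕ} (hf : Fits n w) {s : Store} (e : Expr)
    {c : Config} {t : ℕ} (h : Related n w s c) (hc : CodeAt P c.pc (e.compile t))
    (ht : 16 ≤ t) (ht' : t + e.depth < 32) (hok : e.Ok n s) :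
    ∃ c', Steps P w c (List.replicate e.cost none) c' ∧ c'.pc = c.pc + e.cost ∧
      Related n w s c' ∧ c'.reg t = e.eval n s ∧ ∀ i, i < t → c'.reg i = c.reg i := by
  induction e generalizing c t with
  | lit v =>
    simp only [Expr.compile, Expr.depth, Expr.Ok] at *
    obtain ⟨c1, S1, p1, R1, v1, f1⟩ := h.step_temp (d := t) (v := v) hc.head (by simp)
      (by simp [Instr.exec]) ht (by omega) (by unfold Fits at hf; omega)
    exact ⟨c1, S1, p1, R1, v1, fun i hi => f1 i (by omega)⟩
  | size =>
    simp only [Expr.compile, Expr.depth, Expr.Ok] at *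
    obtain ⟨c1, S1, p1, R1, v1, f1⟩ := h.step_temp (d := t) (v := 0) hc.head (by simp)
      (by simp [Instr.exec]) ht (by omega) (by positivity)
    obtain ⟨c2, S2, p2, R2, v2, f2⟩ := R1.step_temp (d := t) (v := n + 1) (p1 ▸ hc.tail.head)
      (by simp) (by simp [Instr.exec, v1, R1.size]) ht (by omega) (h.size ▸ h.lt 0)
    exact ⟨c2, S1.append S2, by simp [Expr.cost]; omega, R2, v2,
      fun i hi => by rw [f2 i (by omega), f1 i (by omega)]⟩
  | var x =>
    simp only [Expr.compile, Expr.depth, Expr.Ok] at *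
    obtain ⟨c1, S1, p1, R1, v1, f1⟩ := h.step_temp (d := t) (v := 0) hc.head (by simp)
      (by simp [Instr.exec]) ht (by omega) (by positivity)
    obtain ⟨c2, S2, p2, R2, v2, f2⟩ := R1.step_temp (d := t) (v := s.var x) (p1 ▸ hc.tail.head)
      (by simp) (by simp [Instr.exec, v1, R1.var]) ht (by omega) (h.var x ▸ h.lt _)
    exact ⟨c2, S1.append S2, by simp [Expr.cost]; omega, R2, v2,
      fun i hi => by rw [f2 i (by omega), f1 i (by omega)]⟩
  | add e₁ e₂ ih₁ ih₂ =>
    simp only [Expr.compile, Expr.depth, Expr.Ok] at *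
    obtain ⟨c1, S1, p1, R1, v1, f1⟩ := ih₁ h hc.left.left ht (by omega) hok.1
    have hc2 := hc.left.right
    have hc3 := hc.right
    simp only [List.length_append, Expr.length_compile] at hc2 hc3
    obtain ⟨c2, S2, p2, R2, v2, f2⟩ := ih₂ R1 (p1 ▸ hc2) (by omega) (by omega) hok.2.1
    obtain ⟨c3, S3, p3, R3, v3, f3⟩ := R2.step_temp (d := t)
      (v := e₁.eval n s + e₂.eval n s) (by rw [p2, p1, add_assoc]; exact hc3.head)
      (by simp) (by simp [Instr.exec, v2, f2 t (by omega), v1]) ht (by omega) (hf.lt hok.2.2)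
    refine ⟨c3, ?_, by simp only [Expr.cost]; omega, R3, v3, fun i hi => ?_⟩
    · simp only [Expr.cost, List.replicate_add]
      exact (S1.append S2).append S3
    · rw [f3 i (by omega), f2 i (by omega), f1 i (by omega)]
  | sub e₁ e₂ ih₁ ih₂ =>
    simp only [Expr.compile, Expr.depth, Expr.Ok] at *
    obtain ⟨c1, S1, p1, R1, v1, f1⟩ := ih₁ h hc.left.left ht (by omega) hok.1
    have hc2 := hc.left.right
    have hc3 := hc.right
    simp only [List.length_append, Expr.length_compile] at hc2 hc3
    obtain ⟨c2, S2, p2, R2, v2, f2⟩ := ih₂ R1 (p1 ▸ hc2) (by omega) (by omega) hok.2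
    obtain ⟨c3, S3, p3, R3, v3, f3⟩ := R2.step_temp (d := t)
      (v := e₁.eval n s - e₂.eval n s) (by rw [p2, p1, add_assoc]; exact hc3.head)
      (by simp) (by simp [Instr.exec, v2, f2 t (by omega), v1]) ht (by omega)
      -- A truncated difference is at most its first operand, which already fits into a register, so
      -- no size condition is needed.
      (lt_of_le_of_lt (Nat.sub_le _ _) (v1 ▸ R1.lt t))
    refine ⟨c3, ?_, by simp only [Expr.cost]; omega, R3, v3, fun i hi => ?_⟩
    · simp only [Expr.cost, List.replicate_add]
      exact (S1.append S2).append S3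
    · rw [f3 i (by omega), f2 i (by omega), f1 i (by omega)]
  | get A e₁ e₂ ih₁ ih₂ =>
    simp only [Expr.compile, Expr.depth, Expr.Ok] at *
    have := e₂.depth_pos
    obtain ⟨c1, S1, p1, R1, v1, f1⟩ := ih₁ h hc.left.left.left ht (by omega) hok.1
    have hc2 := hc.left.left.right
    have hc3 := hc.left.right
    have hc4 := hc.right
    simp only [List.length_append, Expr.length_compile] at hc2 hc3 hc4
    obtain ⟨c2, S2, p2, R2, v2, f2⟩ := ih₂ R1 (p1 ▸ hc2) (by omega) (by omega) hok.2.1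
    obtain ⟨c3, S3, p3, R3, v3, f3⟩ := addrCode_correct hf R2 (A := A) (t := t)
      (by rw [p2, p1, add_assoc]; exact hc3) ht (by omega) (by rw [f2 t (by omega), v1]) v2
      hok.2.2.1 hok.2.2.2
    obtain ⟨c4, S4, p4, R4, v4, f4⟩ := R3.step_temp (d := t)
      (v := s.arr A (e₁.eval n s) (e₂.eval n s))
      (by rw [p3, p2, p1, add_assoc, add_assoc]; exact add_assoc c.pc _ _ ▸ hc4.head)
      (by simp) (by simp [Instr.exec, v3, R3.arr _ _ _ hok.2.2.2]) ht (by omega)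
      (R3.arr _ _ _ hok.2.2.2 ▸ R3.lt _)
    refine ⟨c4, ?_, by simp only [Expr.cost]; omega, R4, v4, fun i hi => ?_⟩
    · have := ((S1.append S2).append S3).append S4
      have e7 : List.replicate 7 (none : Option ℕ) = List.replicate 6 none ++ [none] := rfl
      simpa only [Expr.cost, List.replicate_add, e7, List.append_assoc] using this
    · rw [f4 i (by omega), f3 i (by omega) (by omega), f2 i (by omega), f1 i (by omega)]

end RAM

/-! ### Commands, their timed semantics and the correctness of their compilation -/

namespace RAM

set_option linter.constructorNameAsVariable false

/-- The commands of the language. -/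
inductive Cmd
  | skip
  | assign (x : Var) (e : Expr)
  | store (A : Arr) (e₁ e₂ e₃ : Expr)
  | write (e : Expr)
  | seq (c₁ c₂ : Cmd)
  | ifLt (e₁ e₂ : Expr) (c₁ c₂ : Cmd)
  | whileLt (e₁ e₂ : Expr) (c : Cmd)
  | ifRead (x : Var) (c₁ c₂ : Cmd)

/-- The number of instructions of the compiled command. -/
def Cmd.size : Cmd → ℕ
  | skip => 0
  | assign _ e => e.cost + 2
  | store _ e₁ e₂ e₃ => e₃.cost + e₁.cost + e₂.cost + 7
  | write e => e.cost + 1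
  | seq c₁ c₂ => c₁.size + c₂.size
  | ifLt e₁ e₂ c₁ c₂ => e₁.cost + e₂.cost + 1 + c₂.size + 1 + c₁.size
  | whileLt e₁ e₂ c => e₁.cost + e₂.cost + 2 + c.size + 1
  | ifRead _ c₁ c₂ => 1 + c₁.size + 1 + c₂.size

/-- The instructions of a command that stands in the program from number `p` on. -/
def Cmd.compile (p : ℕ) : Cmd → List Instr
  | skip => []
  | assign x e => e.compile 16 ++ [.const 17 0, .add x.reg 16 17]
  | store A e₁ e₂ e₃ =>
    e₃.compile 16 ++ e₁.compile 17 ++ e₂.compile 18 ++ addrCode A 17 ++ [.store 17 16]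
  | write e => e.compile 16 ++ [.write 16]
  | seq c₁ c₂ => c₁.compile p ++ c₂.compile (p + c₁.size)
  | ifLt e₁ e₂ c₁ c₂ =>
    let q := p + (e₁.cost + e₂.cost + 1)
    e₁.compile 16 ++ e₂.compile 17 ++ [.jumpLess 16 17 (q + c₂.size + 1)] ++ c₂.compile q ++
      [.jump (q + c₂.size + 1 + c₁.size)] ++ c₁.compile (q + c₂.size + 1)
  | whileLt e₁ e₂ c =>
    let q := p + (e₁.cost + e₂.cost + 2)
    e₁.compile 16 ++ e₂.compile 17 ++ [.jumpLess 16 17 q, .jump (q + c.size + 1)] ++ c.compile q ++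
      [.jump p]
  | ifRead x c₁ c₂ =>
    [.read x.reg (p + 1 + c₁.size + 1)] ++ c₁.compile (p + 1) ++
      [.jump (p + 1 + c₁.size + 1 + c₂.size)] ++ c₂.compile (p + 1 + c₁.size + 1)

theorem Cmd.length_compile (c : Cmd) (p : ℕ) : (c.compile p).length = c.size := by
  induction c generalizing p <;>
    simp_all [Cmd.compile, Cmd.size, addrCode, Expr.length_compile] <;> omega

/-- The expressions of the command need no more scratch registers than there are. -/
def Cmd.wf : Cmd → Bool
  | skip => true
  | assign _ e => e.depth ≤ 12
  | store _ e₁ e₂ e₃ => e₁.depth ≤ 12 && e₂.depth ≤ 12 && e₃.depth ≤ 12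
  | write e => e.depth ≤ 12
  | seq c₁ c₂ => c₁.wf && c₂.wf
  | ifLt e₁ e₂ c₁ c₂ => e₁.depth ≤ 12 && e₂.depth ≤ 12 && c₁.wf && c₂.wf
  | whileLt e₁ e₂ c => e₁.depth ≤ 12 && e₂.depth ≤ 12 && c.wf
  | ifRead _ c₁ c₂ => c₁.wf && c₂.wf

/-- Silent steps. -/
abbrev silent (t : ℕ) : List (Option ℕ) := List.replicate t none

/-- Execution of a command from one store to another. The list holds, for every time step of the
compiled command, the word that is written in it (if any). -/
inductive Exec (n : ℕ) : Cmd → Store → List (Option ℕ) → Store → Prop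
  | skip {s} : Exec n .skip s [] s
  | assign {s x e} (h : e.Ok n s) :
      Exec n (.assign x e) s (silent (e.cost + 2)) (s.set x (e.eval n s))
  | store {s A} {e₁ e₂ e₃ : Expr} (h₁ : e₁.Ok n s) (h₂ : e₂.Ok n s) (h₃ : e₃.Ok n s)
      (hr : e₁.eval n s ≤ (n + 1) ^ 2) (hk : e₂.eval n s < n + 1) :
      Exec n (.store A e₁ e₂ e₃) s (silent (e₃.cost + e₁.cost + e₂.cost + 7))
        (s.setArr A (e₁.eval n s) (e₂.eval n s) (e₃.eval n s))
  | write {s e} (h : e.Ok n s) : Exec n (.write e) s (silent e.cost ++ [some (e.eval n s)]) s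
  | seq {s s' s'' c₁ c₂ tr tr'} (h₁ : Exec n c₁ s tr s') (h₂ : Exec n c₂ s' tr' s'') :
      Exec n (.seq c₁ c₂) s (tr ++ tr') s''
  | ifLt_true {s s' e₁ e₂ c₁ c₂ tr} (h₁ : e₁.Ok n s) (h₂ : e₂.Ok n s)
      (h : e₁.eval n s < e₂.eval n s) (hc : Exec n c₁ s tr s') :
      Exec n (.ifLt e₁ e₂ c₁ c₂) s (silent (e₁.cost + e₂.cost + 1) ++ tr) s'
  | ifLt_false {s s' e₁ e₂ c₁ c₂ tr} (h₁ : e₁.Ok n s) (h₂ : e₂.Ok n s)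
      (h : ¬ e₁.eval n s < e₂.eval n s) (hc : Exec n c₂ s tr s') :
      Exec n (.ifLt e₁ e₂ c₁ c₂) s (silent (e₁.cost + e₂.cost + 1) ++ tr ++ silent 1) s'
  | while_true {s s' s'' e₁ e₂ c tr tr'} (h₁ : e₁.Ok n s) (h₂ : e₂.Ok n s)
      (h : e₁.eval n s < e₂.eval n s) (hc : Exec n c s tr s')
      (hw : Exec n (.whileLt e₁ e₂ c) s' tr' s'') :
      Exec n (.whileLt e₁ e₂ c) s (silent (e₁.cost + e₂.cost + 1) ++ tr ++ silent 1 ++ tr') s''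
  | while_false {s e₁ e₂ c} (h₁ : e₁.Ok n s) (h₂ : e₂.Ok n s)
      (h : ¬ e₁.eval n s < e₂.eval n s) :
      Exec n (.whileLt e₁ e₂ c) s (silent (e₁.cost + e₂.cost + 1) ++ silent 1) s
  | ifRead_some {s s' : Store} {x v rest c₁ c₂ tr} (h : s.inp = v :: rest)
      (hv : v ≤ (n + 1) ^ 2) (hc : Exec n c₁ { s.set x v with inp := rest } tr s') :
      Exec n (.ifRead x c₁ c₂) s (silent 1 ++ tr ++ silent 1) s'
  | ifRead_none {s s' : Store} {x c₁ c₂ tr} (h : s.inp = []) (hc : Exec n c₂ s tr s') :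
      Exec n (.ifRead x c₁ c₂) s (silent 1 ++ tr) s'

theorem Related.pc {n w : ℕ} {s : Store} {c : Config} (h : Related n w s c) (q : ℕ) :
    Related n w s { c with pc := q } :=
  ⟨h.size, h.var, h.arr, h.inp, h.lt⟩

/-- Evaluation of two expressions in the registers `16` and `17`. -/
theorem compile_pair_correct {P : Program} {n w : ℕ} (hf : Fits n w) {s : Store} {e₁ e₂ : Expr}
    {c : Config} (h : Related n w s c) {l : List Instr}
    (hc : CodeAt P c.pc (e₁.compile 16 ++ e₂.compile 17 ++ l))
    (hd₁ : e₁.depth ≤ 12) (hd₂ : e₂.depth ≤ 12) (h₁ : e₁.Ok n s) (h₂ : e₂.Ok n s) :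
    ∃ c', Steps P w c (silent (e₁.cost + e₂.cost)) c' ∧ c'.pc = c.pc + (e₁.cost + e₂.cost) ∧
      Related n w s c' ∧ c'.reg 16 = e₁.eval n s ∧ c'.reg 17 = e₂.eval n s ∧
      CodeAt P c'.pc l := by
  obtain ⟨c1, S1, p1, R1, v1, f1⟩ :=
    e₁.compile_correct hf h hc.left.left (by omega) (by omega) h₁
  have hc2 := hc.left.right
  have hc3 := hc.right
  simp only [List.length_append, Expr.length_compile] at hc2 hc3
  obtain ⟨c2, S2, p2, R2, v2, f2⟩ :=
    e₂.compile_correct hf R1 (p1 ▸ hc2) (by omega) (by omega) h₂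
  have p : c2.pc = c.pc + (e₁.cost + e₂.cost) := by omega
  refine ⟨c2, ?_, p, R2, by rw [f2 16 (by omega), v1], v2, p ▸ hc3⟩
  rw [silent, List.replicate_add]
  exact S1.append S2

theorem Steps.jump {P : Program} {w q : ℕ} {c : Config} (h : P[c.pc]? = some (.jump q)) :
    Steps P w c (silent 1) { c with pc := q } :=
  Steps.single h (by simp)

theorem Steps.jumpLess {P : Program} {w a b q : ℕ} {c : Config}
    (h : P[c.pc]? = some (.jumpLess a b q)) :
    Steps P w c (silent 1) { c with pc := if c.reg a < c.reg b then q else c.pc + 1 } :=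
  Steps.single h (by simp)

theorem CodeAt.cast {P : Program} {p q : ℕ} {l : List Instr} (h : CodeAt P p l) (e : p = q) :
    CodeAt P q l := e ▸ h

/-- The semantics was designed to count every test and jump of the compiled code, so the machine
runs through the very same trace. The induction is on the execution and not on the command, which
provides a hypothesis for the remaining rounds of a loop. -/
theorem Exec.correct {P : Program} {n w : ℕ} (hf : Fits n w) {cmd : Cmd} {s s' : Store}
    {tr : List (Option ℕ)} (h : Exec n cmd s tr s') {c : Config} (hR : Related n w s c)
    (hc : CodeAt P c.pc (cmd.compile c.pc)) (hwf : cmd.wf) :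
    ∃ c', Steps P w c tr c' ∧ c'.pc = c.pc + cmd.size ∧ Related n w s' c' := by
  induction h generalizing c with
  | skip => exact ⟨c, rfl, rfl, hR⟩
  | @assign s x e h =>
    simp only [Cmd.compile, Cmd.wf, decide_eq_true_eq, Cmd.size] at *
    obtain ⟨c1, S1, p1, R1, v1, f1⟩ := e.compile_correct hf hR hc.left (by omega) (by omega) h
    have hc2 := hc.right
    rw [Expr.length_compile, ← p1] at hc2
    obtain ⟨c2, S2, p2, R2, v2, f2⟩ := R1.step_temp (d := 17) (v := 0) hc2.head (by simp)
      (by simp [Instr.exec]) (by omega) (by omega) (by positivity)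
    have hc3 := hc2.tail
    rw [← p2] at hc3
    have S3 := Steps.single (w := w) hc3.head (by simp)
    have hv : e.eval n s < 2 ^ w := v1 ▸ R1.lt 16
    simp only [Instr.exec, f2 16 (by omega), v1, v2, add_zero] at S3
    refine ⟨_, ?_, ?_, R2.put_var x hv⟩
    · rw [silent, List.replicate_add]
      exact S1.append (S2.append S3)
    · simp only [Config.put]; omega
  | @store s A e₁ e₂ e₃ h₁ h₂ h₃ hr hk =>
    simp only [Cmd.compile, Cmd.wf, decide_eq_true_eq, Cmd.size, Bool.and_eq_true] at *
    obtain ⟨c1, S1, p1, R1, v1, f1⟩ :=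
      e₃.compile_correct hf hR hc.left.left.left.left (by omega) (by omega) h₃
    have hc2 := hc.left.left.left.right
    have hc3 := hc.left.left.right
    have hc4 := hc.left.right
    have hc5 := hc.right
    simp only [List.length_append, Expr.length_compile, ← add_assoc, ← p1] at hc2 hc3 hc4 hc5
    obtain ⟨c2, S2, p2, R2, v2, f2⟩ :=
      e₁.compile_correct hf R1 hc2 (by omega) (by omega) h₁
    simp only [← p2] at hc3 hc4 hc5
    obtain ⟨c3, S3, p3, R3, v3, f3⟩ :=
      e₂.compile_correct hf R2 hc3 (by omega) (by omega) h₂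
    simp only [← p3] at hc4 hc5
    obtain ⟨c4, S4, p4, R4, v4, f4⟩ := addrCode_correct hf R3 (A := A) hc4 (by omega) (by omega)
      (by rw [f3 17 (by omega), v2]) v3 hr hk
    have hl : (addrCode A 17).length = 6 := rfl
    rw [hl, ← p4] at hc5
    have S5 := Steps.single (w := w) hc5.head (by simp)
    have v5 : c4.reg 16 = e₃.eval n s := by
      rw [f4 16 (by omega) (by omega), f3 16 (by omega), f2 16 (by omega), v1]
    simp only [Instr.exec, v4, v5] at S5
    refine ⟨_, ?_, ?_, R4.put_arr A hk (v1 ▸ R1.lt 16)⟩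
    · rw [silent, List.replicate_add, List.replicate_add, List.replicate_add]
      have := (((S1.append S2).append S3).append S4).append S5
      simp only [List.append_assoc] at this ⊢
      exact this
    · simp only [Config.put]; omega
  | @write s e h =>
    simp only [Cmd.compile, Cmd.wf, decide_eq_true_eq, Cmd.size] at *
    obtain ⟨c1, S1, p1, R1, v1, f1⟩ := e.compile_correct hf hR hc.left (by omega) (by omega) h
    have hc2 := hc.right
    rw [Expr.length_compile, ← p1] at hc2
    refine ⟨_, S1.append (v1 ▸ Steps.single_write hc2.head), ?_, R1.pc _⟩
    simp only []; omega
  | @seq s s' s'' c₁ c₂ tr tr' h₁ h₂ ih₁ ih₂ =>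
    simp only [Cmd.compile, Cmd.wf, Cmd.size, Bool.and_eq_true] at *
    obtain ⟨c1, S1, p1, R1⟩ := ih₁ hR hc.left hwf.1
    have hc2 := hc.right
    rw [Cmd.length_compile, ← p1] at hc2
    obtain ⟨c2, S2, p2, R2⟩ := ih₂ R1 hc2 hwf.2
    exact ⟨c2, S1.append S2, by omega, R2⟩
  | @ifLt_true s s' e₁ e₂ c₁ c₂ tr h₁ h₂ h hx ih =>
    simp only [Cmd.compile, Cmd.wf, Cmd.size, Bool.and_eq_true, decide_eq_true_eq] at *
    have hc' := hc.right
    simp only [List.append_assoc, List.length_append, Expr.length_compile, Cmd.length_compile,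
      List.length_singleton] at hc hc'
    rw [← List.append_assoc] at hc
    obtain ⟨c1, S1, p1, R1, v1, v2, hc1⟩ :=
      compile_pair_correct hf hR hc hwf.1.1.1 hwf.1.1.2 h₁ h₂
    have S2 := Steps.jumpLess (w := w) hc1.head
    rw [v1, v2, if_pos h] at S2
    obtain ⟨c2, S3, p3, R3⟩ := ih (R1.pc (c.pc + (e₁.cost + e₂.cost + 1) + c₂.size + 1))
      (hc'.cast (by simp only []; omega)) hwf.1.2
    refine ⟨c2, ?_, ?_, R3⟩
    · rw [silent, List.replicate_add]
      exact (S1.append S2).append S3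
    · simp only [] at p3; omega
  | @ifLt_false s s' e₁ e₂ c₁ c₂ tr h₁ h₂ h hx ih =>
    simp only [Cmd.compile, Cmd.wf, Cmd.size, Bool.and_eq_true, decide_eq_true_eq] at *
    have hc' := hc.left.left.right
    have hc'' := hc.left.right
    simp only [List.append_assoc, List.length_append, Expr.length_compile, Cmd.length_compile,
      List.length_singleton] at hc hc' hc''
    rw [← List.append_assoc] at hc
    obtain ⟨c1, S1, p1, R1, v1, v2, hc1⟩ :=
      compile_pair_correct hf hR hc hwf.1.1.1 hwf.1.1.2 h₁ h₂
    have S2 := Steps.jumpLess (w := w) hc1.head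
    rw [v1, v2, if_neg h] at S2
    have e1 : c1.pc + 1 = c.pc + (e₁.cost + e₂.cost + 1) := by omega
    obtain ⟨c2, S3, p3, R3⟩ := ih (R1.pc (c1.pc + 1))
      (by simp only [e1]; exact hc'.cast (by omega)) hwf.2
    have S4 := Steps.jump (w := w) (c := c2)
      (q := c.pc + (e₁.cost + e₂.cost + 1) + c₂.size + 1 + c₁.size)
      (by
        convert hc''.head using 2
        simp only [] at p3; omega)
    refine ⟨_, ?_, ?_, R3.pc (c.pc + (e₁.cost + e₂.cost + 1) + c₂.size + 1 + c₁.size)⟩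
    · rw [silent, List.replicate_add]
      exact ((S1.append S2).append S3).append S4
    · simp only []; omega
  | @while_true s s' s'' e₁ e₂ cmd tr tr' h₁ h₂ h hx hw ih ihw =>
    -- The code hypothesis is kept intact for a second use: the jump back returns to the same
    -- program counter, where the remaining rounds begin.
    have hc0 := hc
    have hwf0 := hwf
    simp only [Cmd.compile, Cmd.wf, Bool.and_eq_true, decide_eq_true_eq] at hc hwf
    have hc' := hc.left.right
    have hc'' := hc.right
    simp only [List.append_assoc, List.length_append, Expr.length_compile, Cmd.length_compile,
      List.length_cons, List.length_nil] at hc hc' hc''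
    rw [← List.append_assoc] at hc
    obtain ⟨c1, S1, p1, R1, v1, v2, hc1⟩ :=
      compile_pair_correct hf hR hc hwf.1.1 hwf.1.2 h₁ h₂
    have S2 := Steps.jumpLess (w := w) hc1.head
    rw [v1, v2, if_pos h] at S2
    obtain ⟨c2, S3, p3, R3⟩ := ih (R1.pc (c.pc + (e₁.cost + e₂.cost + 2)))
      (hc'.cast (by simp only []; omega)) hwf.2
    have S4 := Steps.jump (w := w) (c := c2) (q := c.pc)
      (by
        convert hc''.head using 2
        simp only [] at p3; omega)
    obtain ⟨c3, S5, p5, R5⟩ := ihw (c := { c2 with pc := c.pc }) (R3.pc _) hc0 hwf0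
    refine ⟨c3, ?_, p5, R5⟩
    rw [silent, List.replicate_add]
    exact (((S1.append S2).append S3).append S4).append S5
  | @while_false s e₁ e₂ cmd h₁ h₂ h =>
    simp only [Cmd.compile, Cmd.wf, Cmd.size, Bool.and_eq_true, decide_eq_true_eq] at *
    simp only [List.append_assoc] at hc
    rw [← List.append_assoc] at hc
    obtain ⟨c1, S1, p1, R1, v1, v2, hc1⟩ :=
      compile_pair_correct hf hR hc hwf.1.1 hwf.1.2 h₁ h₂
    have S2 := Steps.jumpLess (w := w) hc1.head
    rw [v1, v2, if_neg h] at S2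
    have S3 := Steps.jump (w := w) (c := { c1 with pc := c1.pc + 1 }) hc1.tail.head
    refine ⟨_, ?_, ?_, (R1.pc (c1.pc + 1)).pc (c.pc + (e₁.cost + e₂.cost + 2) + cmd.size + 1)⟩
    · rw [silent, List.replicate_add]
      exact (S1.append S2).append S3
    · simp only []; omega
  | @ifRead_some s s' x v rest c₁ c₂ tr h hv hx ih =>
    simp only [Cmd.compile, Cmd.wf, Cmd.size, Bool.and_eq_true] at *
    have hc' := hc.left.left.right
    have hc'' := hc.left.right
    simp only [List.append_assoc, List.length_append, Cmd.length_compile,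
      List.length_singleton] at hc hc' hc''
    have S1 := Steps.single (w := w) hc.head (by simp)
    simp only [Instr.exec, hR.inp, h] at S1
    have R1 := hR.put_var x (hf.lt hv)
    obtain ⟨c2, S3, p3, R3⟩ := ih (c := { c.put w x.reg v with input := rest })
      ⟨R1.size, R1.var, R1.arr, rfl, R1.lt⟩ hc' hwf.1
    have S4 := Steps.jump (w := w) (c := c2)
      (q := c.pc + 1 + c₁.size + 1 + c₂.size)
      (by
        convert hc''.head using 2
        simp only [Config.put] at p3; omega)
    refine ⟨_, (S1.append S3).append S4, ?_, R3.pc _⟩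
    simp only []; omega
  | @ifRead_none s s' x c₁ c₂ tr h hx ih =>
    simp only [Cmd.compile, Cmd.wf, Cmd.size, Bool.and_eq_true] at *
    have hc' := hc.right
    simp only [List.append_assoc, List.length_append, Cmd.length_compile,
      List.length_singleton] at hc hc'
    have S1 := Steps.single (w := w) hc.head (by simp)
    simp only [Instr.exec, hR.inp, h] at S1
    obtain ⟨c2, S3, p3, R3⟩ := ih (c := { c with pc := c.pc + 1 + c₁.size + 1, input := [] })
      ⟨hR.size, hR.var, hR.arr, h.symm, hR.lt⟩
      (hc'.cast (by simp only []; omega)) hwf.2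
    refine ⟨c2, S1.append S3, ?_, R3⟩
    simp only [] at p3; omega

end RAM

namespace RAM

set_option linter.constructorNameAsVariable false

/-! ### Proof rules -/

@[simp] theorem Store.set_var (s : Store) (x y : Var) (v : ℕ) :
    (s.set x v).var y = if y = x then v else s.var y := by
  simp [Store.set, Function.update_apply]

@[simp] theorem Store.set_arr (s : Store) (x : Var) (v : ℕ) : (s.set x v).arr = s.arr := rfl

@[simp] theorem Store.set_inp (s : Store) (x : Var) (v : ℕ) : (s.set x v).inp = s.inp := rfl

@[simp] theorem Store.setArr_var (s : Store) (A : Arr) (r k v : ℕ) :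
    (s.setArr A r k v).var = s.var := rfl

@[simp] theorem Store.setArr_inp (s : Store) (A : Arr) (r k v : ℕ) :
    (s.setArr A r k v).inp = s.inp := rfl

theorem Store.setArr_arr (s : Store) (A B : Arr) (r k v r' k' : ℕ) :
    (s.setArr A r k v).arr B r' k' = if B = A ∧ r' = r ∧ k' = k then v else s.arr B r' k' := by
  by_cases hA : B = A
  · subst hA
    by_cases hr : r' = r
    · subst hr
      simp [Store.setArr, Function.update_apply]
    · simp [Store.setArr, hr]
  · simp [Store.setArr, hA]

@[simp] theorem Store.setArr_arr_of_ne (s : Store) {A B : Arr} (h : B ≠ A) (r k v : ℕ) :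
    (s.setArr A r k v).arr B = s.arr B := by
  simp [Store.setArr, h]

/-- From `s`, the command `c` runs in time at most `T`, writes the words `ws` and ends in a store
with property `Q`. -/
def Prints (n : ℕ) (c : Cmd) (s : Store) (ws : List ℕ) (T : ℕ) (Q : Store → Prop) : Prop :=
  ∃ tr s', Exec n c s tr s' ∧ tr.reduceOption = ws ∧ tr.length ≤ T ∧ Q s'

/-- From `s`, the command `c` runs in time at most `T`, writes nothing and ends in a store with
property `Q`. -/
abbrev Does (n : ℕ) (c : Cmd) (s : Store) (T : ℕ) (Q : Store → Prop) : Prop :=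
  Prints n c s [] T Q

/-- The variables that a command may change. -/
def Cmd.vars : Cmd → List Var
  | skip => []
  | assign x _ => [x]
  | store _ _ _ _ => []
  | write _ => []
  | seq c₁ c₂ => c₁.vars ++ c₂.vars
  | ifLt _ _ c₁ c₂ => c₁.vars ++ c₂.vars
  | whileLt _ _ c => c.vars
  | ifRead x c₁ c₂ => x :: (c₁.vars ++ c₂.vars)

/-- The arrays that a command may change. -/
def Cmd.arrs : Cmd → List Arr
  | skip => []
  | assign _ _ => []
  | store A _ _ _ => [A]
  | write _ => []
  | seq c₁ c₂ => c₁.arrs ++ c₂.arrs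
  | ifLt _ _ c₁ c₂ => c₁.arrs ++ c₂.arrs
  | whileLt _ _ c => c.arrs
  | ifRead _ c₁ c₂ => c₁.arrs ++ c₂.arrs

/-- The command reads from the input tape. -/
def Cmd.reads : Cmd → Bool
  | seq c₁ c₂ => c₁.reads || c₂.reads
  | ifLt _ _ c₁ c₂ => c₁.reads || c₂.reads
  | whileLt _ _ c => c.reads
  | ifRead _ _ _ => true
  | _ => false

/-- What a command leaves unchanged. -/
structure Frame (c : Cmd) (s s' : Store) : Prop where
  var : ∀ x, x ∉ c.vars → s'.var x = s.var x
  arr : ∀ A, A ∉ c.arrs → s'.arr A = s.arr A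
  inp : c.reads = false → s'.inp = s.inp

/-- This lets a specification speak only of what a command changes; everything else is recovered by
a syntactic check, mostly with `decide`. -/
theorem Exec.frame {n : ℕ} {c : Cmd} {s s' : Store} {tr : List (Option ℕ)}
    (h : Exec n c s tr s') : Frame c s s' := by
  induction h with
  | skip => exact ⟨fun _ _ => rfl, fun _ _ => rfl, fun _ => rfl⟩
  | assign h =>
    refine ⟨fun y hy => ?_, fun _ _ => rfl, fun _ => rfl⟩
    simp only [Cmd.vars, List.mem_singleton] at hy
    simp [hy]
  | store h₁ h₂ h₃ hr hk =>
    refine ⟨fun _ _ => rfl, fun B hB => ?_, fun _ => rfl⟩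
    simp only [Cmd.arrs, List.mem_singleton] at hB
    simp [hB]
  | write h => exact ⟨fun _ _ => rfl, fun _ _ => rfl, fun _ => rfl⟩
  | seq h₁ h₂ ih₁ ih₂ =>
    refine ⟨fun x hx => ?_, fun A hA => ?_, fun h => ?_⟩
    · simp only [Cmd.vars, List.mem_append, not_or] at hx
      rw [ih₂.var x hx.2, ih₁.var x hx.1]
    · simp only [Cmd.arrs, List.mem_append, not_or] at hA
      rw [ih₂.arr A hA.2, ih₁.arr A hA.1]
    · simp only [Cmd.reads, Bool.or_eq_false_iff] at h
      rw [ih₂.inp h.2, ih₁.inp h.1]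
  | ifLt_true h₁ h₂ h hc ih =>
    refine ⟨fun x hx => ?_, fun A hA => ?_, fun h => ?_⟩
    · simp only [Cmd.vars, List.mem_append, not_or] at hx
      exact ih.var x hx.1
    · simp only [Cmd.arrs, List.mem_append, not_or] at hA
      exact ih.arr A hA.1
    · simp only [Cmd.reads, Bool.or_eq_false_iff] at h
      exact ih.inp h.1
  | ifLt_false h₁ h₂ h hc ih =>
    refine ⟨fun x hx => ?_, fun A hA => ?_, fun h => ?_⟩
    · simp only [Cmd.vars, List.mem_append, not_or] at hx
      exact ih.var x hx.2
    · simp only [Cmd.arrs, List.mem_append, not_or] at hA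
      exact ih.arr A hA.2
    · simp only [Cmd.reads, Bool.or_eq_false_iff] at h
      exact ih.inp h.2
  | while_true h₁ h₂ h hc hw ih ihw =>
    refine ⟨fun x hx => ?_, fun A hA => ?_, fun h => ?_⟩
    · rw [ihw.var x hx, ih.var x hx]
    · rw [ihw.arr A hA, ih.arr A hA]
    · rw [ihw.inp h, ih.inp h]
  | while_false h₁ h₂ h => exact ⟨fun _ _ => rfl, fun _ _ => rfl, fun _ => rfl⟩
  | ifRead_some h hv hc ih =>
    refine ⟨fun y hy => ?_, fun A hA => ?_, fun h => ?_⟩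
    · simp only [Cmd.vars, List.mem_cons, List.mem_append, not_or] at hy
      rw [ih.var y hy.2.1]
      exact (Store.set_var _ _ _ _).trans (if_neg hy.1)
    · simp only [Cmd.arrs, List.mem_append, not_or] at hA
      exact ih.arr A hA.1
    · simp [Cmd.reads] at h
  | ifRead_none h hc ih =>
    refine ⟨fun y hy => ?_, fun A hA => ?_, fun h => ?_⟩
    · simp only [Cmd.vars, List.mem_cons, List.mem_append, not_or] at hy
      exact ih.var y hy.2.2
    · simp only [Cmd.arrs, List.mem_append, not_or] at hA
      exact ih.arr A hA.2
    · simp [Cmd.reads] at h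

theorem reduceOption_silent (t : ℕ) : (silent t).reduceOption = [] := by
  induction t with
  | zero => rfl
  | succ t ih => simp [silent, List.replicate_succ]

section rules

variable {n : ℕ} {c c₁ c₂ : Cmd} {s : Store} {ws ws₁ ws₂ : List ℕ} {T T₁ T₂ : ℕ}
  {Q Q' : Store → Prop}

theorem Prints.mono (h : Prints n c s ws T Q) (hT : T ≤ T₁) (hQ : ∀ s', Q s' → Q' s') :
    Prints n c s ws T₁ Q' := by
  obtain ⟨tr, s', h1, h2, h3, h4⟩ := h
  exact ⟨tr, s', h1, h2, h3.trans hT, hQ _ h4⟩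

theorem Prints.frame (h : Prints n c s ws T Q) :
    Prints n c s ws T (fun s' => Q s' ∧ Frame c s s') := by
  obtain ⟨tr, s', h1, h2, h3, h4⟩ := h
  exact ⟨tr, s', h1, h2, h3, h4, h1.frame⟩

theorem Does.skip (h : Q s) : Does n .skip s 0 Q := ⟨[], s, .skip, rfl, le_rfl, h⟩

theorem Does.assign {x : Var} {e : Expr} (h : e.Ok n s) (hQ : Q (s.set x (e.eval n s))) :
    Does n (.assign x e) s (e.cost + 2) Q :=
  ⟨_, _, .assign h, reduceOption_silent _, by simp, hQ⟩

theorem Does.store {A : Arr} {e₁ e₂ e₃ : Expr} (h₁ : e₁.Ok n s) (h₂ : e₂.Ok n s) (h₃ : e₃.Ok n s)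
    (hr : e₁.eval n s ≤ (n + 1) ^ 2) (hk : e₂.eval n s < n + 1)
    (hQ : Q (s.setArr A (e₁.eval n s) (e₂.eval n s) (e₃.eval n s))) :
    Does n (.store A e₁ e₂ e₃) s (e₃.cost + e₁.cost + e₂.cost + 7) Q :=
  ⟨_, _, .store h₁ h₂ h₃ hr hk, reduceOption_silent _, by simp, hQ⟩

theorem Prints.write {e : Expr} {v : ℕ} (h : e.Ok n s) (hv : e.eval n s = v) (hQ : Q s) :
    Prints n (.write e) s [v] (e.cost + 1) Q :=
  ⟨_, _, .write h, by rw [List.reduceOption_append, reduceOption_silent, hv]; rfl, by simp, hQ⟩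

theorem Prints.seq (h : Prints n c₁ s ws₁ T₁ (fun s' => Prints n c₂ s' ws₂ T₂ Q)) :
    Prints n (.seq c₁ c₂) s (ws₁ ++ ws₂) (T₁ + T₂) Q := by
  obtain ⟨tr, s', h1, h2, h3, tr', s'', h1', h2', h3', h4'⟩ := h
  exact ⟨_, _, .seq h1 h1', by rw [List.reduceOption_append, h2, h2'], by simp; omega, h4'⟩

theorem Does.seq (h : Does n c₁ s T₁ (fun s' => Does n c₂ s' T₂ Q)) :
    Does n (.seq c₁ c₂) s (T₁ + T₂) Q := Prints.seq h

theorem Prints.weaken (h : Prints n c s ws T Q) (hT : T ≤ T₁) : Prints n c s ws T₁ Q :=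
  h.mono hT fun _ h => h

/-- The rule threads a total time budget through a sequence of commands and hands the frame of the
first command to the proof for the second. -/
theorem Does.bind (h : Does n c₁ s T₁ Q') (hT : T₁ ≤ T)
    (h' : ∀ s', Q' s' → Frame c₁ s s' → Does n c₂ s' (T - T₁) Q) : Does n (.seq c₁ c₂) s T Q :=
  (Does.seq (h.frame.mono le_rfl fun s' hs' => h' s' hs'.1 hs'.2)).weaken (by omega)

theorem Does.assign_seq {x : Var} {e : Expr} (h : e.Ok n s) (hT : e.cost + 2 ≤ T)
    (hQ : Does n c (s.set x (e.eval n s)) (T - (e.cost + 2)) Q) :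
    Does n (.seq (.assign x e) c) s T Q :=
  (Does.seq (Does.assign h hQ)).weaken (by omega)

theorem Does.store_seq {A : Arr} {e₁ e₂ e₃ : Expr} (h₁ : e₁.Ok n s) (h₂ : e₂.Ok n s)
    (h₃ : e₃.Ok n s) (hr : e₁.eval n s ≤ (n + 1) ^ 2) (hk : e₂.eval n s < n + 1)
    (hT : e₃.cost + e₁.cost + e₂.cost + 7 ≤ T)
    (hQ : Does n c (s.setArr A (e₁.eval n s) (e₂.eval n s) (e₃.eval n s))
      (T - (e₃.cost + e₁.cost + e₂.cost + 7)) Q) :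
    Does n (.seq (.store A e₁ e₂ e₃) c) s T Q :=
  (Does.seq (Does.store h₁ h₂ h₃ hr hk hQ)).weaken (by omega)

theorem Does.ifLt {e₁ e₂ : Expr} (h₁ : e₁.Ok n s) (h₂ : e₂.Ok n s)
    (ht : e₁.eval n s < e₂.eval n s → Does n c₁ s T Q)
    (hf : ¬ e₁.eval n s < e₂.eval n s → Does n c₂ s T Q) :
    Does n (.ifLt e₁ e₂ c₁ c₂) s (e₁.cost + e₂.cost + 2 + T) Q := by
  by_cases h : e₁.eval n s < e₂.eval n s
  · obtain ⟨tr, s', h1', h2', h3', h4'⟩ := ht h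
    exact ⟨_, _, .ifLt_true h₁ h₂ h h1',
      by rw [List.reduceOption_append, reduceOption_silent, h2']; rfl, by simp; omega, h4'⟩
  · obtain ⟨tr, s', h1', h2', h3', h4'⟩ := hf h
    exact ⟨_, _, .ifLt_false h₁ h₂ h h1', by
      rw [List.reduceOption_append, List.reduceOption_append, reduceOption_silent, h2',
        reduceOption_silent]; rfl, by simp; omega, h4'⟩

theorem Does.ifRead_some {x : Var} {v : ℕ} {rest : List ℕ} (h : s.inp = v :: rest)
    (hv : v ≤ (n + 1) ^ 2) (hc : Does n c₁ { s.set x v with inp := rest } T Q) :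
    Does n (.ifRead x c₁ c₂) s (T + 2) Q := by
  obtain ⟨tr, s', h1', h2', h3', h4'⟩ := hc
  exact ⟨_, _, .ifRead_some h hv h1', by
      rw [List.reduceOption_append, List.reduceOption_append, reduceOption_silent, h2']; rfl,
      by simp; omega, h4'⟩

theorem Does.ifRead_none {x : Var} (h : s.inp = []) (hc : Does n c₂ s T Q) :
    Does n (.ifRead x c₁ c₂) s (T + 1) Q := by
  obtain ⟨tr, s', h1', h2', h3', h4'⟩ := hc
  exact ⟨_, _, .ifRead_none h h1', by
      rw [List.reduceOption_append, reduceOption_silent, h2']; rfl, by simp; omega, h4'⟩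

/-- The measure bounds the number of rounds; the additional factor pays for the final failing test.
-/
theorem Does.whileLt {e₁ e₂ : Expr} (Inv : Store → Prop) (μ : Store → ℕ)
    (hok : ∀ s, Inv s → e₁.Ok n s ∧ e₂.Ok n s)
    (hstep : ∀ s, Inv s → e₁.eval n s < e₂.eval n s →
      Does n c s T (fun s' => Inv s' ∧ μ s' < μ s)) (hs : Inv s) :
    Does n (.whileLt e₁ e₂ c) s ((μ s + 1) * (T + e₁.cost + e₂.cost + 2))
      (fun s' => Inv s' ∧ ¬ e₁.eval n s' < e₂.eval n s') := by
  induction hm : μ s using Nat.strong_induction_on generalizing s with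
  | _ m ih =>
    obtain ⟨h₁, h₂⟩ := hok s hs
    by_cases h : e₁.eval n s < e₂.eval n s
    · obtain ⟨tr, s', a1, a2, a3, a4, a5⟩ := hstep s hs h
      obtain ⟨tr', s'', b1, b2, b3, b4⟩ := ih _ (hm ▸ a5) a4 rfl
      refine ⟨_, _, .while_true h₁ h₂ h a1 b1, ?_, ?_, b4⟩
      · simp only [List.reduceOption_append, reduceOption_silent, a2, b2]; rfl
      · have : (μ s' + 1 + 1) * (T + e₁.cost + e₂.cost + 2) ≤
            (m + 1) * (T + e₁.cost + e₂.cost + 2) := Nat.mul_le_mul_right _ (by omega)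
        rw [add_mul (μ s' + 1)] at this
        simp only [List.length_append, List.length_replicate]
        omega
    · refine ⟨_, _, .while_false h₁ h₂ h, ?_, ?_, hs, h⟩
      · simp only [List.reduceOption_append, reduceOption_silent]; rfl
      · rw [add_mul]
        simp only [List.length_append, List.length_replicate]
        omega

/-- The loop in which `x` runs from the value of `e` to the last column. -/
def forLoop (x : Var) (e : Expr) (c : Cmd) : Cmd :=
  .seq (.assign x e)
    (.whileLt (.var x) .size (.seq c (.assign x (.add (.var x) (.lit 1)))))

/-- Besides its body, a round costs 12 steps: 5 for the test, 6 for the increment and 1 for the jump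
back. Leaving the loop costs 6. -/
theorem Prints.forLoop_aux {x : Var} (f : ℕ → List ℕ) (Inv : ℕ → Store → Prop)
    (hx : x ∉ c.vars) {lo d : ℕ} (hd : lo + d = n + 1)
    (hstep : ∀ j s, lo ≤ j → j ≤ n → s.var x = j → Inv j s →
      Prints n c s (f j) T (fun s' => Inv (j + 1) (s'.set x (j + 1))))
    (h0 : Inv lo s) (hs : s.var x = lo) :
    Prints n (.whileLt (.var x) .size (.seq c (.assign x (.add (.var x) (.lit 1))))) s
      ((List.range' lo d).flatMap f) (d * (T + 12) + 6) (fun s' => Inv (n + 1) s') := by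
  induction d generalizing lo s with
  | zero =>
    refine ⟨_, _, .while_false (by trivial) (by trivial) ?_, ?_, ?_, ?_⟩
    · simp only [Expr.eval]; omega
    · simp only [List.reduceOption_append, reduceOption_silent]; rfl
    · simp [Expr.cost]
    · rw [← hd]; exact h0
  | succ d ih =>
    obtain ⟨tr, s', a1, a2, a3, a4⟩ := hstep lo s le_rfl (by omega) hs h0
    have hx' : s'.var x = lo := by rw [a1.frame.var x hx, hs]
    have h1 : 1 * (n + 1) ≤ (n + 1) ^ 2 := by rw [pow_two]; exact Nat.mul_le_mul_right _ (by omega)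
    have A := Exec.assign (n := n) (s := s') (x := x) (e := .add (.var x) (.lit 1))
      ⟨trivial, by simp [Expr.Ok], by simp only [Expr.eval]; omega⟩
    simp only [Expr.eval, hx'] at A
    obtain ⟨tr', s'', b1, b2, b3, b4⟩ := ih (lo := lo + 1) (s := s'.set x (lo + 1)) (by omega)
      (fun j s hj => hstep j s (by omega)) a4 (by simp)
    refine ⟨_, _, .while_true (by trivial) (by trivial) ?_ (.seq a1 A) b1, ?_, ?_, b4⟩
    · simp only [Expr.eval]; omega
    · simp only [List.reduceOption_append, reduceOption_silent, a2, b2, List.range'_succ,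
        List.flatMap_cons, List.append_nil, List.nil_append]
    · rw [add_mul]
      simp only [List.length_append, List.length_replicate, Expr.cost]
      omega

theorem Prints.forLoop {x : Var} {e : Expr} (f : ℕ → List ℕ) (Inv : ℕ → Store → Prop) {lo : ℕ}
    (hx : x ∉ c.vars) (hok : e.Ok n s) (he : e.eval n s = lo) (hlo : lo ≤ n + 1)
    (h0 : Inv lo (s.set x lo))
    (hstep : ∀ j s, lo ≤ j → j ≤ n → s.var x = j → Inv j s →
      Prints n c s (f j) T (fun s' => Inv (j + 1) (s'.set x (j + 1)))) :
    Prints n (RAM.forLoop x e c) s ((List.range' lo (n + 1 - lo)).flatMap f)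
      ((n + 1) * (T + 12) + 8 + e.cost) (fun s' => Inv (n + 1) s') := by
  have h : Prints n (RAM.forLoop x e c) s ([] ++ _) _ _ :=
    Prints.seq (Does.assign hok (by
      rw [he]
      exact Prints.forLoop_aux f Inv hx (d := n + 1 - lo) (by omega) hstep h0 (by simp)))
  refine h.mono ?_ (fun _ h => h)
  have : (n + 1 - lo) * (T + 12) ≤ (n + 1) * (T + 12) := Nat.mul_le_mul_right _ (by omega)
  omega

theorem Does.forLoop {x : Var} {e : Expr} (Inv : ℕ → Store → Prop) {lo : ℕ}
    (hx : x ∉ c.vars) (hok : e.Ok n s) (he : e.eval n s = lo) (hlo : lo ≤ n + 1)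
    (h0 : Inv lo (s.set x lo))
    (hstep : ∀ j s, lo ≤ j → j ≤ n → s.var x = j → Inv j s →
      Does n c s T (fun s' => Inv (j + 1) (s'.set x (j + 1)))) :
    Does n (RAM.forLoop x e c) s ((n + 1) * (T + 12) + 8 + e.cost) (fun s' => Inv (n + 1) s') := by
  have := Prints.forLoop (fun _ => []) Inv hx hok he hlo h0 hstep
  rwa [List.flatMap_eq_nil_iff.2 (fun _ _ => rfl)] at this

end rules

/-! ### Output times -/

/-- The words of a run, each paired with the time when it is written. -/
def stamp : ℕ → List (Option ℕ) → List (ℕ × ℕ)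
  | _, [] => []
  | o, none :: tr => stamp (o + 1) tr
  | o, some v :: tr => (o, v) :: stamp (o + 1) tr

theorem stamp_append (o : ℕ) (tr tr' : List (Option ℕ)) :
    stamp o (tr ++ tr') = stamp o tr ++ stamp (o + tr.length) tr' := by
  induction tr generalizing o with
  | nil => rfl
  | cons a tr ih =>
    have e : o + (tr.length + 1) = o + 1 + tr.length := by omega
    cases a <;> simp [stamp, ih, e]

theorem stamp_snd (o : ℕ) (tr : List (Option ℕ)) :
    (stamp o tr).map Prod.snd = tr.reduceOption := by
  induction tr generalizing o with
  | nil => rfl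
  | cons a tr ih => cases a <;> simp [stamp, ih]

theorem stamp_length (o : ℕ) (tr : List (Option ℕ)) :
    (stamp o tr).length = tr.reduceOption.length := by
  rw [← stamp_snd o, List.length_map]

theorem stamp_bounds {o : ℕ} {tr : List (Option ℕ)} {p : ℕ × ℕ} (h : p ∈ stamp o tr) :
    o ≤ p.1 ∧ p.1 < o + tr.length := by
  induction tr generalizing o with
  | nil => simp [stamp] at h
  | cons a tr ih =>
    cases a with
    | none => have := ih h; simp; omega
    | some v =>
      simp only [stamp, List.mem_cons] at h
      rcases h with rfl | h
      · simp
      · have := ih h; simp; omega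

theorem stamp_sorted (o : ℕ) (tr : List (Option ℕ)) :
    ((stamp o tr).map Prod.fst).Pairwise (· < ·) := by
  induction tr generalizing o with
  | nil => simp [stamp]
  | cons a tr ih =>
    cases a with
    | none => exact ih _
    | some v =>
      simp only [stamp, List.map_cons, List.pairwise_cons]
      refine ⟨fun t ht => ?_, ih _⟩
      obtain ⟨p, hp, rfl⟩ := List.mem_map.1 ht
      have := stamp_bounds hp
      omega

theorem add_le_getElem_of_sorted {l : List ℕ} (h : l.Pairwise (· < ·)) (i d : ℕ)
    (hd : i + d < l.length) : l[i] + d ≤ l[i + d] := by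
  induction d with
  | zero => simp
  | succ d ih =>
    have h1 := ih (by omega)
    have h2 := List.pairwise_iff_getElem.1 h (i + d) (i + (d + 1)) (by omega) hd (by omega)
    omega

theorem Steps.outputs {P : Program} {w : ℕ} {x : List ℕ} {tr : List (Option ℕ)} {c : Config}
    (h : Steps P w (config P w x 0) tr c) :
    config P w x tr.length = c ∧ outputs P w x tr.length = stamp 0 tr := by
  -- The starting time is generalized for the induction along the trace.
  have key : ∀ (tr : List (Option ℕ)) (o : ℕ), Steps P w (config P w x o) tr c →
      config P w x (o + tr.length) = c ∧
      (List.range' o tr.length).filterMap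
        (fun t => (emitted P (config P w x t)).map fun v => (t, v)) = stamp o tr := by
    intro tr
    induction tr with
    | nil => intro o h; exact ⟨h.symm, rfl⟩
    | cons a tr ih =>
      intro o h
      obtain ⟨h1, h2⟩ := ih (o + 1) h.2
      refine ⟨by rw [← h1]; congr 1; simp; omega, ?_⟩
      rw [List.length_cons, List.range'_succ, List.filterMap_cons, h2, h.1]
      cases a <;> rfl
  have := key tr 0 h
  rw [zero_add] at this
  refine ⟨this.1, ?_⟩
  rw [RAM.outputs, List.range_eq_range', this.2]

/-- The first word of the `i`-th element is written inside the `i`-th block, less than `D` steps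
after its beginning; since blocks have length at most `D`, consecutive starting times differ by at
most `2 * D`. The lower bound holds because output times strictly increase and each element takes
`n` words. The last conclusion bounds `t 0` by the position of any written word; it serves the case
in which a bound by `D` would be too weak. -/
theorem enumerates_of_blocks {α : Type*} {P : Program} {w : ℕ} {x : List ℕ} {enc : α → List ℕ}
    {S : Set α} {s : List α} {n D : ℕ} (hn : 0 < n) (henc : ∀ a, (enc a).length = n)
    {tr₀ tr₁ : List (Option ℕ)} {bs : List (List (Option ℕ))} {c : Config}
    (hsteps : Steps P w (config P w x 0) (tr₀ ++ (bs.flatten ++ tr₁)) c) (hc : Halted P c)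
    (h₀ : tr₀.reduceOption = []) (hbs : bs.map List.reduceOption = s.map enc)
    (hbD : ∀ b ∈ bs, b.length ≤ D) (h₁ : tr₁.reduceOption = [EOE]) (h₁D : tr₁.length ≤ D)
    (hnodup : s.Nodup) (hmem : ∀ a, a ∈ s ↔ a ∈ S) :
    ∃ t : ℕ → ℕ, Enumerates P w x enc S s t ∧ t 0 ≤ tr₀.length + D ∧
      (∀ i < s.length, t i + n ≤ t (i + 1) ∧ t (i + 1) ≤ t i + 2 * D) ∧
      ∀ pre v post, tr₀ ++ (bs.flatten ++ tr₁) = pre ++ some v :: post → t 0 ≤ pre.length := by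
  obtain ⟨hcfg, hout⟩ := hsteps.outputs
  set tr := tr₀ ++ (bs.flatten ++ tr₁) with htr
  have hlen : bs.length = s.length := by simpa using congrArg List.length hbs
  have htake : ∀ i, (bs.take i).flatten.reduceOption = (s.take i).flatMap enc := by
    intro i
    rw [List.flatMap_def, List.map_take, ← hbs, ← List.map_take]
    generalize bs.take i = l
    induction l with
    | nil => rfl
    | cons b l ih => simp [List.reduceOption_append, ih]
  have hwords : tr.reduceOption = s.flatMap enc ++ [EOE] := by
    have := htake bs.length
    rw [List.take_length, hlen, List.take_length] at this
    simp [htr, List.reduceOption_append, h₀, h₁, this]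
  have hfl : ∀ l : List α, (l.flatMap enc).length = l.length * n := by
    intro l
    induction l with
    | nil => simp
    | cons a l ih => simp [henc, ih, add_mul, add_comm]
  set τ := (stamp 0 tr).map Prod.fst with hτ
  have hτlen : τ.length = s.length * n + 1 := by
    rw [hτ, List.length_map, stamp_length, hwords, List.length_append, hfl]; simp
  have hlt : ∀ i ≤ s.length, i * n < τ.length := by
    intro i hi
    have := Nat.mul_le_mul_right n hi
    omega
  -- The time at which block `i` begins.
  let o : ℕ → ℕ := fun i => tr₀.length + (bs.take i).flatten.length
  have hloc : ∀ i ≤ s.length, ∃ t, τ[i * n]? = some t ∧ o i ≤ t ∧ t < o i + D := by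
    intro i hi
    -- For `i = s.length` the role of the block is played by `tr₁`, which writes the end marker.
    obtain ⟨b, z, hbz, hb, hbD⟩ : ∃ b z : List (Option ℕ), (bs.drop i).flatten ++ tr₁ = b ++ z ∧
        b.reduceOption ≠ [] ∧ b.length ≤ D := by
      rcases Nat.lt_or_ge i s.length with h | h
      · rw [← hlen] at h
        refine ⟨bs[i], (bs.drop (i + 1)).flatten ++ tr₁, ?_, ?_, hbD _ (List.getElem_mem h)⟩
        · rw [List.drop_eq_getElem_cons h, List.flatten_cons, List.append_assoc]
        · have e : bs[i].reduceOption = enc (s[i]'(hlen ▸ h)) := by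
            have := List.getElem_of_eq hbs (i := i) (by simpa using h)
            simpa using this
          rw [e]
          intro h0
          have := henc (s[i]'(hlen ▸ h))
          rw [h0] at this
          simp at this
          omega
      · exact ⟨tr₁, [], by rw [List.drop_eq_nil_of_le (by omega)]; simp, by simp [h₁], h₁D⟩
    have hsplit : tr = (tr₀ ++ (bs.take i).flatten) ++ (b ++ z) := by
      rw [← hbz, htr]
      conv_lhs => rw [← List.take_append_drop i bs, List.flatten_append]
      simp only [List.append_assoc]
    have hl : ((stamp 0 (tr₀ ++ (bs.take i).flatten)).map Prod.fst).length = i * n := by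
      rw [List.length_map, stamp_length, List.reduceOption_append, h₀, htake, List.nil_append, hfl,
        List.length_take, min_eq_left hi]
    have hb' : 0 < (stamp (o i) b).length := by
      rw [stamp_length]; exact List.length_pos_iff.2 hb
    refine ⟨(stamp (o i) b)[0].1, ?_, ?_⟩
    · rw [hτ, hsplit, stamp_append, List.map_append, List.getElem?_append_right (by omega), hl,
        Nat.sub_self, stamp_append, List.map_append, zero_add, List.length_append]
      rw [List.getElem?_append_left (by rw [List.length_map]; exact hb'), List.getElem?_map,
        List.getElem?_eq_getElem hb']
      rfl
    · have := stamp_bounds (List.getElem_mem hb')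
      omega
  have ho : ∀ i < s.length, o (i + 1) ≤ o i + D := by
    intro i hi
    rw [← hlen] at hi
    have := hbD _ (List.getElem_mem hi)
    simp only [o]
    rw [← List.take_concat_get' _ _ hi, List.flatten_append, List.length_append,
      List.flatten_singleton]
    omega
  have ho0 : o 0 = tr₀.length := by simp [o]
  -- Element `i` begins with word number `i * n`. The default value is never used for `i ≤
  -- s.length`.
  refine ⟨fun i => τ.getD (i * n) 0, ⟨hnodup, hmem, tr.length, hcfg ▸ hc, ?_, ?_⟩, ?_, ?_, ?_⟩
  · rw [hout, stamp_snd, hwords]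
  · intro i hi
    rw [hout, hfl, List.length_take, min_eq_left hi, ← hτ]
    obtain ⟨t, ht, -⟩ := hloc i hi
    simp [ht]
  · obtain ⟨t, ht, h1, h2⟩ := hloc 0 (by omega)
    simp only [List.getD_eq_getElem?_getD, ht, Option.getD_some]
    omega
  · intro i hi
    obtain ⟨t, ht, h1, h2⟩ := hloc i hi.le
    obtain ⟨t', ht', h1', h2'⟩ := hloc (i + 1) hi
    have := ho i hi
    simp only [List.getD_eq_getElem?_getD, ht, ht', Option.getD_some]
    refine ⟨?_, by omega⟩
    have h3 := hlt (i + 1) hi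
    rw [List.getElem?_eq_getElem (hlt i hi.le)] at ht
    rw [List.getElem?_eq_getElem h3] at ht'
    simp only [Option.some.injEq] at ht ht'
    have e : (i + 1) * n = i * n + n := by ring
    have := add_le_getElem_of_sorted (stamp_sorted 0 tr) (i * n) n (by rw [← hτ]; omega)
    rw [← ht, ← ht']
    simp only [e]
    exact this
  · intro pre v post h
    simp only [zero_mul]
    rw [hτ, h, stamp_append]
    rcases hp : stamp 0 pre with _ | ⟨p, l⟩
    · simp [stamp]
    · have := stamp_bounds (o := 0) (tr := pre) (p := p) (by rw [hp]; simp)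
      simp
      omega

end RAM

/-! ### Tables of coset representatives -/

namespace PermTable

open Equiv

variable {n : ℕ} {T T' : ℕ → Set (Perm (Fin n))}

/-- The products `V_{i+d-1} ⋯ V_{i+1} V_i` with `V_j ∈ T j`. -/
def Desc (T : ℕ → Set (Perm (Fin n))) : ℕ → ℕ → Set (Perm (Fin n))
  | _, 0 => {1}
  | i, d + 1 => {g | ∃ V ∈ T i, ∃ y ∈ Desc T (i + 1) d, g = y * V}

theorem Desc.mono (h : ∀ i, T i ⊆ T' i) {i d : ℕ} : Desc T i d ⊆ Desc T' i d := by
  induction d generalizing i with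
  | zero => exact subset_rfl
  | succ d ih =>
    rintro g ⟨V, hV, y, hy, rfl⟩
    exact ⟨V, h i hV, y, ih hy, rfl⟩

/-- The definition peels off the lowest level on the right, whereas sifting adds the next higher
level on the left; this reconciles the two. -/
theorem Desc.mul_left {i d : ℕ} {g V : Perm (Fin n)} (hg : g ∈ Desc T i d) (hV : V ∈ T (i + d)) :
    V * g ∈ Desc T i (d + 1) := by
  induction d generalizing i g with
  | zero =>
    obtain rfl : g = 1 := hg
    exact ⟨V, hV, 1, rfl, by simp⟩
  | succ d ih =>
    obtain ⟨W, hW, y, hy, rfl⟩ := hg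
    exact ⟨W, hW, V * y, ih hy (by rwa [show i + 1 + d = i + (d + 1) by omega]),
      by rw [mul_assoc]⟩

/-- Level `i` of the table holds the identity and permutations that fix all points below `i`, at most
one for every preimage of `i`. -/
structure IsTable (T : ℕ → Set (Perm (Fin n))) : Prop where
  one : ∀ i < n, 1 ∈ T i
  fix : ∀ i < n, ∀ V ∈ T i, ∀ k : Fin n, (k : ℕ) < i → V k = k
  uniq : ∀ i : Fin n, ∀ V ∈ T i, ∀ W ∈ T i, ∀ j, V j = i → W j = i → V = W

theorem Desc.fix (h : IsTable T) {i d : ℕ} (hd : i + d ≤ n) {g : Perm (Fin n)}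
    (hg : g ∈ Desc T i d) (k : Fin n) (hk : (k : ℕ) < i) : g k = k := by
  induction d generalizing i g with
  | zero =>
    obtain rfl : g = 1 := hg
    rfl
  | succ d ih =>
    obtain ⟨V, hV, y, hy, rfl⟩ := hg
    rw [Perm.mul_apply, h.fix i (by omega) V hV k hk]
    exact ih (by omega) hy (by omega)

theorem Desc.one_mem (h : IsTable T) {i d : ℕ} (hd : i + d ≤ n) : 1 ∈ Desc T i d := by
  induction d generalizing i with
  | zero => rfl
  | succ d ih => exact ⟨1, h.one i (by omega), 1, ih (by omega), by simp⟩

/-- All factors above level `i` fix the point `i`. If the whole product fixes it too, then so does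
the factor of level `i`, which by uniqueness is the identity. Thus trivial low factors can be
removed one at a time. -/
theorem Desc.shrink (h : IsTable T) {i d : ℕ} (hd : i + d = n) {g : Perm (Fin n)}
    (hg : g ∈ Desc T 0 n) (hfix : ∀ k : Fin n, (k : ℕ) < i → g k = k) : g ∈ Desc T i d := by
  induction i generalizing d with
  | zero =>
    obtain rfl : d = n := by omega
    exact hg
  | succ i ih =>
    obtain ⟨V, hV, y, hy, rfl⟩ := ih (d := d + 1) (by omega) (fun k hk => hfix k (by omega))
    have h1 := hfix ⟨i, by omega⟩ (by simp)
    have h2 := Desc.fix h (by omega) hy ⟨i, by omega⟩ (by simp)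
    have h3 : V ⟨i, by omega⟩ = ⟨i, by omega⟩ := y.injective (by rw [h2]; exact h1)
    have h4 : V = 1 := h.uniq ⟨i, by omega⟩ V hV 1 (h.one i (by omega)) _ h3 rfl
    rw [h4, mul_one]
    exact hy

/-- Closure under right multiplication by single entries passes to products of entries, one factor
after the other. -/
theorem Desc.mul_mem_of_closed {S : Set (Perm (Fin n))} {i : ℕ}
    (hS : ∀ x ∈ S, ∀ j, i ≤ j → j < n → ∀ a ∈ T j, x * a ∈ S) {i' d : ℕ} (hi : i ≤ i')
    (hd : i' + d ≤ n) {x z : Perm (Fin n)} (hx : x ∈ S) (hz : z ∈ Desc T i' d) : x * z ∈ S := by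
  induction d generalizing i' z with
  | zero =>
    obtain rfl : z = 1 := hz
    simpa using hx
  | succ d ih =>
    obtain ⟨V, hV, y, hy, rfl⟩ := hz
    rw [← mul_assoc]
    exact hS _ (ih (by omega) (by omega) hy) i' hi (by omega) V hV

/-- For `x = y * V`, the product `V * a` of two entries has a factorization by hypothesis, and by
`Desc.shrink` one of the form `z * W` that starts at level `i`. Then `x * a = (y * z) * W`, and `y *
z` stays in the part above level `i` by induction. -/
theorem Desc.mul_mem (h : IsTable T)
    (hpair : ∀ i < n, ∀ j < n, ∀ V ∈ T i, ∀ W ∈ T j, V * W ∈ Desc T 0 n) {i d : ℕ}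
    (hd : i + d = n) : ∀ x ∈ Desc T i d, ∀ j, i ≤ j → j < n → ∀ a ∈ T j, x * a ∈ Desc T i d := by
  induction d generalizing i with
  | zero => intro x _ j hj hj'; omega
  | succ d ih =>
    rintro x ⟨V, hV, y, hy, rfl⟩ j hj hj' a ha
    have h1 : V * a ∈ Desc T i (d + 1) := by
      refine Desc.shrink h hd (hpair i (by omega) j hj' V hV a ha) fun k hk => ?_
      rw [Perm.mul_apply, h.fix j hj' a ha k (by omega), h.fix i (by omega) V hV k hk]
    obtain ⟨W, hW, z, hz, e⟩ := h1
    refine ⟨W, hW, y * z, ?_, by rw [mul_assoc, e, mul_assoc]⟩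
    exact Desc.mul_mem_of_closed (ih (by omega)) le_rfl (by omega) hy hz

/-- A table through which the generators and all products of two entries can be sifted yields all
elements of the group. -/
theorem desc_eq_closure (h : IsTable T) {A : Set (Perm (Fin n))}
    (hsub : ∀ i < n, ∀ V ∈ T i, V ∈ Subgroup.closure A)
    (hA : ∀ a ∈ A, a⁻¹ ∈ Desc T 0 n)
    (hpair : ∀ i < n, ∀ j < n, ∀ V ∈ T i, ∀ W ∈ T j, V * W ∈ Desc T 0 n) :
    Desc T 0 n = (Subgroup.closure A : Set (Perm (Fin n))) := by
  have hmul : ∀ x ∈ Desc T 0 n, ∀ y ∈ Desc T 0 n, x * y ∈ Desc T 0 n := fun x hx y hy =>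
    Desc.mul_mem_of_closed (Desc.mul_mem h hpair (by omega)) le_rfl (by omega) hx hy
  have hpow : ∀ x ∈ Desc T 0 n, ∀ m : ℕ, x ^ m ∈ Desc T 0 n := by
    intro x hx m
    induction m with
    | zero => simpa using Desc.one_mem h (by omega)
    | succ m ih => rw [pow_succ]; exact hmul _ ih _ hx
  -- In a finite group inverses are powers, so closure under multiplication suffices.
  have hinv : ∀ x ∈ Desc T 0 n, x⁻¹ ∈ Desc T 0 n := by
    intro x hx
    have e : x⁻¹ = x ^ (orderOf x - 1) := by
      rw [inv_eq_iff_mul_eq_one, ← pow_succ', Nat.sub_add_cancel (orderOf_pos x),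
        pow_orderOf_eq_one]
    rw [e]
    exact hpow x hx _
  apply Set.Subset.antisymm
  · have : ∀ d i, i + d ≤ n → Desc T i d ⊆ (Subgroup.closure A : Set (Perm (Fin n))) := by
      intro d
      induction d with
      | zero =>
        rintro i - g rfl
        exact one_mem _
      | succ d ih =>
        rintro i hi g ⟨V, hV, y, hy, rfl⟩
        exact mul_mem (ih _ (by omega) hy) (hsub i (by omega) V hV)
    exact this n 0 (by omega)
  · intro x hx
    induction hx using Subgroup.closure_induction with
    | mem a ha => simpa using hinv _ (hA a ha)
    | one => exact Desc.one_mem h (by omega)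
    | mul x y _ _ hx hy => exact hmul x hx y hy
    | inv x _ hx => exact hinv x hx

/-! ### The order of enumeration -/

/-- The list of all products `V_{i+d-1} ⋯ V_{i+1} V_i h` with `V_j` from the list `L j`. -/
def prodList (L : ℕ → List (Perm (Fin n))) : ℕ → ℕ → Perm (Fin n) → List (Perm (Fin n))
  | _, 0, h => [h]
  | i, d + 1, h => (L i).flatMap fun V => prodList L (i + 1) d (V * h)

variable {L : ℕ → List (Perm (Fin n))}

theorem mem_prodList (hL : ∀ i < n, ∀ V, V ∈ L i ↔ V ∈ T i) {i d : ℕ} (hd : i + d ≤ n)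
    {h x : Perm (Fin n)} : x ∈ prodList L i d h ↔ ∃ y ∈ Desc T i d, x = y * h := by
  induction d generalizing i h with
  | zero => simp [prodList, Desc]
  | succ d ih =>
    simp only [prodList, List.mem_flatMap, ih (i := i + 1) (by omega), hL i (by omega)]
    constructor
    · rintro ⟨V, hV, y, hy, rfl⟩
      exact ⟨y * V, ⟨V, hV, y, hy, rfl⟩, by rw [mul_assoc]⟩
    · rintro ⟨_, ⟨V, hV, y, hy, rfl⟩, rfl⟩
      exact ⟨V, hV, y, hy, by rw [mul_assoc]⟩

/-- If `y * V * h = z * W * h` with `y` and `z` from the levels above `i`, then `V` and `W` have the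
same preimage of `i`, because `y` and `z` fix `i`. Hence `V = W`, so different entries of a level
lead to disjoint lists. -/
theorem nodup_prodList (hT : IsTable T) (hL : ∀ i < n, ∀ V, V ∈ L i ↔ V ∈ T i)
    (hLn : ∀ i < n, (L i).Nodup) {i d : ℕ} (hd : i + d ≤ n) (h : Perm (Fin n)) :
    (prodList L i d h).Nodup := by
  induction d generalizing i h with
  | zero => simp [prodList]
  | succ d ih =>
    rw [prodList, List.nodup_flatMap]
    refine ⟨fun V _ => ih (by omega) _, ?_⟩
    refine List.Pairwise.imp_of_mem ?_ (hLn i (by omega))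
    intro V W hV hW hVW x hx hx'
    rw [mem_prodList hL (by omega)] at hx hx'
    obtain ⟨y, hy, rfl⟩ := hx
    obtain ⟨z, hz, e⟩ := hx'
    rw [← mul_assoc, ← mul_assoc, mul_left_inj] at e
    apply hVW
    rw [hL i (by omega)] at hV hW
    have hy' := Desc.fix hT (by omega) hy ⟨i, by omega⟩ (by simp)
    have hz' := Desc.fix hT (by omega) hz ⟨i, by omega⟩ (by simp)
    refine hT.uniq ⟨i, by omega⟩ V hV W hW (V⁻¹ ⟨i, by omega⟩) (by simp) (z.injective ?_)
    rw [hz', ← Perm.mul_apply, ← e, Perm.mul_apply]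
    simpa using hy'

/-- What remains to be enumerated on the levels below `j`, if the entries `tl l` have not been used
yet on level `l` and `q l` is the product of the current entries of the levels below `l`. -/
def rest (L tl : ℕ → List (Perm (Fin n))) (q : ℕ → Perm (Fin n)) : ℕ → List (Perm (Fin n))
  | 0 => []
  | j + 1 => ((tl j).flatMap fun V => prodList L (j + 1) (n - (j + 1)) (V * q j)) ++ rest L tl q j

variable {tl tl' : ℕ → List (Perm (Fin n))} {q q' : ℕ → Perm (Fin n)}

theorem rest_congr {j : ℕ} (htl : ∀ l < j, tl l = tl' l) (hq : ∀ l < j, q l = q' l) :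
    rest L tl q j = rest L tl' q' j := by
  induction j with
  | zero => rfl
  | succ j ih =>
    rw [rest, rest, ih (fun l hl => htl l (by omega)) (fun l hl => hq l (by omega)),
      htl j (by omega), hq j (by omega)]

theorem rest_skip {j m : ℕ} (hm : j ≤ m) (h : ∀ l, j ≤ l → l < m → tl l = []) :
    rest L tl q m = rest L tl q j := by
  induction m, hm using Nat.le_induction with
  | base => rfl
  | succ m hm ih =>
    rw [rest, h m hm (by omega), ih (fun l hl hl' => h l hl (by omega))]
    rfl

/-- When every level from `i` on stands at the identity, all partial products there equal `h`. The
first product listed is then `h` itself, and the others are those still pending on these levels. -/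
theorem prodList_append_rest {h : Perm (Fin n)} {i d : ℕ} (hd : i + d = n)
    (htl : ∀ l, i ≤ l → l < n → L l = 1 :: tl l) (hq : ∀ l, i ≤ l → l < n → q l = h) :
    prodList L i d h ++ rest L tl q i = h :: rest L tl q n := by
  induction d generalizing i with
  | zero =>
    obtain rfl : i = n := by omega
    rfl
  | succ d ih =>
    rw [← ih (i := i + 1) (by omega) (fun l hl => htl l (by omega))
      (fun l hl => hq l (by omega)), prodList, rest, htl i le_rfl (by omega), List.flatMap_cons,
      one_mul, hq i le_rfl (by omega), show n - (i + 1) = d by omega, List.append_assoc]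

/-- One step of the enumeration: the entry on level `j` is replaced by the next one, the entries on
the levels above are reset. -/
theorem rest_step {j : ℕ} (hj : j < n) {V : Perm (Fin n)} (hV : tl j = V :: tl' j)
    (hnil : ∀ l, j < l → l < n → tl l = []) (htl : ∀ l < j, tl' l = tl l)
    (hL : ∀ l, j < l → l < n → L l = 1 :: tl' l) (hq : ∀ l ≤ j, q' l = q l)
    (hq' : ∀ l, j < l → l ≤ n → q' l = V * q j) :
    rest L tl q n = q' n :: rest L tl' q' n := by
  -- The levels above `j` are exhausted and contribute nothing.
  have h1 : rest L tl q n = rest L tl q (j + 1) :=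
    rest_skip hj fun l hl hl' => hnil l (by omega) hl'
  rw [h1, hq' n hj le_rfl, ← prodList_append_rest (i := j + 1) (d := n - (j + 1)) (by omega)
    (fun l hl => hL l (by omega)) (fun l hl hl' => hq' l (by omega) hl'.le), rest, rest, hV,
    List.flatMap_cons, List.append_assoc, hq j le_rfl,
    rest_congr (fun l hl => htl l hl) (fun l hl => hq l hl.le)]

end PermTable

namespace RAM

set_option linter.constructorNameAsVariable false

open Equiv PermTable

/-! ### Sifting permutations through the table -/

/-- The columns `1, …, n` of an array row hold the values of a permutation. -/
def Rep {n : ℕ} (row : ℕ → ℕ) (g : Perm (Fin n)) : Prop := ∀ k : Fin n, row (k + 1) = g k + 1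

theorem fin_succ_le {n : ℕ} (i : Fin n) : (i : ℕ) + 1 ≤ (n + 1) ^ 2 := by
  have h1 : 1 * (n + 1) ≤ (n + 1) ^ 2 := by rw [pow_two]; exact Nat.mul_le_mul_right _ (by omega)
  omega

/-- Writing `τ i` into column `σ i` covers copying, composing and inverting at once. As `σ` is
injective, the column about to be written still has its old content; this permits updates in place.
-/
theorem Does.fillRow {n : ℕ} {s : Store} {A : Arr} {e₁ e₂ e₃ : Expr} {R : ℕ}
    {σ τ : Perm (Fin n)} (hR : R ≤ (n + 1) ^ 2)
    (h : ∀ s' : Store, (∀ x, x ≠ .k → s'.var x = s.var x) → (∀ B, B ≠ A → s'.arr B = s.arr B) →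
      (∀ r, r ≠ R → s'.arr A r = s.arr A r) → ∀ i : Fin n, s'.var .k = i + 1 →
      s'.arr A R (σ i + 1) = s.arr A R (σ i + 1) →
      (e₁.Ok n s' ∧ e₂.Ok n s' ∧ e₃.Ok n s') ∧
        e₁.eval n s' = R ∧ e₂.eval n s' = σ i + 1 ∧ e₃.eval n s' = τ i + 1) :
    Does n (RAM.forLoop .k (.lit 1) (.store A e₁ e₂ e₃)) s
      ((n + 1) * (e₃.cost + e₁.cost + e₂.cost + 19) + 9)
      (fun s' => Rep (s'.arr A R) (τ * σ⁻¹) ∧ ∀ r, r ≠ R → s'.arr A r = s.arr A r) := by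
  refine (Does.forLoop (T := e₃.cost + e₁.cost + e₂.cost + 7) (lo := 1)
    (fun j s' => (∀ x, x ≠ .k → s'.var x = s.var x) ∧ (∀ B, B ≠ A → s'.arr B = s.arr B) ∧
      (∀ r, r ≠ R → s'.arr A r = s.arr A r) ∧
      ∀ i : Fin n, s'.arr A R (σ i + 1) = if (i : ℕ) + 1 < j then (τ i : ℕ) + 1 else
        s.arr A R (σ i + 1)) (by simp [Cmd.vars]) (by simp [Expr.Ok]) rfl (by omega) ?_ ?_).mono
    (by simp [Expr.cost, add_assoc]) ?_
  · refine ⟨fun x hx => by simp [hx], fun _ _ => rfl, fun _ _ => rfl, fun i => by simp⟩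
  · rintro j s' hj hj' hk ⟨h1, h2, h3, h4⟩
    obtain ⟨i, rfl⟩ : ∃ i : Fin n, j = i + 1 := ⟨⟨j - 1, by omega⟩, by simp; omega⟩
    obtain ⟨⟨o1, o2, o3⟩, v1, v2, v3⟩ := h s' h1 h2 h3 i hk (by rw [h4]; simp)
    refine Does.store o1 o2 o3 (by omega) (by omega) ?_
    rw [v1, v2, v3]
    refine ⟨fun x hx => by simp [hx, h1], fun B hB => by simp [hB, h2], fun r hr => ?_,
      fun k => ?_⟩
    · funext c
      simp [Store.setArr_arr, hr, h3 r hr]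
    · simp only [Store.set_arr, Store.setArr_arr, true_and, h4]
      by_cases e : k = i
      · subst e; simp
      · have e1 : ¬ (σ k : ℕ) + 1 = σ i + 1 := fun h => e (σ.injective (Fin.ext (by omega)))
        have e2 : (k : ℕ) ≠ i := fun h => e (Fin.ext h)
        have e3 : ((k : ℕ) + 1 < i + 1 + 1) ↔ (k : ℕ) + 1 < i + 1 := by omega
        simp only [e1, if_false, e3]
  · rintro s' ⟨h1, h2, h3, h4⟩
    refine ⟨fun k => ?_, h3⟩
    have := h4 (σ⁻¹ k)
    rw [if_pos (by omega)] at this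
    simpa using this

/-! ### The table in memory: numbered entries, index and linked lists -/

/-- The list `l` of numbers is linked in the first column of `X`, from the pointer `v` on. -/
def Chain (X : ℕ → ℕ → ℕ) : ℕ → List ℕ → Prop
  | v, [] => v = 0
  | v, e :: l => v = e + 1 ∧ Chain X (X (e + 1) 0) l

theorem Chain.congr {X Y : ℕ → ℕ → ℕ} {v : ℕ} {l : List ℕ} (h : Chain X v l)
    (hXY : ∀ e ∈ l, Y (e + 1) 0 = X (e + 1) 0) : Chain Y v l := by
  induction l generalizing v with
  | nil => exact h
  | cons e l ih =>
    exact ⟨h.1, hXY e (by simp) ▸ ih h.2 (fun e he => hXY e (by simp [he]))⟩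

variable {n : ℕ} {A : Set (Perm (Fin n))} {els els' : List (Fin n × Perm (Fin n))} {s s' : Store}

/-- The list of the table entries, each with its level. -/
structure IsEntries (A : Set (Perm (Fin n))) (els : List (Fin n × Perm (Fin n))) : Prop where
  init : ∀ i : Fin n, els[(i : ℕ)]? = some (i, 1)
  fix : ∀ p ∈ els, ∀ k < p.1, p.2 k = k
  mem : ∀ p ∈ els, p.2 ∈ Subgroup.closure A
  nodup : (els.map fun p => (p.1, p.2⁻¹ p.1)).Nodup

/-- An entry is determined by its level and its preimage of the point of that level. -/
theorem IsEntries.length_le (h : IsEntries A els) : els.length ≤ n ^ 2 := by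
  have := h.nodup.length_le_card
  simpa [pow_two] using this

theorem IsEntries.le_length (h : IsEntries A els) : n ≤ els.length := by
  by_contra hlt
  have := h.init ⟨els.length, by omega⟩
  simp at this

theorem IsEntries.length_lt (h : IsEntries A els) : els.length + 1 ≤ (n + 1) ^ 2 := by
  have := h.length_le
  have e : (n + 1) ^ 2 = n ^ 2 + 2 * n + 1 := by ring
  omega

/-- The table entries of a level. -/
def level (els : List (Fin n × Perm (Fin n))) (i : ℕ) : Set (Perm (Fin n)) :=
  {V | ∃ p ∈ els, (p.1 : ℕ) = i ∧ p.2 = V}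

theorem level_mono (h : els <+: els') (i : ℕ) : level els i ⊆ level els' i := by
  rintro V ⟨p, hp, h1, h2⟩
  exact ⟨p, h.subset hp, h1, h2⟩

theorem IsEntries.ext (h : IsEntries A els) {p q : Fin n × Perm (Fin n)} (hp : p ∈ els)
    (hq : q ∈ els) (hl : p.1 = q.1) {j : Fin n} (hpj : p.2 j = p.1) (hqj : q.2 j = q.1) :
    p = q := by
  refine List.inj_on_of_nodup_map h.nodup hp hq ?_
  simp only [Prod.mk.injEq]
  exact ⟨hl, by rw [Perm.inv_eq_iff_eq.2 hpj.symm, Perm.inv_eq_iff_eq.2 hqj.symm]⟩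

theorem IsEntries.isTable (h : IsEntries A els) : IsTable (level els) where
  one i hi := ⟨(⟨i, hi⟩, 1), List.mem_of_getElem? (h.init ⟨i, hi⟩), rfl, rfl⟩
  fix := by
    rintro i hi _ ⟨p, hp, h1, rfl⟩ k hk
    exact h.fix p hp k (by omega)
  uniq := by
    rintro i _ ⟨p, hp, h1, rfl⟩ _ ⟨q, hq, h2, rfl⟩ j hj hj'
    have e1 := Fin.ext h1
    have e2 := Fin.ext h2
    rw [h.ext hp hq (e1.trans e2.symm) (hj.trans e1.symm) (hj'.trans e2.symm)]

/-- The inverse is inserted because it takes `g i` back to `i`; its preimage `g i` is new on this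
level. -/
theorem IsEntries.insert (h : IsEntries A els) {i : Fin n} {g : Perm (Fin n)}
    (hg : g ∈ Subgroup.closure A) (hfix : ∀ k < i, g k = k)
    (hnew : ∀ p ∈ els, p.1 = i → p.2 (g i) ≠ i) : IsEntries A (els ++ [(i, g⁻¹)]) where
  init k := by
    have := h.le_length
    rw [List.getElem?_append_left (by omega), h.init]
  fix := by
    intro p hp k hk
    rw [List.mem_append, List.mem_singleton] at hp
    rcases hp with hp | rfl
    · exact h.fix p hp k hk
    · exact Perm.inv_eq_iff_eq.2 (hfix k hk).symm
  mem := by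
    intro p hp
    rw [List.mem_append, List.mem_singleton] at hp
    rcases hp with hp | rfl
    · exact h.mem p hp
    · exact inv_mem hg
  nodup := by
    rw [List.map_append, List.nodup_append]
    refine ⟨h.nodup, by simp, ?_⟩
    rintro a ha b hb rfl
    simp only [List.map_cons, List.map_nil, List.mem_singleton, inv_inv] at hb
    obtain ⟨p, hp, e⟩ := List.mem_map.1 ha
    rw [hb, Prod.mk.injEq] at e
    refine hnew p hp e.1 ?_
    rw [← e.2, ← e.1]
    simp

/-- The store holds the table: `E` the values of the entries, `I` their numbers, and `X` a linked list
of the entries for every level, beginning with the identity. -/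
structure Tab (A : Set (Perm (Fin n))) (els : List (Fin n × Perm (Fin n))) (s : Store) : Prop where
  entries : IsEntries A els
  count : s.var .N = els.length
  rep : ∀ e p, els[e]? = some p → Rep (s.arr .E (e + 1)) p.2
  idx : ∀ (i j : Fin n) (e : ℕ),
    s.arr .I (i + 1) (j + 1) = e + 1 ↔ ∃ p, els[e]? = some p ∧ p.1 = i ∧ p.2 j = i
  chain : ∀ i : Fin n, ∃ l : List ℕ, Chain (s.arr .X) (s.arr .X (i + 1) 0) l ∧
    ((i : ℕ) :: l).Nodup ∧ ∀ e, e ∈ (i : ℕ) :: l ↔ ∃ p, els[e]? = some p ∧ p.1 = i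

theorem Tab.congr (h : Tab A els s) (hN : s'.var .N = s.var .N) (hE : s'.arr .E = s.arr .E)
    (hI : s'.arr .I = s.arr .I) (hX : s'.arr .X = s.arr .X) : Tab A els s' where
  entries := h.entries
  count := hN.trans h.count
  rep := hE ▸ h.rep
  idx := hI ▸ h.idx
  chain := hX ▸ h.chain

/-- Insertion of the permutation in `G` as a new table entry on level `i`. -/
def insertCmd : Cmd :=
  .seq (.assign .N (.add (.var .N) (.lit 1)))
  (.seq (forLoop .k (.lit 1) (.store .E (.var .N) (.get .G (.lit 0) (.var .k)) (.var .k)))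
  (.seq (.store .I (.var .i) (.var .j) (.var .N))
  (.seq (.store .X (.var .N) (.lit 0) (.get .X (.var .i) (.lit 0)))
  (.seq (.store .X (.var .i) (.lit 0) (.var .N))
  (.assign .e (.var .N))))))

/-- The new entry is linked directly behind the identity. Therefore the head of the list of level
`i` remains in row `i + 1`, and no list has to be traversed. -/
theorem Tab.insert (h : Tab A els s) {i : Fin n} {g : Perm (Fin n)}
    (hg : g ∈ Subgroup.closure A) (hfix : ∀ k < i, g k = k)
    (hnew : s.arr .I (i + 1) (g i + 1) = 0)
    (hN : s'.var .N = els.length + 1)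
    (hE : Rep (s'.arr .E (els.length + 1)) g⁻¹)
    (hE' : ∀ r, r ≠ els.length + 1 → s'.arr .E r = s.arr .E r)
    (hI : ∀ r k, s'.arr .I r k = if r = i + 1 ∧ k = g i + 1 then els.length + 1 else s.arr .I r k)
    (hX : ∀ r, s'.arr .X r 0 = if r = i + 1 then els.length + 1 else
      if r = els.length + 1 then s.arr .X (i + 1) 0 else s.arr .X r 0) :
    Tab A (els ++ [(i, g⁻¹)]) s' := by
  have hnew' : ∀ p ∈ els, p.1 = i → p.2 (g i) ≠ i := by
    intro p hp h1 h2
    obtain ⟨e, he⟩ := List.mem_iff_getElem?.1 hp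
    have := (h.idx i (g i) e).2 ⟨p, he, h1, h2⟩
    omega
  have hget : ∀ e p, (els ++ [(i, g⁻¹)])[e]? = some p ↔
      els[e]? = some p ∨ e = els.length ∧ p = (i, g⁻¹) := by
    intro e p
    rcases lt_trichotomy e els.length with h | h | h
    · rw [List.getElem?_append_left h]
      exact ⟨Or.inl, fun h' => h'.elim id fun h' => by omega⟩
    · subst h
      simp [eq_comm]
    · rw [List.getElem?_eq_none (by simp; omega), List.getElem?_eq_none (by omega)]
      simp
      omega
  have hlt : ∀ e p, els[e]? = some p → e < els.length := by
    intro e p h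
    exact (List.getElem?_eq_some_iff.1 h).1
  have hle := h.entries.le_length
  refine ⟨h.entries.insert hg hfix hnew', by simp [hN], ?_, ?_, ?_⟩
  · intro e p hp
    rcases (hget e p).1 hp with h1 | ⟨rfl, rfl⟩
    · have := hlt e p h1
      rw [hE' _ (by omega)]
      exact h.rep e p h1
    · exact hE
  · intro k j e
    simp only [hI, hget]
    by_cases hk : k = i ∧ j = g i
    · obtain ⟨rfl, rfl⟩ := hk
      simp only [and_self, if_true]
      constructor
      · intro h1
        exact ⟨_, Or.inr ⟨by omega, rfl⟩, rfl, by simp⟩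
      · rintro ⟨p, h1 | ⟨h1, -⟩, h2, h3⟩
        · exact absurd h3 (hnew' p (List.mem_of_getElem? h1) h2)
        · omega
    · rw [if_neg, h.idx]
      · constructor
        · rintro ⟨p, h1, h2⟩
          exact ⟨p, Or.inl h1, h2⟩
        · rintro ⟨p, h1 | ⟨h1, rfl⟩, h2, h3⟩
          · exact ⟨p, h1, h2, h3⟩
          · refine absurd ⟨h2.symm, ?_⟩ hk
            exact (Perm.inv_eq_iff_eq.1 (h3.trans h2.symm))
      · rintro ⟨h1, h2⟩
        exact hk ⟨Fin.ext (by omega), Fin.ext (by omega)⟩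
  · intro k
    obtain ⟨l, h1, h2, h3⟩ := h.chain k
    have hl : ∀ e ∈ l, e < els.length := by
      intro e he
      obtain ⟨p, hp, -⟩ := (h3 e).1 (by simp [he])
      exact hlt e p hp
    -- The only old pointer that changes belongs to the identity of level `i`, which is in the tail
    -- of no list.
    have hfar : ∀ e ∈ l, e ≠ (i : ℕ) := by
      rintro e he rfl
      by_cases hk : k = i
      · subst hk
        simp at h2
        exact h2.1 he
      · obtain ⟨p, hp, hp'⟩ := (h3 i).1 (by simp [he])
        rw [h.entries.init i] at hp
        cases hp
        exact hk hp'.symm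
    have hc : ∀ v, Chain (s.arr .X) v l → Chain (s'.arr .X) v l := by
      intro v hv
      refine hv.congr fun e he => ?_
      have := hl e he
      have := hfar e he
      rw [hX, if_neg (by omega), if_neg (by omega)]
    by_cases hk : k = i
    · subst hk
      refine ⟨els.length :: l, ⟨by simp [hX], ?_⟩, ?_, ?_⟩
      · rw [hX, if_neg (by omega), if_pos rfl]
        exact hc _ h1
      · simp only [List.nodup_cons, List.mem_cons, not_or] at h2 ⊢
        refine ⟨⟨by omega, h2.1⟩, fun h4 => ?_, h2.2⟩
        have := hl _ h4
        omega
      · intro e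
        simp only [hget]
        constructor
        · intro h4
          by_cases h5 : e = els.length
          · exact ⟨_, Or.inr ⟨h5, rfl⟩, rfl⟩
          · obtain ⟨p, hp, hp'⟩ := (h3 e).1 (by simp at h4 ⊢; tauto)
            exact ⟨p, Or.inl hp, hp'⟩
        · rintro ⟨p, h4 | ⟨rfl, -⟩, h5⟩
          · have := (h3 e).2 ⟨p, h4, h5⟩
            simp at this ⊢
            tauto
          · simp
    · have hki : (k : ℕ) ≠ i := fun h => hk (Fin.ext h)
      refine ⟨l, ?_, h2, ?_⟩
      · rw [hX, if_neg (by omega), if_neg (by omega)]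
        exact hc _ h1
      · intro e
        rw [h3]
        simp only [hget]
        constructor
        · rintro ⟨p, hp, hp'⟩
          exact ⟨p, Or.inl hp, hp'⟩
        · rintro ⟨p, hp | ⟨-, rfl⟩, hp'⟩
          · exact ⟨p, hp, hp'⟩
          · exact absurd hp'.symm hk

theorem insertCmd_spec (h : Tab A els s) {i : Fin n} {g : Perm (Fin n)}
    (hg : g ∈ Subgroup.closure A) (hfix : ∀ k < i, g k = k) (hG : Rep (s.arr .G 0) g)
    (hi : s.var .i = i + 1) (hj : s.var .j = g i + 1)
    (hnew : s.arr .I (i + 1) (g i + 1) = 0) :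
    Does n insertCmd s (50 * (n + 1) + 100) (fun s' => Tab A (els ++ [(i, g⁻¹)]) s' ∧
      s'.var .e = els.length + 1) := by
  have hN := h.count
  have hlen := h.entries.length_lt
  have hi' := fin_succ_le i
  refine Does.assign_seq (by simp [Expr.Ok, Expr.eval, hN, hlen]) (by simp only [Expr.cost]; omega)
    -- Storing `k` in column `g k` inverts the permutation.
    (Does.bind (Does.fillRow (R := els.length + 1) (σ := g) (τ := 1) hlen ?_)
      (by simp only [Expr.cost]; omega) ?_)
  · intro s' h1 h2 h3 k hk h4
    simp [Expr.Ok, Expr.eval, h1, h2, hN, hG k, hk]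
  · rintro s1 ⟨hE, hE'⟩ F1
    have fv := F1.var
    have fa := F1.arr
    refine Does.store_seq (by simp [Expr.Ok]) (by simp [Expr.Ok]) (by simp [Expr.Ok])
      ?_ ?_ (by simp only [Expr.cost]; omega) ?_
    · simp [Expr.eval, fv .i (by decide), hi, hi']
    · simp [Expr.eval, fv .j (by decide), hj]
    refine Does.store_seq (by simp [Expr.Ok]) (by simp [Expr.Ok]) ?_ ?_ ?_
      (by simp only [Expr.cost]; omega) ?_
    · simp [Expr.Ok, Expr.eval, fv .i (by decide), hi, hi']
    · simp [Expr.eval, fv .N (by decide), hN, hlen]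
    · simp [Expr.eval]
    refine Does.store_seq (by simp [Expr.Ok]) (by simp [Expr.Ok]) (by simp [Expr.Ok])
      ?_ ?_ (by simp only [Expr.cost]; omega) ?_
    · simp [Expr.eval, fv .i (by decide), hi, hi']
    · simp [Expr.eval]
    refine (Does.assign (by simp [Expr.Ok]) ⟨?_, ?_⟩).weaken (by simp only [Expr.cost]; omega)
    · refine h.insert hg hfix hnew ?_ ?_ ?_ ?_ ?_
      · simp [fv .N (by decide), hN, Expr.eval]
      · simpa using hE
      · intro r hr
        simpa using hE' r hr
      · intro r k
        simp [Expr.eval, fv .N (by decide), fv .i (by decide), fv .j (by decide), hN, hi, hj,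
          Store.setArr_arr, fa .I (by decide)]
      · intro r
        simp [Expr.eval, fv .N (by decide), fv .i (by decide), fv .j (by decide), hN, hi, hj,
          Store.setArr_arr, fa .X (by decide)]
    · simp [Expr.eval, fv .N (by decide), hN]

end RAM

/-! ### Sifting and closing the table under products -/

namespace RAM

set_option linter.constructorNameAsVariable false

open Equiv PermTable

variable {n : ℕ} {A : Set (Perm (Fin n))} {els els' : List (Fin n × Perm (Fin n))} {s s' : Store}

/-- Sifting on one level: the permutation in `G` is multiplied by a table entry, so that it fixes
the point of this level. If there is no such entry yet, it is inserted. -/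
def siftLevel : Cmd :=
  .seq (.assign .j (.get .G (.lit 0) (.var .i)))
  (.seq (.assign .e (.get .I (.var .i) (.var .j)))
  (.seq (.ifLt (.lit 0) (.var .e) .skip insertCmd)
  (forLoop .k (.lit 1)
    (.store .G (.lit 0) (.var .k) (.get .E (.var .e) (.get .G (.lit 0) (.var .k)))))))

/-- Both branches leave in `e` the number of an entry that maps `g i` to `i`: the one found in the
index, or the freshly inserted `g⁻¹`. The multiplication that follows need not distinguish them. -/
theorem siftLevel_spec (h : Tab A els s) {i : Fin n} {g : Perm (Fin n)}
    (hg : g ∈ Subgroup.closure A) (hfix : ∀ k < i, g k = k) (hG : Rep (s.arr .G 0) g)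
    (hi : s.var .i = i + 1) :
    Does n siftLevel s (100 * (n + 1) + 200) (fun s' => ∃ els' V, els <+: els' ∧ Tab A els' s' ∧
      (i, V) ∈ els' ∧ V (g i) = i ∧ Rep (s'.arr .G 0) (V * g)) := by
  have hi' := fin_succ_le i
  have hGi := hG i
  refine Does.assign_seq (by simp [Expr.Ok, Expr.eval, hi]) (by simp only [Expr.cost]; omega) ?_
  refine Does.assign_seq (by simp [Expr.Ok, Expr.eval, hi, hi', hGi])
    (by simp only [Expr.cost]; omega) ?_
  simp only [Expr.eval, Store.set_var, Store.set_arr, hi, hGi, if_true, reduceCtorEq, if_false]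
  set s1 := (s.set .j (g i + 1)).set .e (s.arr .I (i + 1) (g i + 1)) with hs1
  have h1 : Tab A els s1 := h.congr (by simp [hs1]) rfl rfl rfl
  refine Does.bind (Does.ifLt (T := 50 * (n + 1) + 100) (Q := fun s2 => ∃ els' V e, els <+: els' ∧
    Tab A els' s2 ∧ els'[e]? = some (i, V) ∧ V (g i) = i ∧ s2.var .e = e + 1)
    (by simp [Expr.Ok]) (by simp [Expr.Ok]) ?_ ?_) (by simp only [Expr.cost]; omega) ?_
  · intro h2
    simp only [Expr.eval, hs1, Store.set_var, if_true] at h2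
    obtain ⟨e, he⟩ := Nat.exists_eq_succ_of_ne_zero h2.ne'
    obtain ⟨p, hp, hp1, hp2⟩ := (h.idx i (g i) e).1 he
    exact (Does.skip ⟨els, p.2, e, List.prefix_rfl, h1, by rw [hp, ← hp1], hp2,
      by simp [hs1, he]⟩).weaken (by omega)
  · intro h2
    simp only [Expr.eval, hs1, Store.set_var, if_true] at h2
    refine (insertCmd_spec h1 hg hfix (by simpa [hs1] using hG) (by simp [hs1, hi])
      (by simp [hs1]) (by simp [hs1]; omega)).mono le_rfl ?_
    rintro s2 ⟨h3, h4⟩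
    exact ⟨_, g⁻¹, els.length, List.prefix_append _ _, h3, by simp, by simp, h4⟩
  · rintro s2 ⟨els', V, e, hpre, h3, he, hV, hse⟩ F
    have he' := (List.getElem?_eq_some_iff.1 he).1
    have hlen := h3.entries.length_lt
    have hE := h3.rep e _ he
    have hG2 : s2.arr .G = s.arr .G := F.arr .G (by decide)
    refine ((Does.fillRow (R := 0) (σ := 1) (τ := V * g) (by omega) ?_).frame).mono
      (by simp only [Expr.cost]; omega) ?_
    · intro s' h1 h2 h3 k hk h4
      simp at h4
      simp [Expr.Ok, Expr.eval, h1, hse, hk, h4, hG2, hG k, h2, hE (g k)]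
      omega
    · rintro s3 ⟨⟨h4, -⟩, F'⟩
      exact ⟨els', V, hpre, h3.congr (F'.var _ (by decide)) (F'.arr _ (by decide))
        (F'.arr _ (by decide)) (F'.arr _ (by decide)), List.mem_of_getElem? he, hV, by simpa using h4⟩

/-- Sifting the permutation in `G` through the table. -/
def sift : Cmd := forLoop .i (.lit 1) siftLevel

/-- The invariant records the product of the entries used so far; applied after `g`, it fixes all
points treated. After the last level this product is `g⁻¹`. Insertions on the way do no harm, since
`Desc` grows with the table. -/
theorem sift_spec (h : Tab A els s) {g : Perm (Fin n)} (hg : g ∈ Subgroup.closure A)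
    (hG : Rep (s.arr .G 0) g) :
    Does n sift s (400 * (n + 1) ^ 2) (fun s' => ∃ els', els <+: els' ∧ Tab A els' s' ∧
      g⁻¹ ∈ Desc (level els') 0 n) := by
  refine (Does.forLoop (T := 100 * (n + 1) + 200) (lo := 1) (fun j s' => ∃ els' h, els <+: els' ∧
    Tab A els' s' ∧ h ∈ Desc (level els') 0 (j - 1) ∧ h ∈ Subgroup.closure A ∧
    (∀ k : Fin n, (k : ℕ) + 1 < j → (h * g) k = k) ∧ Rep (s'.arr .G 0) (h * g))
    (by decide) (by simp [Expr.Ok]) rfl (by omega) ?_ ?_).mono ?_ ?_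
  · exact ⟨els, 1, List.prefix_rfl, h.congr (by simp) rfl rfl rfl, rfl, one_mem _,
      by intro k hk; omega, by simpa using hG⟩
  · rintro j s1 hj hj' hi ⟨els', f, hpre, h1, hf, hfA, hfix, hG1⟩
    obtain ⟨i, rfl⟩ : ∃ i : Fin n, j = i + 1 := ⟨⟨j - 1, by omega⟩, by simp; omega⟩
    refine (siftLevel_spec h1 (mul_mem hfA hg) (fun k hk => hfix k (by omega)) hG1 hi).mono
      le_rfl ?_
    rintro s2 ⟨els'', V, hpre', h2, hV, hVi, hG2⟩
    refine ⟨els'', V * f, hpre.trans hpre', h2.congr (by simp) rfl rfl rfl, ?_, ?_, ?_, ?_⟩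
    · exact Desc.mul_left (Desc.mono (level_mono hpre') hf) ⟨_, hV, by simp, rfl⟩
    · exact mul_mem (h2.entries.mem _ hV) hfA
    · intro k hk
      rw [mul_assoc, Perm.mul_apply]
      by_cases e : k = i
      · rw [e, hVi]
      · have e' : (k : ℕ) ≠ i := fun h => e (Fin.ext h)
        rw [hfix k (by omega)]
        exact h2.entries.fix _ hV k (by simp only []; omega)
    · simpa [mul_assoc] using hG2
  · simp only [Expr.cost]
    have h1 : 1 * 1 ≤ (n + 1) * (n + 1) := Nat.mul_le_mul (by omega) (by omega)
    nlinarith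
  · rintro s' ⟨els', f, hpre, h1, hf, -, hfix, -⟩
    have e : f * g = 1 := by
      ext k
      rw [hfix k (by omega)]; rfl
    exact ⟨els', hpre, h1, by rwa [inv_eq_of_mul_eq_one_left e]⟩

/-- Sifting the inverse of the product of two table entries. -/
def siftProduct (x y : Var) : Cmd :=
  .seq (forLoop .k (.lit 1)
    (.store .G (.lit 0) (.get .E (.var y) (.get .E (.var x) (.var .k))) (.var .k))) sift

/-- Sifting factors the inverse of its argument, so the inverse of the product is loaded. -/
theorem siftProduct_spec (h : Tab A els s) {x y : Var} (hx : x ≠ .k) (hy : y ≠ .k) {e f : ℕ}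
    {p q : Fin n × Perm (Fin n)} (he : els[e]? = some p) (hf : els[f]? = some q)
    (hxe : s.var x = e + 1) (hyf : s.var y = f + 1) :
    Does n (siftProduct x y) s (500 * (n + 1) ^ 2) (fun s' => ∃ els', els <+: els' ∧
      Tab A els' s' ∧ q.2 * p.2 ∈ Desc (level els') 0 n) := by
  have he' := (List.getElem?_eq_some_iff.1 he).1
  have hf' := (List.getElem?_eq_some_iff.1 hf).1
  have hlen := h.entries.length_lt
  have hE := h.rep _ _ he
  have hF := h.rep _ _ hf
  have h1 : 1 * (n + 1) ≤ (n + 1) ^ 2 := by rw [pow_two]; exact Nat.mul_le_mul_right _ (by omega)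
  refine Does.bind (Does.fillRow (R := 0) (σ := q.2 * p.2) (τ := 1) (by omega) ?_)
    (by simp only [Expr.cost]; omega) ?_
  · intro s' h1 h2 h3 k hk h4
    simp [Expr.Ok, Expr.eval, h1, h2, hx, hy, hxe, hyf, hk, hE k, hF (p.2 k)]
    omega
  · rintro s1 ⟨h2, -⟩ F
    refine (sift_spec (h.congr (F.var _ (by simp [forLoop, Cmd.vars]))
      (F.arr _ (by simp [forLoop, Cmd.arrs])) (F.arr _ (by simp [forLoop, Cmd.arrs]))
      (F.arr _ (by simp [forLoop, Cmd.arrs]))) (g := (q.2 * p.2)⁻¹) ?_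
      (by simpa using h2)).mono (by simp only [Expr.cost]; omega) ?_
    · exact inv_mem (mul_mem (h.entries.mem _ (List.mem_of_getElem? hf))
        (h.entries.mem _ (List.mem_of_getElem? he)))
    · simp

/-- Sifting the products of entry `a` and the entries up to `a`. -/
def siftRow : Cmd :=
  .whileLt (.var .b) (.add (.var .a) (.lit 1))
    (.seq (siftProduct .a .b) (.seq (siftProduct .b .a) (.assign .b (.add (.var .b) (.lit 1)))))

/-- Sifting all products of two table entries. -/
def siftAll : Cmd :=
  .seq (.assign .a (.lit 1)) (.whileLt (.var .a) (.add (.var .N) (.lit 1))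
    (.seq (.assign .b (.lit 1)) (.seq siftRow (.assign .a (.add (.var .a) (.lit 1))))))

/-- The products of two entries that are sifted before entry `a` is combined with entry `b`. -/
def Sifted (els : List (Fin n × Perm (Fin n))) (a b : ℕ) : Prop :=
  ∀ e f p q, els[e]? = some p → els[f]? = some q →
    (e + 1 < a ∧ f + 1 < a ∨ e + 1 = a ∧ f + 1 < b ∨ f + 1 = a ∧ e + 1 < b) →
    q.2 * p.2 ∈ Desc (level els) 0 n

/-- The table grows while it is being worked through. The bounds on `a` and `b` ensure that only
pairs of old entries are concerned, and their factorizations persist. -/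
theorem Sifted.mono {a b : ℕ} (h : Sifted els a b) (hpre : els <+: els') (ha : a ≤ els.length + 1)
    (hb : b ≤ a + 1) (hb' : a ≤ els.length ∨ b ≤ 1) : Sifted els' a b := by
  intro e f p q hp hq hef
  have key : ∀ e p, els'[e]? = some p → e < els.length → els[e]? = some p := by
    intro e p hp he
    obtain ⟨t, rfl⟩ := hpre
    rw [← hp, List.getElem?_append_left he]
  exact Desc.mono (level_mono hpre) (h e f p q (key e p hp (by omega)) (key f q hq (by omega)) hef)

/-- Combining `a` with all `b ≤ a` in both orders treats each pair when its later member is reached.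
Entries inserted meanwhile have larger numbers and wait for their own turn. -/
theorem siftRow_spec (h : Tab A els s) {a : ℕ} (ha : s.var .a = a) (ha1 : 1 ≤ a)
    (hale : a ≤ els.length) (hb : s.var .b = 1) (hs : Sifted els a 1) :
    Does n siftRow s (1100 * (n + 1) ^ 4) (fun s' => ∃ els', els <+: els' ∧ Tab A els' s' ∧
      s'.var .a = a ∧ Sifted els' (a + 1) 1) := by
  have hn1 : 1 ≤ (n + 1) ^ 2 := Nat.one_le_pow _ _ (by omega)
  have hlen := h.entries.length_lt
  refine (Does.whileLt (T := 1050 * (n + 1) ^ 2) (fun s' => ∃ els', els <+: els' ∧ Tab A els' s' ∧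
    s'.var .a = a ∧ 1 ≤ s'.var .b ∧ s'.var .b ≤ a + 1 ∧ Sifted els' a (s'.var .b))
    (fun s' => a + 1 - s'.var .b) ?_ ?_ ?_).mono ?_ ?_
  · rintro s' ⟨els', hpre, h1, h2, h3, h4, h5⟩
    simp [Expr.Ok, Expr.eval, h2]
    omega
  · rintro s1 ⟨els1, hpre, h1, h2, h3, h4, h5⟩ hlt
    simp only [Expr.eval, h2] at hlt
    have hle := hpre.length_le
    obtain ⟨e, rfl⟩ : ∃ e, a = e + 1 := ⟨a - 1, by omega⟩
    obtain ⟨f, hf⟩ : ∃ f, s1.var .b = f + 1 := ⟨s1.var .b - 1, by omega⟩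
    obtain ⟨p, hp⟩ : ∃ p, els1[e]? = some p := ⟨_, List.getElem?_eq_getElem (by omega)⟩
    obtain ⟨q, hq⟩ : ∃ q, els1[f]? = some q := ⟨_, List.getElem?_eq_getElem (by omega)⟩
    have hkeep : ∀ {els'' : List (Fin n × Perm (Fin n))} {e : ℕ} {p}, els1 <+: els'' →
        els1[e]? = some p → els''[e]? = some p := by
      rintro els'' e p ⟨t, rfl⟩ he
      rw [List.getElem?_append_left (List.getElem?_eq_some_iff.1 he).1, he]
    refine Does.bind (siftProduct_spec h1 (by simp) (by simp) hp hq h2 hf) (by omega) ?_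
    rintro s2 ⟨els2, hpre2, hT2, hD2⟩ F2
    have b2 := (F2.var .b (by decide)).trans hf
    have a2 := (F2.var .a (by decide)).trans h2
    refine Does.bind (siftProduct_spec hT2 (by simp) (by simp) (hkeep hpre2 hq) (hkeep hpre2 hp)
      b2 a2) (by omega) ?_
    rintro s3 ⟨els3, hpre3, hT3, hD3⟩ F3
    have b3 := (F3.var .b (by decide)).trans b2
    have a3 := (F3.var .a (by decide)).trans a2
    have hpre13 := hpre2.trans hpre3
    refine (Does.assign ?_ ⟨⟨els3, hpre.trans hpre13, hT3.congr (by simp) rfl rfl rfl, by simp [a3],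
      by simp [Expr.eval], by simp [Expr.eval]; omega, ?_⟩, ?_⟩).weaken
      (by simp only [Expr.cost]; omega)
    · simp [Expr.Ok, Expr.eval, b3]
      omega
    · have h6 := h5.mono hpre13 (by omega) (by omega) (Or.inl (by omega))
      simp only [Expr.eval, Store.set_var, if_true, b3]
      rw [hf] at h6
      have hp3 := hkeep hpre13 hp
      have hq3 := hkeep hpre13 hq
      intro e' f' p' q' hp' hq' hc
      by_cases hc' : e' + 1 < e + 1 ∧ f' + 1 < e + 1 ∨ e' + 1 = e + 1 ∧ f' + 1 < f + 1 ∨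
          f' + 1 = e + 1 ∧ e' + 1 < f + 1
      · exact h6 e' f' p' q' hp' hq' hc'
      · have hc2 : e' = e ∧ f' = f ∨ e' = f ∧ f' = e := by omega
        rcases hc2 with ⟨rfl, rfl⟩ | ⟨rfl, rfl⟩
        · rw [hp3] at hp'
          rw [hq3] at hq'
          cases hp'
          cases hq'
          exact Desc.mono (level_mono hpre3) hD2
        · rw [hq3] at hp'
          rw [hp3] at hq'
          cases hp'
          cases hq'
          exact hD3
    · simp [Expr.eval, b3, hf]
      omega
  · exact ⟨els, List.prefix_rfl, h, ha, by omega, by omega, hb ▸ hs⟩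
  · have h1 : a + 1 - s.var .b + 1 ≤ (n + 1) ^ 2 := by omega
    have h2 : 1050 * (n + 1) ^ 2 + (Expr.var .b).cost + ((Expr.var .a).add (Expr.lit 1)).cost + 2 ≤
        1100 * (n + 1) ^ 2 := by simp only [Expr.cost]; omega
    calc _ ≤ (n + 1) ^ 2 * (1100 * (n + 1) ^ 2) := Nat.mul_le_mul h1 h2
      _ = _ := by ring
  · rintro s' ⟨⟨els', hpre, h1, h2, h3, h4, h5⟩, hlt⟩
    simp only [Expr.eval, h2] at hlt
    refine ⟨els', hpre, h1, h2, fun e f p q hp hq hef => h5 e f p q hp hq ?_⟩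
    omega

theorem siftAll_spec (h : Tab A els s) :
    Does n siftAll s (1200 * (n + 1) ^ 6) (fun s' => ∃ els', els <+: els' ∧ Tab A els' s' ∧
      ∀ p ∈ els', ∀ q ∈ els', q.2 * p.2 ∈ Desc (level els') 0 n) := by
  have hn1 : 1 ≤ (n + 1) ^ 2 := Nat.one_le_pow _ _ (by omega)
  have hn4 : 1 ≤ (n + 1) ^ 4 := Nat.one_le_pow _ _ (by omega)
  have hn6 : 1 ≤ (n + 1) ^ 6 := Nat.one_le_pow _ _ (by omega)
  refine Does.assign_seq (by simp [Expr.Ok]) (by simp only [Expr.cost]; omega) ?_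
  refine (Does.whileLt (T := 1120 * (n + 1) ^ 4) (fun s' => ∃ els', els <+: els' ∧ Tab A els' s' ∧
    1 ≤ s'.var .a ∧ s'.var .a ≤ els'.length + 1 ∧ Sifted els' (s'.var .a) 1)
    -- The loop bound `N` moves, but it never exceeds `n ^ 2`, so this measure proves termination.
    (fun s' => n ^ 2 + 1 - s'.var .a) ?_ ?_ ?_).mono ?_ ?_
  · rintro s' ⟨els', hpre, h1, h2, h3, h4⟩
    have := h1.entries.length_lt
    simpa [Expr.Ok, Expr.eval, h1.count] using this
  · rintro s1 ⟨els1, hpre, h1, h2, h3, h4⟩ hlt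
    have hlen := h1.entries.length_lt
    have hlen' := h1.entries.length_le
    simp only [Expr.eval, h1.count] at hlt
    refine Does.assign_seq (by simp [Expr.Ok]) (by simp only [Expr.cost]; omega) ?_
    refine Does.bind (siftRow_spec (s := s1.set .b 1) (a := s1.var .a)
      (h1.congr (by simp) rfl rfl rfl) (by simp) (by simpa using h2)
      (by omega) (by simp) (by simpa using h4)) (by simp only [Expr.cost]; omega) ?_
    rintro s2 ⟨els2, hpre2, hT2, ha2, hS2⟩ F2
    have hle := hpre2.length_le
    refine (Does.assign ?_ ⟨⟨els2, hpre.trans hpre2, hT2.congr (by simp) rfl rfl rfl,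
      by simp [Expr.eval], by simp [Expr.eval, ha2]; omega, by simpa [Expr.eval, ha2] using hS2⟩,
      ?_⟩).weaken (by simp only [Expr.cost]; omega)
    · simp [Expr.Ok, Expr.eval, ha2]
      omega
    · simp [Expr.eval, ha2]
      omega
  · refine ⟨els, List.prefix_rfl, h.congr (by simp) rfl rfl rfl, by simp [Expr.eval],
      by simp [Expr.eval], ?_⟩
    intro e f p q hp hq hef
    simp [Expr.eval] at hef
  · have h1 : n ^ 2 + 1 - (s.set .a ((Expr.lit 1).eval n s)).var .a + 1 ≤ (n + 1) ^ 2 := by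
      have e : (n + 1) ^ 2 = n ^ 2 + 2 * n + 1 := by ring
      simp [Expr.eval]
      omega
    have h2 : 1120 * (n + 1) ^ 4 + (Expr.var .a).cost + ((Expr.var .N).add (Expr.lit 1)).cost + 2 ≤
        1150 * (n + 1) ^ 4 := by simp only [Expr.cost]; omega
    have h3 := Nat.mul_le_mul h1 h2
    have e : (n + 1) ^ 2 * (1150 * (n + 1) ^ 4) = 1150 * (n + 1) ^ 6 := by ring
    rw [e] at h3
    refine h3.trans ?_
    simp only [Expr.cost]
    omega
  · rintro s' ⟨⟨els', hpre, h1, h2, h3, h4⟩, hlt⟩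
    simp only [Expr.eval, h1.count] at hlt
    refine ⟨els', hpre, h1, fun p hp q hq => ?_⟩
    obtain ⟨e, he⟩ := List.mem_iff_getElem?.1 hp
    obtain ⟨f, hf⟩ := List.mem_iff_getElem?.1 hq
    have := (List.getElem?_eq_some_iff.1 he).1
    have := (List.getElem?_eq_some_iff.1 hf).1
    exact h4 e f p q he hf (by omega)

/-! ### Reading the input -/

/-- Reading a permutation into `G`; its first word is in `x` already. -/
def readPerm : Cmd :=
  .seq (.store .G (.lit 0) (.lit 1) (.var .x))
    (forLoop .k (.lit 2) (.ifRead .x (.store .G (.lit 0) (.var .k) (.var .x)) .skip))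

theorem permWords_drop (g : Perm (Fin n)) (k : Fin n) :
    (permWords g).drop k = ((g k : ℕ) + 1) :: (permWords g).drop (k + 1) := by
  have h : (k : ℕ) < (permWords g).length := by simp [permWords]
  rw [List.drop_eq_getElem_cons h]
  simp [permWords]

theorem readPerm_spec {g : Perm (Fin n)} {v : ℕ} {ws rest : List ℕ} (hw : permWords g = v :: ws)
    (hx : s.var .x = v) (hinp : s.inp = ws ++ rest) :
    Does n readPerm s (50 * (n + 1)) (fun s' => Rep (s'.arr .G 0) g ∧ s'.inp = rest) := by
  have hl : n = ws.length + 1 := by simpa [permWords] using congrArg List.length hw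
  have hw0 := permWords_drop g ⟨0, by omega⟩
  simp only [List.drop_zero, zero_add, hw, List.drop_one, List.tail_cons, List.cons.injEq,
    and_true] at hw0
  refine Does.store_seq (by simp [Expr.Ok]) (by simp [Expr.Ok]) (by simp [Expr.Ok])
    (by simp [Expr.eval]) (by simp only [Expr.eval]; omega) (by simp only [Expr.cost]; omega) ?_
  refine (Does.forLoop (T := 15) (lo := 2) (fun j s' => s'.inp = (permWords g).drop (j - 1) ++ rest ∧
    ∀ k : Fin n, (k : ℕ) + 1 < j → s'.arr .G 0 (k + 1) = g k + 1)
    (by decide) (by simp [Expr.Ok]) rfl (by omega) ?_ ?_).mono (by simp only [Expr.cost]; omega) ?_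
  · refine ⟨by simp [hw, hinp], fun k hk => ?_⟩
    have hk0 : k = ⟨0, by omega⟩ := Fin.ext (by simp only []; omega)
    rw [hk0]
    simp [Store.setArr_arr, Expr.eval, hx, hw0]
  · rintro j s1 hj hj' hk ⟨h1, h2⟩
    obtain ⟨i, rfl⟩ : ∃ i : Fin n, j = i + 1 := ⟨⟨j - 1, by omega⟩, by simp; omega⟩
    rw [Nat.add_sub_cancel, permWords_drop] at h1
    have h3 := fin_succ_le (g i)
    refine (Does.ifRead_some h1 h3 (Does.store (by simp [Expr.Ok]) (by simp [Expr.Ok])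
      (by simp [Expr.Ok]) (by simp [Expr.eval]) ?_ ⟨by simp, ?_⟩)).weaken (by simp [Expr.cost])
    · simp [Expr.eval, hk]
    · intro k hk'
      simp only [Store.set_arr, Store.setArr_arr, Expr.eval, Store.set_var]
      by_cases e : k = i
      · subst e
        simp [hk]
      · have e' : (k : ℕ) ≠ i := fun h => e (Fin.ext h)
        simp only [reduceCtorEq, if_false, hk, true_and, add_left_inj, e']
        exact h2 k (by omega)
  · rintro s' ⟨h1, h2⟩
    refine ⟨fun k => h2 k (by omega), ?_⟩
    rw [h1, List.drop_eq_nil_of_le (by simp [permWords])]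
    rfl

/-- Reading and sifting the permutations of the input; the first word is in `x` already. -/
def readAll : Cmd :=
  .seq (.assign .go (.lit 1)) (.whileLt (.lit 0) (.var .go)
    (.seq readPerm (.seq sift (.ifRead .x .skip (.assign .go (.lit 0))))))

theorem readAll_spec (hn : 0 < n) {As : List (Perm (Fin n))}
    (hA : ∀ g ∈ As, g ∈ Subgroup.closure A) (h : Tab A els s) {v : ℕ}
    (hx : s.var .x = v) (hinp : v :: s.inp = As.flatMap permWords) :
    Does n readAll s (600 * (As.flatMap permWords).length * (n + 1) ^ 2 + 600 * (n + 1) ^ 2)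
      (fun s' => ∃ els', els <+: els' ∧ Tab A els' s' ∧
        ∀ g ∈ As, g⁻¹ ∈ Desc (level els') 0 n) := by
  have hn1 : 1 * (n + 1) ≤ (n + 1) ^ 2 := by rw [pow_two]; exact Nat.mul_le_mul_right _ (by omega)
  refine Does.assign_seq (by simp [Expr.Ok]) (by simp only [Expr.cost]; omega) ?_
  refine (Does.whileLt (T := 500 * (n + 1) ^ 2) (fun s' => ∃ els' l l', els <+: els' ∧ Tab A els' s' ∧
    As = l ++ l' ∧ (∀ g ∈ l, g⁻¹ ∈ Desc (level els') 0 n) ∧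
    (s'.var .go = 1 ∧ s'.var .x :: s'.inp = l'.flatMap permWords ∨ s'.var .go = 0 ∧ l' = []))
    -- The summand `go` makes the last round count even for `n = 1`, when it consumes no further
    -- word.
    (fun s' => s'.inp.length + s'.var .go) ?_ ?_ ?_).mono ?_ ?_
  · rintro s' -
    simp [Expr.Ok]
  · rintro s1 ⟨els1, l, l', hpre, h1, h2, h3, h4⟩ hlt
    simp only [Expr.eval] at hlt
    obtain ⟨hgo, hin⟩ : s1.var .go = 1 ∧ s1.var .x :: s1.inp = l'.flatMap permWords := by
      rcases h4 with h4 | h4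
      · exact h4
      · omega
    obtain ⟨g, l'', rfl⟩ : ∃ g l'', l' = g :: l'' := by
      cases l' with
      | nil => simp at hin
      | cons g l'' => exact ⟨g, l'', rfl⟩
    obtain ⟨v, ws, hw⟩ : ∃ v ws, permWords g = v :: ws := by
      refine List.exists_cons_of_length_pos ?_
      simpa [permWords] using hn
    rw [List.flatMap_cons, hw, List.cons_append, List.cons.injEq] at hin
    have hgA : g ∈ Subgroup.closure A := hA g (by simp [h2])
    refine Does.bind (readPerm_spec hw hin.1 hin.2) (by omega) ?_
    rintro s2 ⟨hG, hinp2⟩ F2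
    have h1' := h1.congr (F2.var _ (by decide)) (F2.arr _ (by decide)) (F2.arr _ (by decide))
      (F2.arr _ (by decide))
    refine Does.bind (sift_spec h1' hgA hG) (by omega) ?_
    rintro s3 ⟨els3, hpre3, h5, h6⟩ F3
    have hinp3 := (F3.inp (by decide)).trans hinp2
    have hgo3 := (F3.var .go (by decide)).trans ((F2.var .go (by decide)).trans hgo)
    have hdone : ∀ f ∈ l ++ [g], f⁻¹ ∈ Desc (level els3) 0 n := by
      intro f hf
      rw [List.mem_append, List.mem_singleton] at hf
      rcases hf with hf | rfl
      · exact Desc.mono (level_mono hpre3) (h3 f hf)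
      · exact h6
    have hlen1 : s1.inp.length = ws.length + s3.inp.length := by rw [hin.2, hinp3]; simp
    cases l'' with
    | nil =>
      refine (Does.ifRead_none (by simpa using hinp3) (Does.assign (by simp [Expr.Ok])
        ⟨⟨els3, l ++ [g], [], hpre.trans hpre3, h5.congr (by simp) rfl rfl rfl, by simp [h2], hdone,
          Or.inr ⟨by simp [Expr.eval], rfl⟩⟩, ?_⟩)).weaken (by simp only [Expr.cost]; omega)
      simp [Expr.eval]
      omega
    | cons g' l'' =>
      obtain ⟨v', ws', hw'⟩ : ∃ v ws, permWords g' = v :: ws := by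
        refine List.exists_cons_of_length_pos ?_
        simpa [permWords] using hn
      have hv' : v' ≤ (n + 1) ^ 2 := by
        have : v' ∈ permWords g' := by rw [hw']; simp
        simp only [permWords, List.mem_ofFn] at this
        obtain ⟨k, rfl⟩ := this
        exact fin_succ_le _
      have hinp4 := hinp3
      rw [List.flatMap_cons, hw', List.cons_append] at hinp4
      refine (Does.ifRead_some hinp4 hv' (Does.skip
        ⟨⟨els3, l ++ [g], g' :: l'', hpre.trans hpre3, h5.congr rfl rfl rfl rfl, by simp [h2], hdone,
          Or.inl ⟨by simpa using hgo3, by simp [hw']⟩⟩, ?_⟩)).weaken (by omega)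
      have := congrArg List.length hinp4
      simp [hgo3, hgo] at this ⊢
      omega
  · exact ⟨els, [], As, List.prefix_rfl, h.congr (by simp) rfl rfl rfl, rfl, by simp,
      Or.inl ⟨by simp [Expr.eval], by simpa [hx] using hinp⟩⟩
  · have hl := congrArg List.length hinp
    simp only [List.length_cons] at hl
    have h2 : 500 * (n + 1) ^ 2 + (Expr.lit 0).cost + (Expr.var .go).cost + 2 ≤
        550 * (n + 1) ^ 2 := by simp only [Expr.cost]; omega
    refine (Nat.mul_le_mul_left _ h2).trans ?_
    simp only [Expr.cost, Store.set_inp, Store.set_var, if_true, Expr.eval, ← hl]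
    have : 0 ≤ (s.inp.length + 1) * (n + 1) ^ 2 := Nat.zero_le _
    have e1 : (s.inp.length + 1 + 1) * (550 * (n + 1) ^ 2) =
      550 * ((s.inp.length + 1) * (n + 1) ^ 2) + 550 * (n + 1) ^ 2 := by ring
    have e2 : 600 * (s.inp.length + 1) * (n + 1) ^ 2 = 600 * ((s.inp.length + 1) * (n + 1) ^ 2) := by
      ring
    rw [e1, e2]
    omega
  · rintro s' ⟨⟨els', l, l', hpre, h1, h2, h3, h4⟩, hlt⟩
    simp only [Expr.eval] at hlt
    obtain rfl : l' = [] := by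
      rcases h4 with h4 | h4
      · omega
      · exact h4.2
    exact ⟨els', hpre, h1, by simpa [h2] using h3⟩

/-- Initialization of the table with the identity on every level. -/
def initTable : Cmd :=
  .seq (forLoop .i (.lit 1)
    (.seq (forLoop .k (.lit 1) (.store .E (.var .i) (.var .k) (.var .k)))
      (.store .I (.var .i) (.var .i) (.var .i))))
    (.assign .N (.sub .size (.lit 1)))

theorem initTable_spec (hI : ∀ r k, s.arr .I r k = 0) (hX : ∀ r k, s.arr .X r k = 0) :
    Does n initTable s (100 * (n + 1) ^ 2) (fun s' => ∃ els, Tab A els s') := by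
  have hn1 : 1 * (n + 1) ≤ (n + 1) ^ 2 := by rw [pow_two]; exact Nat.mul_le_mul_right _ (by omega)
  have hn2 : (n + 1) * ((n + 1) * 25 + 30 + 12) = 25 * (n + 1) ^ 2 + 42 * (n + 1) := by ring
  refine Does.bind (Does.forLoop (T := (n + 1) * 25 + 30) (lo := 1) (fun j s' =>
    (∀ i : Fin n, (i : ℕ) + 1 < j → Rep (s'.arr .E (i + 1)) (1 : Perm (Fin n))) ∧
    (∀ r k, s'.arr .I r k = if r = k ∧ 1 ≤ r ∧ r < j then r else 0) ∧ s'.arr .X = s.arr .X)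
    (by decide) (by simp [Expr.Ok]) rfl (by omega) ?_ ?_) (by rw [hn2]; simp only [Expr.cost]; omega) ?_
  · refine ⟨fun i hi => by omega, fun r k => ?_, rfl⟩
    rw [if_neg (by omega)]
    exact hI r k
  · rintro j s1 hj hj' hi ⟨h1, h2, h3⟩
    obtain ⟨i, rfl⟩ : ∃ i : Fin n, j = i + 1 := ⟨⟨j - 1, by omega⟩, by simp; omega⟩
    have hi' := fin_succ_le i
    refine Does.bind (Does.fillRow (R := i + 1) (σ := (1 : Perm (Fin n))) (τ := 1) hi' ?_)
      (by simp only [Expr.cost]; omega) ?_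
    · intro s' h1 h2 h3 k hk h4
      simp [Expr.Ok, Expr.eval, h1, hi, hk]
    · rintro s2 ⟨h4, h5⟩ F2
      have hi2 := (F2.var .i (by decide)).trans hi
      refine (Does.store (by simp [Expr.Ok]) (by simp [Expr.Ok]) (by simp [Expr.Ok]) ?_ ?_
        ⟨?_, ?_, ?_⟩).weaken (by simp only [Expr.cost]; omega)
      · simpa [Expr.eval, hi2] using hi'
      · simp [Expr.eval, hi2]
      · intro k hk
        by_cases e : k = i
        · subst e
          simpa using h4
        · have e' : (k : ℕ) ≠ i := fun h => e (Fin.ext h)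
          have := h1 k (by omega)
          rw [← h5 _ (by omega)] at this
          simpa using this
      · intro r k
        simp only [Store.set_arr, Store.setArr_arr, Expr.eval, hi2, true_and,
          F2.arr .I (by decide), h2]
        split_ifs <;> omega
      · simp [F2.arr .X (by decide), h3]
  · rintro s1 ⟨h1, h2, h3⟩ -
    refine (Does.assign (by simp [Expr.Ok])
      ⟨List.ofFn fun i : Fin n => (i, (1 : Perm (Fin n))), ?_⟩).weaken
      (by rw [hn2]; simp only [Expr.cost]; omega)
    have hget : ∀ e p, (List.ofFn fun i : Fin n => (i, (1 : Perm (Fin n))))[e]? = some p ↔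
        p.2 = 1 ∧ (p.1 : ℕ) = e := by
      intro e p
      rw [List.getElem?_eq_some_iff]
      constructor
      · rintro ⟨h, rfl⟩
        simp
      · rintro ⟨h, rfl⟩
        refine ⟨by simp, ?_⟩
        simp [← h]
    refine ⟨⟨?_, ?_, ?_, ?_⟩, by simp [Expr.eval], ?_, ?_, ?_⟩
    · intro i
      simp
    · intro p hp k hk
      obtain ⟨e, he⟩ := List.mem_iff_getElem?.1 hp
      rw [((hget e p).1 he).1]
      rfl
    · intro p hp
      obtain ⟨e, he⟩ := List.mem_iff_getElem?.1 hp
      rw [((hget e p).1 he).1]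
      exact one_mem _
    · rw [List.map_ofFn, List.nodup_ofFn]
      intro i j hij
      simpa using hij
    · intro e p he
      obtain ⟨h4, h5⟩ := (hget e p).1 he
      rw [h4, ← h5]
      exact h1 p.1 (by omega)
    · intro i j e
      simp only [Store.set_arr, h2, hget]
      constructor
      · intro h
        have : (i : ℕ) = j ∧ (i : ℕ) = e := by
          split_ifs at h; omega
        exact ⟨(i, 1), ⟨rfl, this.2⟩, rfl, Fin.ext this.1.symm⟩
      · rintro ⟨p, ⟨h4, h5⟩, rfl, h6⟩
        rw [h4] at h6
        have h6 : j = p.1 := h6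
        rw [h6, if_pos (by omega), h5]
    · intro i
      refine ⟨[], by simp [Chain, h3, hX], by simp, fun e => ?_⟩
      simp only [List.mem_singleton, hget]
      constructor
      · rintro rfl
        exact ⟨(i, 1), ⟨rfl, rfl⟩, rfl⟩
      · rintro ⟨p, ⟨-, h5⟩, rfl⟩
        exact h5.symm

end RAM

namespace RAM

set_option linter.constructorNameAsVariable false

open Equiv PermTable

/-! ### Enumeration -/

variable {n : ℕ} {A : Set (Perm (Fin n))} {els : List (Fin n × Perm (Fin n))} {s s' : Store}
  {L tl : ℕ → List (Perm (Fin n))} {q : ℕ → Perm (Fin n)}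

/-- The permutation of the table entry with a given number. -/
def entry (els : List (Fin n × Perm (Fin n))) (e : ℕ) : Perm (Fin n) :=
  (els[e]?.map Prod.snd).getD 1

/-- The pointer `v` leads to a linked list of table entries with the permutations `l`. -/
def Linked (els : List (Fin n × Perm (Fin n))) (X : ℕ → ℕ → ℕ) (v : ℕ) (l : List (Perm (Fin n))) :
    Prop :=
  ∃ ids, Chain X v ids ∧ l = ids.map (entry els) ∧ ∀ e ∈ ids, e < els.length

theorem Linked.eq_nil {X : ℕ → ℕ → ℕ} {l : List (Perm (Fin n))} (h : Linked els X 0 l) :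
    l = [] := by
  obtain ⟨ids, h1, rfl, -⟩ := h
  cases ids with
  | nil => rfl
  | cons e ids => exact absurd h1.1 (by omega)

theorem Linked.eq_cons {X : ℕ → ℕ → ℕ} {v : ℕ} {l : List (Perm (Fin n))} (h : Linked els X v l)
    (hv : v ≠ 0) : ∃ e l', v = e + 1 ∧ e < els.length ∧ l = entry els e :: l' ∧
      Linked els X (X v 0) l' := by
  obtain ⟨ids, h1, rfl, h2⟩ := h
  cases ids with
  | nil => exact absurd h1 hv
  | cons e ids =>
    refine ⟨e, ids.map (entry els), h1.1, h2 e (by simp), rfl, ids, ?_, rfl,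
      fun e he => h2 e (by simp [he])⟩
    rw [h1.1]
    exact h1.2

/-- The lists of the entries of the levels. -/
theorem Tab.exists_lists (h : Tab A els s) : ∃ L tl : ℕ → List (Perm (Fin n)),
    (∀ l < n, L l = 1 :: tl l) ∧ (∀ l < n, Linked els (s.arr .X) (s.arr .X (l + 1) 0) (tl l)) ∧
    (∀ l < n, ∀ V, V ∈ L l ↔ V ∈ level els l) ∧ ∀ l < n, (L l).Nodup := by
  choose f hf using h.chain
  have hget : ∀ l : Fin n, ∀ e ∈ (l : ℕ) :: f l, ∃ p, els[e]? = some p ∧ p.1 = l :=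
    fun l e he => ((hf l).2.2 e).1 he
  have hone : ∀ l : Fin n, entry els l = 1 := fun l => by simp [entry, h.entries.init]
  refine ⟨fun l => if hl : l < n then ((l :: f ⟨l, hl⟩).map (entry els)) else [],
    fun l => if hl : l < n then (f ⟨l, hl⟩).map (entry els) else [], ?_, ?_, ?_, ?_⟩
  · intro l hl
    simp only [hl, dif_pos, List.map_cons]
    rw [hone ⟨l, hl⟩]
  · intro l hl
    simp only [hl, dif_pos]
    refine ⟨_, (hf ⟨l, hl⟩).1, rfl, fun e he => ?_⟩
    obtain ⟨p, hp, -⟩ := hget ⟨l, hl⟩ e (by simp [he])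
    exact (List.getElem?_eq_some_iff.1 hp).1
  · intro l hl V
    simp only [hl, dif_pos, List.mem_map]
    constructor
    · rintro ⟨e, he, rfl⟩
      obtain ⟨p, hp, hp'⟩ := hget ⟨l, hl⟩ e he
      exact ⟨p, List.mem_of_getElem? hp, by rw [hp'], by simp [entry, hp]⟩
    · rintro ⟨p, hp, rfl, rfl⟩
      obtain ⟨e, he⟩ := List.mem_iff_getElem?.1 hp
      exact ⟨e, ((hf p.1).2.2 e).2 ⟨p, he, rfl⟩, by simp [entry, he]⟩
  · intro l hl
    simp only [hl, dif_pos]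
    -- Different numbers on one level belong to different permutations, as the pairs of level and
    -- preimage are distinct.
    refine List.Nodup.map_on ?_ (hf ⟨l, hl⟩).2.1
    intro e he f hf hef
    obtain ⟨p, hp, hp'⟩ := hget ⟨l, hl⟩ e he
    obtain ⟨q, hq, hq'⟩ := hget ⟨l, hl⟩ f hf
    have hpq : p = q := Prod.ext (hp'.trans hq'.symm) (by simpa [entry, hp, hq] using hef)
    subst hpq
    obtain ⟨h1, h2⟩ := List.getElem?_eq_some_iff.1 hp
    obtain ⟨h3, h4⟩ := List.getElem?_eq_some_iff.1 hq
    exact (h.entries.nodup.of_map _).getElem_inj_iff.1 (h2.trans h4.symm)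

/-- The state of the enumeration: on level `l`, the entry with number `C[0][l+1]` is used at the
moment and the entries `tl l` are still to come; row `R[0][l]` of `Q` holds the product `q l` of the
current entries of the levels below `l`. -/
structure EnumState (els : List (Fin n × Perm (Fin n))) (L tl : ℕ → List (Perm (Fin n)))
    (q : ℕ → Perm (Fin n)) (s : Store) : Prop where
  length_le : els.length + 1 ≤ (n + 1) ^ 2
  rep : ∀ e < els.length, Rep (s.arr .E (e + 1)) (entry els e)
  sentinel : s.arr .X (s.arr .C 0 0) 0 = 1
  start : ∀ l < n, ∃ t, L l = 1 :: t ∧ Linked els (s.arr .X) (s.arr .X (l + 1) 0) t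
  cur : ∀ l < n, Linked els (s.arr .X) (s.arr .X (s.arr .C 0 (l + 1)) 0) (tl l)
  cur_le : ∀ l ≤ n, s.arr .C 0 l ≤ (n + 1) ^ 2
  row_le : ∀ l ≤ n, s.arr .R 0 l ≤ l
  row : ∀ l ≤ n, Rep (s.arr .Q (s.arr .R 0 l)) (q l)

theorem EnumState.congr (h : EnumState els L tl q s) (hE : s'.arr .E = s.arr .E)
    (hX : s'.arr .X = s.arr .X) (hC : s'.arr .C = s.arr .C) (hR : s'.arr .R = s.arr .R)
    (hQ : s'.arr .Q = s.arr .Q) : EnumState els L tl q s' where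
  length_le := h.length_le
  rep := hE ▸ h.rep
  sentinel := by rw [hX, hC]; exact h.sentinel
  start := hX ▸ h.start
  cur := by rw [hX, hC]; exact h.cur
  cur_le := hC ▸ h.cur_le
  row_le := hR ▸ h.row_le
  row := by rw [hR, hQ]; exact h.row

/-- All levels above level `j` are set to their first entries. -/
def resetLevels : Cmd :=
  forLoop .l (.add (.var .j) (.lit 1))
    (.seq (.store .C (.lit 0) (.var .l) (.var .l)) (.store .R (.lit 0) (.var .l) (.var .j)))

/-- Row `l` of `E` holds the identity of level `l - 1`, so the number `l` is the right initial
entry. Identities leave the product unchanged, hence all these levels may point to row `j` of `Q`;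
copying rows would take quadratic time. -/
theorem resetLevels_spec {j : ℕ} (hj : s.var .j = j) (hjn : j ≤ n) :
    Does n resetLevels s (60 * (n + 1)) (fun s' =>
      (∀ l ≤ n, s'.arr .C 0 l = if l ≤ j then s.arr .C 0 l else l) ∧
      ∀ l ≤ n, s'.arr .R 0 l = if l ≤ j then s.arr .R 0 l else j) := by
  have hn1 : 1 * (n + 1) ≤ (n + 1) ^ 2 := by rw [pow_two]; exact Nat.mul_le_mul_right _ (by omega)
  refine (Does.forLoop (T := 24) (lo := j + 1) (fun m s' => s'.var .j = j ∧
    (∀ l ≤ n, s'.arr .C 0 l = if l ≤ j ∨ m ≤ l then s.arr .C 0 l else l) ∧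
      ∀ l ≤ n, s'.arr .R 0 l = if l ≤ j ∨ m ≤ l then s.arr .R 0 l else j)
    (by decide) ?_ (by simp [Expr.eval, hj]) (by omega) ?_ ?_).mono
    (by simp only [Expr.cost]; omega) ?_
  · simp [Expr.Ok, Expr.eval, hj]
    omega
  · refine ⟨by simp [hj], fun l hl => ?_, fun l hl => ?_⟩
    · rw [if_pos (by omega)]; rfl
    · rw [if_pos (by omega)]; rfl
  · rintro m s1 hm hm' hl ⟨h1, h2, h3⟩
    refine Does.store_seq (by simp [Expr.Ok]) (by simp [Expr.Ok]) (by simp [Expr.Ok])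
      (by simp [Expr.eval]) (by simp only [Expr.eval]; omega) (by simp only [Expr.cost]; omega) ?_
    refine (Does.store (by simp [Expr.Ok]) (by simp [Expr.Ok]) (by simp [Expr.Ok])
      (by simp [Expr.eval]) (by simp only [Expr.eval, Store.setArr_var]; omega)
      ⟨by simp [h1], fun l hl' => ?_, fun l hl' => ?_⟩).weaken (by simp only [Expr.cost]; omega)
    · simp only [Store.set_arr, Store.setArr_arr, Expr.eval, hl, h2 l hl', reduceCtorEq, false_and,
        if_false, true_and]
      split_ifs <;> omega
    · simp only [Store.set_arr, Store.setArr_arr, Expr.eval, Store.setArr_var, hl, h1, h3 l hl',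
        reduceCtorEq, false_and, if_false, true_and]
      split_ifs <;> omega
  · rintro s' ⟨-, h2, h3⟩
    refine ⟨fun l hl => ?_, fun l hl => ?_⟩
    · rw [h2 l hl]
      split_ifs <;> omega
    · rw [h3 l hl]
      split_ifs <;> omega

/-- Initialization of the enumeration. -/
def initEnum : Cmd :=
  .seq (.store .X (.lit 0) (.lit 0) (.lit 1))
  (.seq (.store .C (.lit 0) (.lit 0) (.lit 0))
  (.seq (.store .R (.lit 0) (.lit 0) (.lit 0))
  (.seq (forLoop .k (.lit 1) (.store .Q (.lit 0) (.var .k) (.var .k)))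
  (.seq (.assign .j (.lit 0)) resetLevels))))

theorem Linked.congr {X Y : ℕ → ℕ → ℕ} {v : ℕ} {l : List (Perm (Fin n))} (h : Linked els X v l)
    (hXY : ∀ r, r ≠ 0 → Y r 0 = X r 0) : Linked els Y v l := by
  obtain ⟨ids, h1, h2, h3⟩ := h
  exact ⟨ids, h1.congr fun e _ => hXY _ (by omega), h2, h3⟩

theorem initEnum_spec (h : Tab A els s) (hL : ∀ l < n, L l = 1 :: tl l)
    (htl : ∀ l < n, Linked els (s.arr .X) (s.arr .X (l + 1) 0) (tl l)) :
    Does n initEnum s (200 * (n + 1)) (EnumState els L tl (fun _ => 1)) := by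
  have hn1 : 1 * (n + 1) ≤ (n + 1) ^ 2 := by rw [pow_two]; exact Nat.mul_le_mul_right _ (by omega)
  -- Row 0 of `X` belongs to no entry. Its nonzero value is the sentinel that stops the search for a
  -- level when none is left.
  refine Does.store_seq (by simp [Expr.Ok]) (by simp [Expr.Ok]) (by simp [Expr.Ok])
    (by simp [Expr.eval]) (by simp [Expr.eval]) (by simp only [Expr.cost]; omega) ?_
  refine Does.store_seq (by simp [Expr.Ok]) (by simp [Expr.Ok]) (by simp [Expr.Ok])
    (by simp [Expr.eval]) (by simp [Expr.eval]) (by simp only [Expr.cost]; omega) ?_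
  refine Does.store_seq (by simp [Expr.Ok]) (by simp [Expr.Ok]) (by simp [Expr.Ok])
    (by simp [Expr.eval]) (by simp [Expr.eval]) (by simp only [Expr.cost]; omega) ?_
  refine Does.bind (Does.fillRow (R := 0) (σ := (1 : Perm (Fin n))) (τ := 1) (by omega) ?_)
    (by simp only [Expr.cost]; omega) ?_
  · intro s' h1 h2 h3 k hk h4
    simp [Expr.Ok, Expr.eval, hk]
  rintro s1 ⟨h1, -⟩ F1
  refine Does.assign_seq (by simp [Expr.Ok]) (by simp only [Expr.cost]; omega) ?_
  refine ((resetLevels_spec (j := 0) (by simp [Expr.eval]) (by omega)).frame).mono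
    (by simp only [Expr.cost]; omega) ?_
  rintro s2 ⟨⟨hC, hR⟩, F2⟩
  have hE2 : s2.arr .E = s.arr .E := by
    rw [F2.arr .E (by decide), Store.set_arr, F1.arr .E (by decide)]
    simp
  have hX2 : ∀ r, s2.arr .X r 0 = if r = 0 then 1 else s.arr .X r 0 := by
    intro r
    rw [F2.arr .X (by decide), Store.set_arr, F1.arr .X (by decide)]
    simp [Store.setArr_arr, Expr.eval]
  have hX2' : ∀ r, r ≠ 0 → s2.arr .X r 0 = s.arr .X r 0 := fun r hr => by rw [hX2, if_neg hr]
  have hQ2 : Rep (s2.arr .Q 0) (1 : Perm (Fin n)) := by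
    rw [F2.arr .Q (by decide)]
    simpa using h1
  have hC2 : ∀ l ≤ n, s2.arr .C 0 l = l := by
    intro l hl
    rw [hC l hl]
    split_ifs with h0
    · rw [Store.set_arr, F1.arr .C (by decide)]
      obtain rfl : l = 0 := by omega
      simp [Store.setArr_arr, Expr.eval]
    · rfl
  have hR2 : ∀ l ≤ n, s2.arr .R 0 l = 0 := by
    intro l hl
    rw [hR l hl]
    split_ifs with h0
    · rw [Store.set_arr, F1.arr .R (by decide)]
      obtain rfl : l = 0 := by omega
      simp [Store.setArr_arr, Expr.eval]
    · rfl
  have htl2 : ∀ l < n, Linked els (s2.arr .X) (s2.arr .X (l + 1) 0) (tl l) := by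
    intro l hl
    rw [hX2' _ (by omega)]
    exact (htl l hl).congr hX2'
  refine ⟨h.entries.length_lt, ?_, ?_, ?_, ?_, ?_, ?_, ?_⟩
  · intro e he
    rw [hE2]
    have := h.rep e _ (List.getElem?_eq_getElem he)
    simpa [entry, he] using this
  · rw [hC2 0 (by omega), hX2, if_pos rfl]
  · exact fun l hl => ⟨tl l, hL l hl, htl2 l hl⟩
  · intro l hl
    rw [hC2 _ (by omega)]
    exact htl2 l hl
  · intro l hl
    rw [hC2 l hl]
    omega
  · intro l hl
    rw [hR2 l hl]
    omega
  · intro l hl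
    rw [hR2 l hl]
    exact hQ2

/-- Search for the last level with a further entry. -/
def findLevel : Cmd :=
  .seq (.assign .j (.sub .size (.lit 1)))
    (.whileLt (.get .X (.get .C (.lit 0) (.var .j)) (.lit 0)) (.lit 1)
      (.assign .j (.sub (.var .j) (.lit 1))))

/-- The variable `j` is one more than the level under inspection, so that `j = 0` reports the end of
the enumeration. -/
theorem findLevel_spec (h : EnumState els L tl q s) :
    Does n findLevel s (60 * (n + 1)) (fun s' => s'.var .j ≤ n ∧
      (∀ l, s'.var .j ≤ l → l < n → tl l = []) ∧
      s'.arr .X (s'.arr .C 0 (s'.var .j)) 0 ≠ 0) := by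
  refine Does.assign_seq (by simp [Expr.Ok]) (by simp only [Expr.cost]; omega) ?_
  refine (Does.whileLt (T := 6) (fun s' => s'.var .j ≤ n ∧
    (∀ l, s'.var .j ≤ l → l < n → tl l = []) ∧ s'.arr = s.arr) (fun s' => s'.var .j)
    ?_ ?_ ?_).mono ?_ ?_
  · rintro s1 ⟨h1, h2, h3⟩
    have := h.cur_le _ h1
    simp [Expr.Ok, Expr.eval, h3, this]
    omega
  · rintro s1 ⟨h1, h2, h3⟩ hlt
    simp only [Expr.eval, h3] at hlt
    have hj : s1.var .j ≠ 0 := by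
      intro h0
      rw [h0, h.sentinel] at hlt
      omega
    refine (Does.assign (by simp [Expr.Ok]) ⟨⟨?_, ?_, h3⟩, ?_⟩).weaken (by simp [Expr.cost])
    · simp [Expr.eval]
      omega
    · intro l hl hl'
      simp only [Expr.eval, Store.set_var, if_true] at hl
      by_cases e : s1.var .j ≤ l
      · exact h2 l e hl'
      · have e' : s1.var .j = l + 1 := by omega
        have := h.cur l hl'
        -- A null pointer behind the current entry means that the level is exhausted.
        rw [← e', show s.arr .X (s.arr .C 0 (s1.var .j)) 0 = 0 by omega] at this
        exact this.eq_nil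
    · simp [Expr.eval]
      omega
  · refine ⟨by simp [Expr.eval], fun l hl hl' => ?_, rfl⟩
    simp [Expr.eval] at hl
    omega
  · simp [Expr.cost, Expr.eval]
    omega
  · rintro s1 ⟨⟨h1, h2, h3⟩, hlt⟩
    simp only [Expr.eval] at hlt
    exact ⟨h1, h2, by omega⟩

/-- Passing to the next entry on level `j`. -/
def advance : Cmd :=
  .seq (.assign .e (.get .X (.get .C (.lit 0) (.var .j)) (.lit 0)))
  (.seq (.store .C (.lit 0) (.var .j) (.var .e))
  (.seq (.assign .r (.get .R (.lit 0) (.sub (.var .j) (.lit 1))))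
  (.seq (forLoop .k (.lit 1)
    (.store .Q (.var .j) (.var .k) (.get .E (.var .e) (.get .Q (.var .r) (.var .k)))))
  (.seq (.store .R (.lit 0) (.var .j) (.var .j)) resetLevels))))

/-- A single composition fills row `j + 1` of `Q`. Overwriting this row is safe: by `row_le`, the
levels up to `j` point only to rows with number at most `j`. -/
theorem advance_spec (h : EnumState els L tl q s) {j : ℕ} (hj : s.var .j = j + 1) (hjn : j < n)
    (hnil : ∀ l, j + 1 ≤ l → l < n → tl l = [])
    (hX : s.arr .X (s.arr .C 0 (j + 1)) 0 ≠ 0) :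
    Does n advance s (200 * (n + 1)) (fun s' => ∃ tl' q', EnumState els L tl' q' s' ∧
      rest L tl q n = q' n :: rest L tl' q' n) := by
  have hn1 : 1 * (n + 1) ≤ (n + 1) ^ 2 := by rw [pow_two]; exact Nat.mul_le_mul_right _ (by omega)
  obtain ⟨e, t, he, hlt, htl, hlink⟩ := (h.cur j hjn).eq_cons hX
  have hlen := h.length_le
  have hC := h.cur_le (j + 1) (by omega)
  have hRj := h.row_le j (by omega)
  have hQ := h.row j (by omega)
  have hE := h.rep e hlt
  choose! st hst using h.start
  refine Does.assign_seq (by simp [Expr.Ok, Expr.eval, hj, hC, hjn])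
    (by simp only [Expr.cost]; omega) ?_
  simp only [Expr.eval, hj, he]
  refine Does.store_seq (by simp [Expr.Ok]) (by simp [Expr.Ok]) (by simp [Expr.Ok])
    (by simp [Expr.eval]) (by simp [Expr.eval, hj, hjn]) (by simp only [Expr.cost]; omega) ?_
  simp only [Expr.eval, hj, Store.set_var, reduceCtorEq, if_false, if_true]
  refine Does.assign_seq (by simp [Expr.Ok, Expr.eval, hj]; omega)
    (by simp only [Expr.cost]; omega) ?_
  simp only [Expr.eval, hj, Store.set_var, Store.setArr_var, reduceCtorEq, if_false,
    Nat.add_sub_cancel, Store.setArr_arr, Store.set_arr, false_and]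
  set s1 := (((s.set .e (e + 1)).setArr .C 0 (j + 1) (e + 1)).set .r (s.arr .R 0 j)) with hs1
  refine Does.bind (Does.fillRow (R := j + 1) (σ := (1 : Perm (Fin n)))
    (τ := entry els e * q j) (by omega) ?_) (by simp only [Expr.cost]; omega) ?_
  · intro s' h1 h2 h3 k hk h4
    have hr : s'.var .r = s.arr .R 0 j := by rw [h1 _ (by simp)]; simp [hs1]
    have hq : s'.arr .Q (s.arr .R 0 j) = s.arr .Q (s.arr .R 0 j) := by
      rw [h3 _ (by omega)]
      simp [hs1]
    have he' : s'.var .e = e + 1 := by rw [h1 _ (by simp)]; simp [hs1]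
    have hE' : s'.arr .E = s.arr .E := by rw [h2 _ (by simp)]; simp [hs1]
    have hj' : s'.var .j = j + 1 := by rw [h1 _ (by simp)]; simp [hs1, hj]
    simp [Expr.Ok, Expr.eval, hr, hq, he', hE', hj', hk, hQ k, hE (q j k)]
    omega
  rintro s2 ⟨hQ2, hQ2'⟩ F2
  have hj2 : s2.var .j = j + 1 := by rw [F2.var .j (by decide)]; simp [hs1, hj]
  refine Does.store_seq (by simp [Expr.Ok]) (by simp [Expr.Ok]) (by simp [Expr.Ok])
    (by simp [Expr.eval]) (by simp [Expr.eval, hj2, hjn]) (by simp only [Expr.cost]; omega) ?_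
  simp only [Expr.eval, hj2]
  refine ((resetLevels_spec (j := j + 1) (by simp [hj2]) (by omega)).frame).mono
    (by simp only [Expr.cost]; omega) ?_
  rintro s3 ⟨⟨hC3, hR3⟩, F3⟩
  have hE3 : s3.arr .E = s.arr .E := by
    rw [F3.arr .E (by decide), Store.setArr_arr_of_ne _ (by simp), F2.arr .E (by decide)]
    simp [hs1]
  have hX3 : s3.arr .X = s.arr .X := by
    rw [F3.arr .X (by decide), Store.setArr_arr_of_ne _ (by simp), F2.arr .X (by decide)]
    simp [hs1]
  have hQ3 : s3.arr .Q = s2.arr .Q := by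
    rw [F3.arr .Q (by decide), Store.setArr_arr_of_ne _ (by simp)]
  have hC3' : ∀ l ≤ n, s3.arr .C 0 l = if l ≤ j then s.arr .C 0 l else
      if l = j + 1 then e + 1 else l := by
    intro l hl
    rw [hC3 l hl, Store.setArr_arr_of_ne _ (by simp), F2.arr .C (by decide)]
    simp only [hs1, Store.set_arr, Store.setArr_arr, true_and]
    split_ifs <;> omega
  have hR3' : ∀ l ≤ n, s3.arr .R 0 l = if l ≤ j then s.arr .R 0 l else j + 1 := by
    intro l hl
    rw [hR3 l hl, Store.setArr_arr, F2.arr .R (by decide)]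
    simp only [hs1, Store.set_arr, Store.setArr_arr, true_and, reduceCtorEq, false_and, if_false]
    split_ifs <;> omega
  -- Below `j` nothing changes, level `j` loses one entry, and the levels above recover all entries
  -- but the identity.
  refine ⟨fun l => if l < j then tl l else if l = j then t else st l,
    fun l => if l ≤ j then q l else entry els e * q j, ⟨hlen, ?_, ?_, ?_, ?_, ?_, ?_, ?_⟩, ?_⟩
  · rw [hE3]; exact h.rep
  · rw [hC3' 0 (by omega), if_pos (by omega), hX3]; exact h.sentinel
  · rw [hX3]; exact h.start
  · intro l hl
    rw [hX3, hC3' _ (by omega)]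
    rcases lt_trichotomy l j with h1 | h1 | h1
    · rw [if_pos (by omega), if_pos h1]
      exact h.cur l hl
    · subst h1
      rw [if_neg (by omega), if_pos rfl, if_neg (by omega), if_pos rfl, ← he]
      exact hlink
    · rw [if_neg (by omega), if_neg (by omega), if_neg (by omega), if_neg (by omega)]
      exact (hst l hl).2
  · intro l hl
    rw [hC3' l hl]
    have := h.cur_le l hl
    split_ifs <;> omega
  · intro l hl
    rw [hR3' l hl]
    have := h.row_le l hl
    split_ifs <;> omega
  · intro l hl
    rw [hR3' l hl, hQ3]
    by_cases h1 : l ≤ j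
    · simp only [if_pos h1]
      have := h.row_le l hl
      rw [hQ2' _ (by omega)]
      simpa [hs1] using h.row l hl
    · simp only [if_neg h1]
      simpa using hQ2
  · refine rest_step (L := L) (q := q)
      (tl' := fun l => if l < j then tl l else if l = j then t else st l)
      (q' := fun l => if l ≤ j then q l else entry els e * q j) hjn (V := entry els e) ?_ (fun l hl hl' => hnil l hl hl') ?_ ?_ ?_ ?_
    · simp [htl]
    · intro l hl
      simp [hl]
    · intro l hl hl'
      simp only [if_neg (show ¬ l < j by omega), if_neg (show ¬ l = j by omega)]
      exact (hst l hl').1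
    · intro l hl
      simp [hl]
    · intro l hl hl'
      simp only [if_neg (show ¬ l ≤ j by omega)]

/-- Output of the current permutation and transition to the next one. -/
def enumStep : Cmd :=
  .seq (.assign .r (.get .R (.lit 0) (.sub .size (.lit 1))))
  (.seq (forLoop .k (.lit 1) (.write (.get .Q (.var .r) (.var .k))))
  (.seq findLevel
  (.seq (.assign .go (.var .j)) (.ifLt (.lit 0) (.var .j) advance .skip))))

theorem permWords_eq_flatMap (g : Perm (Fin n)) {f : ℕ → List ℕ}
    (hf : ∀ k : Fin n, f (k + 1) = [(g k : ℕ) + 1]) :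
    (List.range' 1 n).flatMap f = permWords g := by
  have h : List.range' 1 n = (List.finRange n).map fun k : Fin n => (k : ℕ) + 1 := by
    apply List.ext_getElem <;> simp [add_comm]
  rw [h, List.flatMap_map, permWords, List.ofFn_eq_map, List.flatMap_congr (fun k _ => hf k),
    List.map_eq_flatMap]

theorem enumStep_spec (h : EnumState els L tl q s) :
    Prints n enumStep s (permWords (q n)) (450 * (n + 1)) (fun s' =>
      (s'.var .go = 0 ∧ rest L tl q n = []) ∨ (0 < s'.var .go ∧ ∃ tl' q',
        EnumState els L tl' q' s' ∧ rest L tl q n = q' n :: rest L tl' q' n)) := by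
  have hn1 : 1 * (n + 1) ≤ (n + 1) ^ 2 := by rw [pow_two]; exact Nat.mul_le_mul_right _ (by omega)
  have hRn := h.row_le n le_rfl
  have hQn := h.row n le_rfl
  set s1 := s.set .r (s.arr .R 0 n) with hs1
  have hprint : Prints n (forLoop .k (.lit 1) (.write (.get .Q (.var .r) (.var .k)))) s1
      (permWords (q n)) (30 * (n + 1) + 20)
      (fun s' => s'.arr = s1.arr) := by
    have := Prints.forLoop (n := n) (s := s1) (x := .k) (e := .lit 1) (lo := 1)
      (c := .write (.get .Q (.var .r) (.var .k))) (T := 12)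
      (fun k => [s.arr .Q (s.arr .R 0 n) k])
      (fun _ s' => s'.arr = s1.arr ∧ s'.var .r = s.arr .R 0 n) (by simp [Cmd.vars])
      (by simp [Expr.Ok]) rfl (by omega) ⟨rfl, by simp [hs1]⟩ ?_
    · rw [Nat.add_sub_cancel, permWords_eq_flatMap (q n) fun k => by rw [hQn k]] at this
      exact this.mono (by simp only [Expr.cost]; omega) fun _ h => h.1
    · rintro k s2 hk hk' hv ⟨h1, h2⟩
      refine Prints.write ?_ ?_ ⟨h1, by simp [h2]⟩
      · simp [Expr.Ok, Expr.eval, h2, hv]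
        omega
      · simp [Expr.eval, h1, h2, hv, hs1]
  have hmain : Prints n enumStep s ([] ++ (permWords (q n) ++ []))
      (14 + ((30 * (n + 1) + 20) + (300 * (n + 1) + 20))) (fun s' =>
      (s'.var .go = 0 ∧ rest L tl q n = []) ∨ (0 < s'.var .go ∧ ∃ tl' q',
        EnumState els L tl' q' s' ∧ rest L tl q n = q' n :: rest L tl' q' n)) := by
    refine Prints.seq ((Does.assign (by simp [Expr.Ok, Expr.eval]) ?_).weaken
      (by simp [Expr.cost]))
    refine Prints.seq (hprint.mono le_rfl fun s2 hs2 => ?_)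
    have h2 : EnumState els L tl q s2 := by
      have hs3 : s2.arr = s.arr := hs2
      exact h.congr (by rw [hs3]) (by rw [hs3]) (by rw [hs3]) (by rw [hs3]) (by rw [hs3])
    refine Does.bind (findLevel_spec h2) (by omega) ?_
    rintro s3 ⟨h3, h4, h5⟩ F3
    have h6 : EnumState els L tl q s3 := h2.congr (F3.arr _ (by decide)) (F3.arr _ (by decide))
      (F3.arr _ (by decide)) (F3.arr _ (by decide)) (F3.arr _ (by decide))
    refine Does.assign_seq (by simp [Expr.Ok]) (by simp only [Expr.cost]; omega) ?_
    refine (Does.ifLt (T := 200 * (n + 1)) (by simp [Expr.Ok]) (by simp [Expr.Ok])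
      ?_ ?_).weaken (by simp only [Expr.cost]; omega)
    · intro hlt
      simp only [Expr.eval, Store.set_var, reduceCtorEq, if_false] at hlt
      obtain ⟨j, hj⟩ : ∃ j, s3.var .j = j + 1 := ⟨s3.var .j - 1, by omega⟩
      rw [hj] at h3 h4 h5
      refine ((advance_spec (s := s3.set .go (s3.var .j)) (h6.congr rfl rfl rfl rfl rfl) (j := j) (by simp [hj]) (by omega) h4
        (by simpa using h5)).frame).mono le_rfl ?_
      rintro s4 ⟨h7, F4⟩
      refine Or.inr ⟨?_, h7⟩
      rw [F4.var .go (by decide)]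
      simp [hj]
    · intro hlt
      simp only [Expr.eval, Store.set_var, reduceCtorEq, if_false] at hlt
      have hj : s3.var .j = 0 := by omega
      refine (Does.skip (Or.inl ⟨by simp [Expr.eval, hj], ?_⟩)).weaken (by omega)
      rw [rest_skip (j := 0) (by omega) fun l hl hl' => h4 l (by omega) hl']
      rfl
  rw [List.nil_append, List.append_nil] at hmain
  exact hmain.weaken (by omega)

/-- The main loop of the enumeration. -/
def enumLoop : Cmd := .whileLt (.lit 0) (.var .go) enumStep

/-- Each round of the loop, with its test and jump, is one block that writes one permutation. The
trailing silent trace is the final failing test. -/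
theorem enumLoop_spec (h : EnumState els L tl q s) (hgo : 0 < s.var .go) :
    ∃ (bs : List (List (Option ℕ))) (tr : List (Option ℕ)) (s' : Store), Exec n enumLoop s (bs.flatten ++ tr) s' ∧
      bs.map List.reduceOption = (q n :: rest L tl q n).map permWords ∧
      (∀ b ∈ bs, b.length ≤ 470 * (n + 1)) ∧ tr.reduceOption = [] ∧ tr.length ≤ 10 := by
  induction hm : (rest L tl q n).length generalizing s tl q with
  | zero =>
    obtain ⟨tr, s', h1, h2, h3, h4⟩ := enumStep_spec h
    have hnil : rest L tl q n = [] := List.eq_nil_of_length_eq_zero hm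
    have hgo' : s'.var .go = 0 := by
      rcases h4 with h4 | ⟨-, tl', q', -, h4⟩
      · exact h4.1
      · rw [hnil] at h4
        cases h4
    refine ⟨[silent 4 ++ tr ++ silent 1], silent 4 ++ silent 1, s', ?_, ?_, ?_, ?_, ?_⟩
    · rw [List.flatten_singleton]
      exact Exec.while_true (e₁ := .lit 0) (e₂ := .var .go) (by simp [Expr.Ok]) (by simp [Expr.Ok])
        hgo h1 (Exec.while_false (by simp [Expr.Ok]) (by simp [Expr.Ok])
          (by simp [Expr.eval, hgo']))
    · rw [List.map_singleton, List.reduceOption_append, List.reduceOption_append,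
        reduceOption_silent, reduceOption_silent, h2, hnil]
      simp
    · simp
      omega
    · rw [List.reduceOption_append, reduceOption_silent, reduceOption_silent]
      rfl
    · simp
  | succ m ih =>
    obtain ⟨tr, s', h1, h2, h3, h4⟩ := enumStep_spec h
    rcases h4 with ⟨-, h4⟩ | ⟨hgo', tl', q', h5, h6⟩
    · rw [h4] at hm
      simp at hm
    obtain ⟨bs, tr', s'', g1, g2, g3, g4, g5⟩ := ih h5 hgo' (by rw [h6] at hm; simpa using hm)
    refine ⟨(silent 4 ++ tr ++ silent 1) :: bs, tr', s'', ?_, ?_, ?_, g4, g5⟩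
    · rw [List.flatten_cons, List.append_assoc]
      exact Exec.while_true (e₁ := .lit 0) (e₂ := .var .go) (by simp [Expr.Ok]) (by simp [Expr.Ok])
        hgo h1 g1
    · rw [List.map_cons, g2, h6, List.map_cons, List.reduceOption_append, List.reduceOption_append,
        reduceOption_silent, reduceOption_silent, h2]
      simp
    · intro b hb
      rcases List.mem_cons.1 hb with rfl | hb
      · simp
        omega
      · exact g3 b hb

end RAM

namespace RAM

set_option linter.constructorNameAsVariable false

open Equiv PermTable

/-! ### The program -/

variable {n : ℕ}

/-- Computation of the table and preparation of the enumeration. -/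
def preprocess : Cmd :=
  .seq initTable (.seq readAll (.seq siftAll (.seq initEnum (.assign .go (.lit 1)))))

/-- Output of the identity. -/
def printOne : Cmd := .seq (.write (.lit 1)) (forLoop .k (.lit 2) (.write (.var .k)))

/-- The program without its prologue. -/
def mainCmd : Cmd := .seq (.ifRead .x (.seq preprocess enumLoop) printOne) (.write (.lit 0))

/-- The prologue reads the degree and puts the number of columns of the arrays into register `0`. -/
def prologue : List Instr := [.read 0 0, .const 16 1, .add 0 0 16]

/-- The program that enumerates the permutation group. -/
def enumProgram : Program := prologue ++ mainCmd.compile 3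

theorem prologue_correct {w : ℕ} (hf : Fits n w) (inp : List ℕ) :
    ∃ c, Steps enumProgram w (config enumProgram w (n :: inp) 0) (silent 3) c ∧ c.pc = 3 ∧
      Related n w ⟨fun _ => 0, fun _ _ _ => 0, inp⟩ c := by
  have hn1 : 1 * (n + 1) ≤ (n + 1) ^ 2 := by rw [pow_two]; exact Nat.mul_le_mul_right _ (by omega)
  have h1 : 1 < 2 ^ w := hf.lt (by omega)
  have hn : n < 2 ^ w := hf.lt (by omega)
  have hn' : n + 1 < 2 ^ w := hf.lt (by omega)
  let c1 : Config := ⟨1, Function.update (fun _ => 0) 0 n, inp⟩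
  let c2 : Config := ⟨2, Function.update c1.reg 16 1, inp⟩
  let c3 : Config := ⟨3, Function.update c2.reg 0 (n + 1), inp⟩
  have S1 : Steps enumProgram w (config enumProgram w (n :: inp) 0) [none] c1 := by
    have := Steps.single (P := enumProgram) (w := w) (c := config enumProgram w (n :: inp) 0)
      (ins := .read 0 0) rfl (by simp)
    simpa [Instr.exec, config, Config.put, Nat.mod_eq_of_lt hn] using this
  have S2 : Steps enumProgram w c1 [none] c2 := by
    have := Steps.single (P := enumProgram) (w := w) (c := c1) (ins := .const 16 1) rfl (by simp)
    simpa [Instr.exec, Config.put, Nat.mod_eq_of_lt h1] using this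
  have S3 : Steps enumProgram w c2 [none] c3 := by
    have := Steps.single (P := enumProgram) (w := w) (c := c2) (ins := .add 0 0 16) rfl (by simp)
    have e : c2.reg 0 + c2.reg 16 = n + 1 := by simp [c2, c1]
    simpa only [Instr.exec, Config.put, e, Nat.mod_eq_of_lt hn'] using this
  refine ⟨c3, (S1.append S2).append S3, rfl, ?_, ?_, ?_, rfl, ?_⟩
  · simp [c3]
  · intro x
    have h0 := x.reg_pos
    have h16 := x.reg_lt
    simp only [c3, c2, c1]
    rw [Function.update_of_ne (by omega), Function.update_of_ne (by omega),
      Function.update_of_ne (by omega)]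
  · intro A r k _
    have : 32 ≤ addr n A r k := by unfold addr; omega
    simp only [c3, c2, c1]
    rw [Function.update_of_ne (by omega), Function.update_of_ne (by omega),
      Function.update_of_ne (by omega)]
  · intro i
    simp only [c3, c2, c1, Function.update_apply]
    split_ifs <;> omega

theorem enumProgram_steps {w : ℕ} (hf : Fits n w) {inp : List ℕ} {tr : List (Option ℕ)} {s : Store}
    (h : Exec n mainCmd ⟨fun _ => 0, fun _ _ _ => 0, inp⟩ tr s) :
    ∃ c, Steps enumProgram w (config enumProgram w (n :: inp) 0) (silent 3 ++ tr) c ∧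
      Halted enumProgram c := by
  obtain ⟨c, h1, h2, h3⟩ := prologue_correct hf inp
  have hcode : CodeAt enumProgram 3 (mainCmd.compile 3) := by
    intro i hi
    have hl : prologue.length = 3 := rfl
    rw [enumProgram, List.getElem?_append_right (by omega), hl, Nat.add_sub_cancel_left,
      List.getElem?_eq_getElem hi]
  obtain ⟨c', h4, h5, -⟩ := h.correct hf h3 (by rw [h2]; exact hcode) (by decide)
  refine ⟨c', h1.append h4, ?_⟩
  rw [Halted, enumProgram, List.length_append, Cmd.length_compile, h5, h2]
  rfl

theorem preprocess_spec (hn : 0 < n) {As : List (Perm (Fin n))} {v : ℕ} {ws : List ℕ}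
    (hAs : As.flatMap permWords = v :: ws) :
    Does n preprocess ⟨Function.update (fun _ => 0) .x v, fun _ _ _ => 0, ws⟩
      (3000 * (ws.length + 2) ^ 6) (fun s' => ∃ els L tl,
        EnumState els L tl (fun _ => 1) s' ∧ 0 < s'.var .go ∧
        (∀ l < n, L l = 1 :: tl l) ∧ (prodList L 0 n 1).Nodup ∧
        ∀ g, g ∈ prodList L 0 n 1 ↔ g ∈ Subgroup.closure {g | g ∈ As}) := by
  set A : Set (Perm (Fin n)) := {g | g ∈ As} with hA
  set s0 : Store := ⟨Function.update (fun _ => 0) .x v, fun _ _ _ => 0, ws⟩ with hs0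
  have hlen : (As.flatMap permWords).length = ws.length + 1 := by rw [hAs]; rfl
  -- With at least one generator the degree is bounded by the input length, so a polynomial in `n`
  -- is good enough.
  have hnle : n ≤ ws.length + 1 := by
    rw [← hlen]
    cases As with
    | nil => simp at hAs
    | cons g As => simp [permWords]
  set Y := ws.length + 2 with hY
  have hY1 : 1 ≤ Y := by omega
  have y1 : n + 1 ≤ Y ^ 6 := (by omega : n + 1 ≤ Y).trans (Nat.le_self_pow (by omega) Y)
  have y2 : (n + 1) ^ 2 ≤ Y ^ 6 := (Nat.pow_le_pow_left (by omega) 2).trans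
    (Nat.pow_le_pow_right hY1 (by omega))
  have y3 : (ws.length + 1) * (n + 1) ^ 2 ≤ Y ^ 6 := by
    calc (ws.length + 1) * (n + 1) ^ 2 ≤ Y * Y ^ 2 :=
        Nat.mul_le_mul (by omega) (Nat.pow_le_pow_left (by omega) 2)
      _ = Y ^ 3 := by ring
      _ ≤ Y ^ 6 := Nat.pow_le_pow_right hY1 (by omega)
  have y6 : (n + 1) ^ 6 ≤ Y ^ 6 := Nat.pow_le_pow_left (by omega) 6
  have y0 : 1 ≤ Y ^ 6 := Nat.one_le_pow _ _ hY1
  refine Does.bind (initTable_spec (A := A) (fun _ _ => rfl) (fun _ _ => rfl)) (by omega) ?_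
  rintro s1 ⟨els1, h1⟩ F1
  have hx1 : s1.var .x = v := by rw [F1.var .x (by decide)]; simp [hs0]
  have hi1 : s1.inp = ws := by rw [F1.inp (by decide)]
  have e : 600 * (As.flatMap permWords).length * (n + 1) ^ 2 =
      600 * ((ws.length + 1) * (n + 1) ^ 2) := by rw [hlen]; ring
  refine Does.bind (readAll_spec hn (fun g hg => Subgroup.subset_closure hg) h1 hx1
    (by rw [hi1, hAs])) (by rw [e]; omega) ?_
  rintro s2 ⟨els2, -, h2, hgen⟩ -
  refine Does.bind (siftAll_spec h2) (by rw [e]; omega) ?_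
  rintro s3 ⟨els3, hpre, h3, hpair⟩ -
  obtain ⟨L, tl, hL, htl, hmem, hnodup⟩ := h3.exists_lists
  refine Does.bind (initEnum_spec h3 hL htl) (by rw [e]; omega) ?_
  rintro s4 h4 -
  refine (Does.assign (by simp [Expr.Ok]) ⟨els3, L, tl, h4.congr rfl rfl rfl rfl rfl,
    by simp [Expr.eval], hL, nodup_prodList h3.entries.isTable hmem hnodup (by omega) 1, ?_⟩).weaken
    (by rw [e]; simp only [Expr.cost]; omega)
  intro g
  rw [mem_prodList hmem (by omega), ← SetLike.mem_coe, ← desc_eq_closure h3.entries.isTable]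
  · simp
  · rintro i hi _ ⟨p, hp, -, rfl⟩
    exact h3.entries.mem p hp
  · intro a ha
    exact Desc.mono (level_mono hpre) (hgen a ha)
  · rintro i hi j hj _ ⟨p, hp, -, rfl⟩ _ ⟨q, hq, -, rfl⟩
    exact hpair q hq p hp

/-- The first word comes in the second step, regardless of `n`; the empty list of generators
requires this. -/
theorem printOne_spec (hn : 0 < n) (s : Store) : ∃ tr s',
    Exec n printOne s (none :: some 1 :: tr) s' ∧ 1 :: tr.reduceOption = permWords (1 : Perm (Fin n)) ∧
      tr.length ≤ 20 * (n + 1) := by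
  have h := Prints.forLoop (n := n) (s := s) (x := .k) (e := .lit 2) (lo := 2)
    (c := .write (.var .k)) (T := 3) (fun k => [k]) (fun _ _ => True) (by simp [Cmd.vars])
    (by simp [Expr.Ok]) rfl (by omega) trivial
    (fun k s2 _ _ hv _ => Prints.write (by simp [Expr.Ok]) (by simp [Expr.eval, hv]) trivial)
  obtain ⟨tr, s', h1, h2, h3, -⟩ := h
  refine ⟨tr, s', Exec.seq (Exec.write (e := .lit 1) (by simp [Expr.Ok])) h1, ?_, ?_⟩
  · rw [h2, ← permWords_eq_flatMap (1 : Perm (Fin n)) (f := fun k => [k]) (by simp)]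
    obtain ⟨m, rfl⟩ : ∃ m, n = m + 1 := ⟨n - 1, by omega⟩
    rw [List.range'_succ]
    rfl
  · refine h3.trans ?_
    simp only [Expr.cost]
    omega

/-- Such registers hold numbers up to `(n + 1) ^ 10`, while memory is cubic in `n + 1`; since `n + 1
≥ 2`, the surplus powers absorb the constants. -/
theorem fits_of_le {w : ℕ} (hn : 1 ≤ n) (hw : 10 * (Nat.log 2 n + 1) ≤ w) : Fits n w := by
  have h1 : n + 1 ≤ 2 ^ (Nat.log 2 n + 1) := Nat.lt_pow_succ_log_self (by omega) n
  have h2 : (n + 1) ^ 10 ≤ 2 ^ w := by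
    calc (n + 1) ^ 10 ≤ (2 ^ (Nat.log 2 n + 1)) ^ 10 := Nat.pow_le_pow_left h1 10
      _ = 2 ^ (10 * (Nat.log 2 n + 1)) := by rw [← pow_mul, mul_comm]
      _ ≤ 2 ^ w := Nat.pow_le_pow_right (by omega) hw
  refine le_trans ?_ h2
  set m := n + 1 with hm
  have hm2 : 2 ≤ m := by omega
  have h3 : 64 * m ^ 3 ≤ m ^ 10 := by
    calc 64 * m ^ 3 = 2 ^ 6 * m ^ 3 := by norm_num
      _ ≤ m ^ 6 * m ^ 3 := Nat.mul_le_mul_right _ (Nat.pow_le_pow_left hm2 6)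
      _ = m ^ 9 := by ring
      _ ≤ m ^ 10 := Nat.pow_le_pow_right (by omega) (by omega)
  have h4 : m ^ 2 * m = m ^ 3 := by ring
  have h5 : 8 ≤ m ^ 3 := Nat.pow_le_pow_left hm2 3
  have h6 : m ≤ m ^ 3 := Nat.le_self_pow (by omega) m
  rw [h4]
  omega

theorem enumProgram_enumerates {w : ℕ} (hn : 1 ≤ n) (hw : 10 * (Nat.log 2 n + 1) ≤ w)
    (A : List (Perm (Fin n))) : ∃ (s : List (Perm (Fin n))) (t : ℕ → ℕ),
      Enumerates enumProgram w (permInput A) permWords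
        (Subgroup.closure {g | g ∈ A} : Set (Perm (Fin n))) s t ∧
      t 0 ≤ 10000 * (permInput A).length ^ 6 ∧
      ∀ i < s.length, t i + n ≤ t (i + 1) ∧ t (i + 1) ≤ t i + 2000 * n := by
  have hf := fits_of_le hn hw
  have hlenW : ∀ g : Perm (Fin n), (permWords g).length = n := fun g => by simp [permWords]
  have hwrite : ∀ s : Store, Exec n (.write (.lit 0)) s (silent 1 ++ [some 0]) s := fun s =>
    Exec.write (e := .lit 0) (by simp [Expr.Ok])
  cases A with
  | nil =>
    obtain ⟨tr, s', h1, h2, h3⟩ := printOne_spec hn ⟨fun _ => 0, fun _ _ _ => 0, []⟩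
    obtain ⟨c, h4, h5⟩ := enumProgram_steps hf
      (Exec.seq (Exec.ifRead_none (x := .x) (c₁ := .seq preprocess enumLoop) rfl h1) (hwrite s'))
    have e : silent 3 ++ (silent 1 ++ none :: some 1 :: tr ++ (silent 1 ++ [some 0])) =
        silent 5 ++ ([some 1 :: tr].flatten ++ (silent 1 ++ [some 0])) := by
      rw [List.flatten_singleton]
      rfl
    rw [e] at h4
    -- The delay is at most `2 * D = 960 * (n + 1) ≤ 1920 * n`. The start is bounded through `h0`,
    -- as the general bound would involve `D`, hence `n`.
    obtain ⟨t, ht, -, hd, h0⟩ := enumerates_of_blocks (D := 480 * (n + 1)) (s := [1])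
      (S := (Subgroup.closure {g : Perm (Fin n) | g ∈ []} : Set (Perm (Fin n)))) hn hlenW h4 h5
      (reduceOption_silent 5) (by simp [← h2]) (by simp; omega) rfl (by simp; omega) (by simp) (by simp)
    refine ⟨[1], t, ht, ?_, fun i hi => ⟨(hd i hi).1, (hd i hi).2.trans (by omega)⟩⟩
    refine (h0 (silent 5) 1 (tr ++ (silent 1 ++ [some 0])) (by simp)).trans ?_
    simp [permInput]
  | cons g A =>
    obtain ⟨v, ws, hvws⟩ : ∃ v ws, (g :: A).flatMap permWords = v :: ws := by
      refine List.exists_cons_of_length_pos ?_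
      simp [permWords]
      omega
    have hv : v ≤ (n + 1) ^ 2 := by
      have : v ∈ (g :: A).flatMap permWords := by rw [hvws]; simp
      obtain ⟨f, -, hf⟩ := List.mem_flatMap.1 this
      simp only [permWords, List.mem_ofFn] at hf
      obtain ⟨k, rfl⟩ := hf
      exact fin_succ_le _
    obtain ⟨tr, s', h1, h2, h3, els, L, tl, hstate, hgo, hL, hnodup, hmem⟩ :=
      preprocess_spec hn hvws
    obtain ⟨bs, tr', s'', g1, g2, g3, g4, g5⟩ := enumLoop_spec hstate hgo
    -- The initial state has the identity on all levels, so nothing of the full list is missed.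
    have hall : prodList L 0 n 1 = 1 :: rest L tl (fun _ => 1) n := by
      rw [← prodList_append_rest (i := 0) (d := n) (by omega) (fun l _ hl => hL l hl)
        (fun _ _ _ => rfl)]
      simp [rest]
    rw [← hall] at g2
    obtain ⟨c, h4, h5⟩ := enumProgram_steps hf
      (Exec.seq (Exec.ifRead_some (s := ⟨fun _ => 0, fun _ _ _ => 0, v :: ws⟩) (x := .x)
        (c₂ := printOne) rfl hv (Exec.seq h1 g1)) (hwrite s''))
    have e : silent 3 ++ (silent 1 ++ (tr ++ (bs.flatten ++ tr')) ++ silent 1 ++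
        (silent 1 ++ [some 0])) =
        (silent 4 ++ tr) ++ (bs.flatten ++ (tr' ++ (silent 2 ++ [some 0]))) := by
      have e4 : silent 4 = silent 3 ++ silent 1 := rfl
      have e2 : silent 2 = silent 1 ++ silent 1 := rfl
      rw [e4, e2]
      simp only [List.append_assoc]
    rw [e, ← hvws] at h4
    have hlen : (permInput (g :: A)).length = ws.length + 2 := by
      rw [permInput, hvws]
      rfl
    have hnle : n ≤ ws.length + 1 := by
      have := congrArg List.length hvws
      simp [permWords] at this
      omega
    have hpow : ws.length + 2 ≤ (ws.length + 2) ^ 6 := Nat.le_self_pow (by omega) _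
    obtain ⟨t, ht, h0, hd, -⟩ := enumerates_of_blocks (D := 480 * (n + 1)) hn hlenW h4 h5
      (by rw [List.reduceOption_append, reduceOption_silent, h2]; rfl) g2
      (fun b hb => (g3 b hb).trans (by omega))
      (by rw [List.reduceOption_append, List.reduceOption_append, g4, reduceOption_silent]; rfl)
      (by simp; omega) hnodup hmem
    refine ⟨_, t, ht, ?_, fun i hi => ⟨(hd i hi).1, (hd i hi).2.trans (by omega)⟩⟩
    rw [hlen]
    simp only [List.length_append, List.length_replicate] at h0
    omega

end RAM

theorem mainTheorem9 :
    ∃ (P : RAM.Program) (k : ℕ) (p : Polynomial ℕ) (c C : ℝ), 0 < c ∧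
      ∀ n : ℕ, 1 ≤ n → ∀ w : ℕ, k * (Nat.log 2 n + 1) ≤ w →
        ∀ A : List (Equiv.Perm (Fin n)),
          ∃ (s : List (Equiv.Perm (Fin n))) (t : ℕ → ℕ),
            RAM.Enumerates P w (permInput A) permWords
              (Subgroup.closure {g | g ∈ A} : Set (Equiv.Perm (Fin n))) s t ∧
            t 0 ≤ p.eval (permInput A).length ∧
            ∀ i < s.length,
              c * n ≤ (t (i + 1) : ℝ) - t i ∧ (t (i + 1) : ℝ) - t i ≤ C * n := by
  refine ⟨RAM.enumProgram, 10, Polynomial.C 10000 * Polynomial.X ^ 6, 1, 2000, one_pos, ?_⟩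
  intro n hn w hw A
  obtain ⟨s, t, h1, h2, h3⟩ := RAM.enumProgram_enumerates hn hw A
  refine ⟨s, t, h1, by simpa using h2, fun i hi => ?_⟩
  obtain ⟨h4, h5⟩ := h3 i hi
  have h4' : (t i : ℝ) + n ≤ t (i + 1) := by exact_mod_cast h4
  have h5' : (t (i + 1) : ℝ) ≤ t i + 2000 * n := by exact_mod_cast h5
  constructor <;> linarith
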